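/- Identify a permutation $\pi$ of length $n$ with its plot $\{(i,\pi(i))\}$; it is *simple* if $n\ge 2$ and the only nonempty contiguous sets of indices with contiguous image are the singletons and the whole set. $\mathrm{rect}(A)$ is the smallest axes-parallel rectangle containing $A$. A point *slices* $A$ if exactly one of its coordinates lies strictly inside the corresponding side of $\mathrm{rect}(A)$ and the other lies outside the closed side; its direction (left, right, up, down) is its position relative to the rectangle. "21" and "12" denote pairs of points in decreasing, respectively increasing, position. *Wedge sawtooth alternation of length $3k$*: points $a_j,b_j,c_j$ ($1\le j\le k$), where the pairs $(a_j,b_j)$ form a sum of $k$ copies of 21 (each copy above and to the right of the previous ones, $a_j$ being the upper left point of its copy), the points $c_1,\dots,c_k$ form a decreasing sequence below all $a_j,b_j$, and $c_j$ is horizontally between $a_j$ and $b_j$; or the image of this under one of the four symmetries of the square that preserve sums of 21. *Sliced (split) wedge sawtooth alternation of length $3m$*, $m\ge 1$: obtained from a wedge sawtooth alternation of length $3m$ (oriented as described) by moving $c_1$ below all other points (type 1), or moving $b_1$ to the right of all other points (type 2), or moving $c_1$ above all other points (type 3); or the image of one of these under one of the same four symmetries. *Proper pin sequence* in a point set $S$: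 points $p_1,\dots,p_L\in S$, $L\ge2$, $p_1\neq p_2$, such that each $p_i$ ($i\ge 3$) slices $\{p_1,\dots,p_{i-1}\}$ and no point of $S$ slicing $\{p_1,\dots,p_{i-1}\}$ in the same direction lies further in that direction, and each $p_{i+1}$ ($i\ge2$) lies horizontally or vertically strictly between $\mathrm{rect}(p_1,\dots,p_{i-1})$ and $p_i$. The pins $p_1,p_2$ have no direction; $p_i$ is a *turn* if it has the same direction as $p_{i-2}$. *Spiral pin sequence with at least $s$ extensions*: a set $S$ of points, consisting of the pins of a proper pin sequence $p_1,\dots,p_L$ in $S$ (maximality is required with respect to $S$ only) without turns, together with extensions of at least $s$ distinct pins; the added points are not pins, and extensions of distinct pins share no points. An extension of $p_i$ is defined if $p_{i-1}$ and $p_i$ have directions. If these are up and right, it is of one of two types (the other cases follow by the symmetries of the square, which also carry the copies of 21 along): - Type 1: one point $q$ such that $p_i,q$ form a 21 and $\mathrm{rect}(p_i,q)$ is sliced by $p_{i-1}$ and/or $p_{i+1}$ and by no other point of $S$. - Type 2: three points $q,r,t$ such that (i) either $p_{i-1},t$ form a 21 and $p_i$ is the only pin slicing $\mathrm{rect}(p_{i-1},t)$,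 or $t,p_{i+1}$ form a 21 and $p_{i+2}$ is the only pin slicing $\mathrm{rect}(p_{i+1},t)$; (ii) $q,r$ form a 21 that is SW of $p_i$, NE of $\mathrm{rect}(p_1,\dots,p_{i-2})$, and is sliced by $t$ and by no other point of $S$; (iii) $p_{i+1}$ separates $p_i$ from $\{q,r\}$ (it lies horizontally or vertically strictly between $\mathrm{rect}(q,r)$ and $p_i$) and is the only pin slicing $\mathrm{rect}(p_i,q,r)$. **Proposition.** Let $m\ge1$ and $p,s\ge0$ be integers and $h=3mp(2s+1)$. Every simple permutation $\pi$ that contains a wedge sawtooth alternation of length $3h$ contains a sliced wedge sawtooth alternation of length $3m$, or has a proper pin sequence (in the plot of $\pi$) with at least $p$ turns, or its plot has a subset that is a spiral pin sequence with at least $s$ extensions. -/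

import Mathlib

namespace SawtoothPin

/-- Points of the plane. All notions below only use the relative order of the coordinates. -/
abbrev Pt : Type := ℤ × ℤ

/-- The plot of a permutation: the set of points `(i, π i)`. -/
def plot {n : ℕ} (π : Equiv.Perm (Fin n)) : Set Pt :=
  Set.range fun i : Fin n => (((i : ℕ) : ℤ), ((π i : ℕ) : ℤ))

/-- A permutation is simple if it has length at least two and its only intervals (nonempty
contiguous sets of indices whose image is contiguous) are the singletons and the whole set. -/
def IsSimple {n : ℕ} (π : Equiv.Perm (Fin n)) : Prop :=
  2 ≤ n ∧ ∀ I : Set (Fin n), I.Nonempty → I.OrdConnected → (π '' I).OrdConnected →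
    (∃ i, I = {i}) ∨ I = Set.univ

/-! ### Wedge sawtooth alternations -/

/-- The symmetries of the square under which a sum of copies of 21 remains a sum of copies of 21:
the identity, the reflection in the main diagonal, the half turn, and the reflection in the
other diagonal. -/
def sumSymmetries : Set (Pt → Pt) :=
  {fun z => z, fun z => (z.2, z.1), fun z => (-z.1, -z.2), fun z => (-z.2, -z.1)}

/-- The pairs `(a j, b j)` form a sum of `k` copies of 21, `a j` being the `2` and `b j` the `1`
of the `j`-th copy. -/
def IsSumOf21 {k : ℕ} (a b : Fin k → Pt) : Prop :=
  (∀ j, (a j).1 < (b j).1 ∧ (b j).2 < (a j).2) ∧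
  ∀ i j, i < j → (b i).1 < (a j).1 ∧ (a i).2 < (b j).2

/-- A wedge sawtooth alternation of length `3 * k` in standard orientation: a sum of `k` copies
`(a j, b j)` of 21, placed above a decreasing sequence of `k` points `c j`, where `c j` slices
the `j`-th copy of 21. -/
def IsWedge {k : ℕ} (a b c : Fin k → Pt) : Prop :=
  IsSumOf21 a b ∧
  (∀ j, (a j).1 < (c j).1 ∧ (c j).1 < (b j).1) ∧
  (∀ i j, (c i).2 < (b j).2) ∧
  ∀ i j, i < j → (c j).2 < (c i).2

/-- `π` contains a wedge sawtooth alternation of length `3 * k`, in one of its four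
orientations. -/
def ContainsWedge {n : ℕ} (π : Equiv.Perm (Fin n)) (k : ℕ) : Prop :=
  ∃ g ∈ sumSymmetries, ∃ a b c : Fin k → Pt,
    (∀ j, a j ∈ plot π ∧ b j ∈ plot π ∧ c j ∈ plot π) ∧
    IsWedge (fun j => g (a j)) (fun j => g (b j)) (fun j => g (c j))

/-- Type 1 sliced wedge sawtooth alternation in standard orientation. The points `u, w, v` are
the `3`, the `1` and the `2` of the leftmost 312; the remaining triples `a j, c j, b j` are as in
a wedge sawtooth alternation, and the `1` is pulled below the whole monotone sequence. -/
def IsSlicedWedge₁ {k : ℕ} (u w v : Pt) (a b c : Fin k → Pt) : Prop :=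
  IsWedge a b c ∧
  (u.1 < w.1 ∧ w.1 < v.1 ∧ ∀ j, v.1 < (a j).1) ∧
  (w.2 < v.2 ∧ v.2 < u.2 ∧ ∀ j, w.2 < (c j).2 ∧ (c j).2 < v.2 ∧ u.2 < (b j).2)

/-- Type 2: the `2` of the leftmost 312 is pulled to the right of all other points. -/
def IsSlicedWedge₂ {k : ℕ} (u w v : Pt) (a b c : Fin k → Pt) : Prop :=
  IsWedge a b c ∧
  (u.1 < w.1 ∧ w.1 < v.1 ∧ ∀ j, w.1 < (a j).1 ∧ (b j).1 < v.1) ∧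
  (w.2 < v.2 ∧ v.2 < u.2 ∧ ∀ j, (c j).2 < w.2 ∧ u.2 < (b j).2)

/-- Type 3: the `1` of the leftmost 312 is replaced by a new maximum. -/
def IsSlicedWedge₃ {k : ℕ} (u w v : Pt) (a b c : Fin k → Pt) : Prop :=
  IsWedge a b c ∧
  (u.1 < w.1 ∧ w.1 < v.1 ∧ ∀ j, v.1 < (a j).1) ∧
  (v.2 < u.2 ∧ u.2 < w.2 ∧ ∀ j, (c j).2 < v.2 ∧ u.2 < (b j).2 ∧ (a j).2 < w.2)

/-- `π` contains a sliced wedge sawtooth alternation of length `3 * m`, of one of the three types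
and in one of the four orientations. -/
def ContainsSlicedWedge {n : ℕ} (π : Equiv.Perm (Fin n)) (m : ℕ) : Prop :=
  ∃ k, m = k + 1 ∧ ∃ g ∈ sumSymmetries, ∃ (u w v : Pt) (a b c : Fin k → Pt),
    (u ∈ plot π ∧ w ∈ plot π ∧ v ∈ plot π) ∧
    (∀ j, a j ∈ plot π ∧ b j ∈ plot π ∧ c j ∈ plot π) ∧
    (IsSlicedWedge₁ (g u) (g w) (g v) (fun j => g (a j)) (fun j => g (b j)) (fun j => g (c j)) ∨
     IsSlicedWedge₂ (g u) (g w) (g v) (fun j => g (a j)) (fun j => g (b j)) (fun j => g (c j)) ∨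
     IsSlicedWedge₃ (g u) (g w) (g v) (fun j => g (a j)) (fun j => g (b j)) (fun j => g (c j)))

/-! ### Slicing and pin sequences -/

/-- The four directions of pins. -/
inductive Dir : Type
  | left | right | up | down

/-- How far a point lies in a given direction. -/
def Dir.along : Dir → Pt → ℤ
  | .left, z => -z.1
  | .right, z => z.1
  | .up, z => z.2
  | .down, z => -z.2

/-- The coordinate of a point perpendicular to a given direction. -/
def Dir.cross : Dir → Pt → ℤ
  | .left, z => z.2
  | .right, z => z.2
  | .up, z => z.1
  | .down, z => z.1

/-- `z` slices the rectangular hull of `A` and lies in direction `d` of it. For instance, for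
`d = right` it lies to the right of the hull, and its height is strictly between the bottom and
the top of the hull. -/
def SlicesFrom (d : Dir) (A : Set Pt) (z : Pt) : Prop :=
  (∀ u ∈ A, d.along u < d.along z) ∧
  (∃ u ∈ A, d.cross u < d.cross z) ∧ ∃ v ∈ A, d.cross z < d.cross v

/-- `z` slices (the rectangular hull of) `A`, vertically or horizontally. -/
def Slices (A : Set Pt) (z : Pt) : Prop := ∃ d, SlicesFrom d A z

/-- `z` separates `w` from `A`: it lies horizontally or vertically strictly between the
rectangular hull of `A` and `w`. -/
def Separates (z w : Pt) (A : Set Pt) : Prop :=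
  ∃ d : Dir, (∀ u ∈ A, d.along u < d.along z) ∧ d.along z < d.along w

/-- The set of the first `i` points `p 0, …, p (i - 1)` of a sequence. -/
def initial (p : ℕ → Pt) (i : ℕ) : Set Pt := p '' {j | j < i}

/-- The pin `p i` has direction `d`. The first two pins `p 0` and `p 1` have no direction. -/
def HasDir (p : ℕ → Pt) (i : ℕ) (d : Dir) : Prop :=
  2 ≤ i ∧ SlicesFrom d (initial p i) (p i)

/-- `p 0, …, p (L - 1)` is a proper pin sequence in the point set `S` (the plot of a permutation,
or a set of points of a plot, regarded as a permutation in its own right). -/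
structure IsProperPinSeq (S : Set Pt) (L : ℕ) (p : ℕ → Pt) : Prop where
  two_le : 2 ≤ L
  mem : ∀ i < L, p i ∈ S
  ne : p 0 ≠ p 1
  slices : ∀ i < L, 2 ≤ i → Slices (initial p i) (p i)
  maximality : ∀ i < L, ∀ d, HasDir p i d →
    ∀ z ∈ S, SlicesFrom d (initial p i) z → d.along z ≤ d.along (p i)
  separation : ∀ i, 1 ≤ i → i + 1 < L → Separates (p (i + 1)) (p i) (initial p i)

/-- The pin `p i` turns: it has the same direction as the last but one pin before it. -/
def IsTurn (p : ℕ → Pt) (i : ℕ) : Prop :=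
  ∃ d, HasDir p (i - 2) d ∧ HasDir p i d

/-- `π` contains a proper pin sequence with at least `t` turns. -/
def ContainsPinSeqWithTurns {n : ℕ} (π : Equiv.Perm (Fin n)) (t : ℕ) : Prop :=
  ∃ (L : ℕ) (p : ℕ → Pt), IsProperPinSeq (plot π) L p ∧
    ∃ T : Finset ℕ, t ≤ T.card ∧ ∀ i ∈ T, i < L ∧ IsTurn p i

/-! ### Spiral pin sequences with extensions -/

/-- For perpendicular directions `d`, `e`, the points `z`, `w` form the image of a copy of 21
under the symmetry of the square that takes up to `d` and right to `e`. -/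
def Forms21 (d e : Dir) (z w : Pt) : Prop :=
  (d.along z < d.along w ∧ e.along w < e.along z) ∨
  (d.along w < d.along z ∧ e.along z < e.along w)

/-- In the point set `S`, the point `q` is a type 1 extension of the pin `p i` of the pin sequence
`p 0, …, p (L - 1)`. Here `d`, `e` are the directions of `p (i - 1)` and `p i`; the typical case
is `d = up`, `e = right`. -/
def IsExt₁ (S : Set Pt) (L : ℕ) (p : ℕ → Pt) (i : ℕ) (q : Pt) : Prop :=
  ∃ d e, HasDir p (i - 1) d ∧ HasDir p i e ∧
    Forms21 d e (p i) q ∧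
    (Slices {p i, q} (p (i - 1)) ∨ (i + 1 < L ∧ Slices {p i, q} (p (i + 1)))) ∧
    ∀ z ∈ S, Slices {p i, q} z → z = p (i - 1) ∨ (i + 1 < L ∧ z = p (i + 1))

/-- In the point set `S`, the points `q, r, s` form a type 2 extension of the pin `p i` of the pin
sequence `p 0, …, p (L - 1)`. Here `d`, `e` are the directions of `p (i - 1)` and `p i`; the
typical case is `d = up`, `e = right`, in which `q` and `r` are SW of `p i` and NE of the
rectangular hull of all pins before `p (i - 1)`. -/
def IsExt₂ (S : Set Pt) (L : ℕ) (p : ℕ → Pt) (i : ℕ) (q r s : Pt) : Prop :=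
  ∃ d e, HasDir p (i - 1) d ∧ HasDir p i e ∧
    ((Forms21 d e (p (i - 1)) s ∧
        ∀ j < L, Slices {p (i - 1), s} (p j) ↔ j = i) ∨
      (i + 2 < L ∧ Forms21 d e s (p (i + 1)) ∧
        ∀ j < L, Slices {p (i + 1), s} (p j) ↔ j = i + 2)) ∧
    (Forms21 d e q r ∧
      (∀ z ∈ ({q, r} : Set Pt), (d.along z < d.along (p i) ∧ e.along z < e.along (p i)) ∧
        ∀ u ∈ initial p (i - 1), d.along u < d.along z ∧ e.along u < e.along z) ∧
      ∀ z ∈ S, Slices {q, r} z ↔ z = s) ∧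
    (i + 1 < L ∧ Separates (p (i + 1)) (p i) {q, r} ∧
      ∀ j < L, Slices {p i, q, r} (p j) ↔ j = i + 1)

/-- The point set `S` is a spiral pin sequence with (at least) `k` extensions: it consists of the
pins `p 0, …, p (L - 1)` of a turn-free proper pin sequence, together with, for each `i` in a set
`E` of at least `k` indices of pins, the additional points `X i` of an extension of `p i`. -/
def IsExtendedSpiral (S : Set Pt) (k : ℕ) : Prop :=
  ∃ (L : ℕ) (p : ℕ → Pt) (E : Finset ℕ) (X : ℕ → Set Pt),
    IsProperPinSeq S L p ∧ (∀ i < L, ¬ IsTurn p i) ∧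
    k ≤ E.card ∧ (∀ i ∈ E, i < L) ∧
    S = initial p L ∪ ⋃ i ∈ E, X i ∧
    (∀ i ∈ E, Disjoint (X i) (initial p L)) ∧
    (∀ i ∈ E, ∀ j ∈ E, i ≠ j → Disjoint (X i) (X j)) ∧
    ∀ i ∈ E, (∃ q, X i = {q} ∧ IsExt₁ S L p i q) ∨
      ∃ q r s, X i = {q, r, s} ∧ IsExt₂ S L p i q r s

/-- `π` contains a spiral pin sequence with at least `k` extensions. -/
def ContainsExtendedSpiral {n : ℕ} (π : Equiv.Perm (Fin n)) (k : ℕ) : Prop :=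
  ∃ S : Set Pt, S ⊆ plot π ∧ IsExtendedSpiral S k

end SawtoothPin

/-!
Let `x` and `y` be the directions of the axes of the wedge, so that its copies of 21 go up in
direction `y` as they go on in direction `x`, and its decreasing points lie below them. As the
permutation is simple, a proper pin sequence leads from the first copy of 21 to the furthest point
in direction `x` (`exists_properPinSeq`). In the end it has passed all triples of the wedge, whereas
its first two pins touch only the first one.

A pin that newly touches `m` triples slices a 21 of earlier pins from beyond `m - 1` of these
triples, and these points form a sliced wedge sawtooth alternation
(`containsSlicedWedge_of_newly_touched`). Otherwise many pins touch new triples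
(`DirWedge.le_card_touchingPins`). If moreover there are fewer than `p` turns, then by the
pigeonhole principle `6 * s + 4` of these pins lie in a stretch without turns. Such a stretch is a
spiral. The pins that point away from the wedge touch nothing new, so touching pins six apart in
the list of all touching pins are at least eight apart in the spiral, with room left at both ends
(`DirWedge.exists_isExtendedSpiral`).

The pin sequence is chosen with the greatest number of turns among those with the same first two
pins and the same last pin. This excludes shortcuts: a point that could follow a pin of the spiral
and lies beyond the pin four places later, in the direction of the pin before, would give a pin
sequence with more turns (`exists_more_turns`). Let a pin of the spiral touch a new triple, and
consider the three consecutive pins of which the middle one points in direction `x`. A point of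
the triple beyond the expected turn of the spiral is a type 1 extension, as shortcuts are excluded.
If there is none, then the triple lies in a single turn of the spiral. Its points are then compared
with the pins nearby: either one of them is a type 1 extension, possibly after one or two pins have
been replaced by the other points of the triple, or all three form a type 2 extension
(`TightSpiral.extendable_of_clockwise`, `TightSpiral.extendable_of_anticlockwise`).

All these changes are local. A point lodged between two stages of a spiral slices nothing that lies
well inside or well outside of it, and replacing pins at stages at least six pins apart leaves the
rest of the spiral in order, so all extensions are obtained at once
(`isExtendedSpiral_of_stageExt`).
-/

namespace SawtoothPin

/-! ### Directions -/

/-- The opposite direction. -/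
def Dir.opp : Dir → Dir
  | .left => .right
  | .right => .left
  | .up => .down
  | .down => .up

/-- Two directions are perpendicular. -/
def Perp (d e : Dir) : Prop := e ≠ d ∧ e ≠ d.opp

@[simp] theorem Dir.opp_opp (d : Dir) : d.opp.opp = d := by cases d <;> rfl

theorem Dir.opp_ne (d : Dir) : d.opp ≠ d := by cases d <;> simp [Dir.opp]

@[simp] theorem Dir.along_opp (d : Dir) (z : Pt) : d.opp.along z = -d.along z := by
  cases d <;> simp [Dir.opp, Dir.along]

theorem Perp.symm {d e : Dir} (h : Perp d e) : Perp e d := by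
  revert h; cases d <;> cases e <;> simp [Perp, Dir.opp]

theorem Perp.opp_left {d e : Dir} (h : Perp d e) : Perp d.opp e := by
  revert h; cases d <;> cases e <;> simp [Perp, Dir.opp]

theorem Perp.opp_right {d e : Dir} (h : Perp d e) : Perp d e.opp := by
  revert h; cases d <;> cases e <;> simp [Perp, Dir.opp]

/-- The four directions are those of any perpendicular pair and their opposites. -/
theorem Perp.cases {d e : Dir} (h : Perp d e) (c : Dir) :
    c = d ∨ c = e ∨ c = d.opp ∨ c = e.opp := by
  revert h; cases d <;> cases e <;> cases c <;> simp [Perp, Dir.opp]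

/-- Both neighbours of a direction are perpendicular to it, so they agree up to sign. -/
theorem Perp.eq_or_eq_opp {d e f : Dir} (h : Perp d e) (h' : Perp e f) : f = d ∨ f = d.opp := by
  revert h h'; cases d <;> cases e <;> cases f <;> simp [Perp, Dir.opp]

/-- `Dir.cross` may be replaced by the coordinate along any perpendicular direction: slicing is
symmetric under reversing that coordinate. -/
theorem slicesFrom_iff {d e : Dir} (h : Perp d e) {A : Set Pt} {z : Pt} :
    SlicesFrom d A z ↔ (∀ u ∈ A, d.along u < d.along z) ∧
      (∃ u ∈ A, e.along u < e.along z) ∧ ∃ v ∈ A, e.along z < e.along v := by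
  revert h
  cases d <;> cases e <;> simp [Perp, Dir.opp, SlicesFrom, Dir.along, Dir.cross] <;> tauto

theorem SlicesFrom.dir_unique {d e : Dir} {A : Set Pt} {z : Pt} (h : SlicesFrom d A z)
    (h' : SlicesFrom e A z) : d = e := by
  by_contra hne
  obtain ⟨u, hu, -⟩ := h.2.1
  by_cases ho : e = d.opp
  · subst ho
    have h1 := h.1 u hu
    have h2 := h'.1 u hu
    rw [Dir.along_opp, Dir.along_opp] at h2
    omega
  · obtain ⟨-, -, v, hv, hv'⟩ := (slicesFrom_iff (show Perp d e from ⟨Ne.symm hne, ho⟩)).1 h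
    have := h'.1 v hv
    omega

/-- A point that lies strictly on one side of `A` in both coordinates does not slice `A`. -/
theorem not_slices_of_corner {d e : Dir} (h : Perp d e) {A : Set Pt} {z : Pt}
    (hA : ∀ u ∈ A, d.along u < d.along z ∧ e.along u < e.along z) : ¬ Slices A z := by
  rintro ⟨f, hf⟩
  have key : ∀ {c c' : Dir}, Perp c c' → (∀ u ∈ A, c.along u < c.along z) →
      f = c' ∨ f = c'.opp → False := by
    intro c c' hc hA' hf'
    have hp : Perp f c := by
      rcases hf' with rfl | rfl
      · exact hc.symm
      · exact hc.symm.opp_left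
    obtain ⟨-, -, v, hv, hv'⟩ := (slicesFrom_iff hp).1 hf
    have := hA' v hv
    omega
  rcases h.cases f with hf' | hf' | hf' | hf'
  · exact key h.symm (fun u hu => (hA u hu).2) (Or.inl hf')
  · exact key h (fun u hu => (hA u hu).1) (Or.inl hf')
  · exact key h.symm (fun u hu => (hA u hu).2) (Or.inr hf')
  · exact key h (fun u hu => (hA u hu).1) (Or.inr hf')

theorem not_slices_of_mem {A : Set Pt} {z : Pt} (h : z ∈ A) : ¬ Slices A z := by
  rintro ⟨f, hf⟩
  exact lt_irrefl _ (hf.1 z h)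

/-! ### Proper pin sequences -/

theorem mem_initial {p : ℕ → Pt} {i j : ℕ} (h : j < i) : p j ∈ initial p i := ⟨j, h, rfl⟩

theorem initial_mono (p : ℕ → Pt) {i j : ℕ} (h : i ≤ j) : initial p i ⊆ initial p j := by
  rintro _ ⟨k, hk, rfl⟩
  exact mem_initial (lt_of_lt_of_le hk h)

theorem initial_congr {p q : ℕ → Pt} {i : ℕ} (h : ∀ j < i, p j = q j) :
    initial p i = initial q i := by
  ext z
  constructor
  · rintro ⟨j, hj, rfl⟩
    exact ⟨j, hj, (h j hj).symm⟩
  · rintro ⟨j, hj, rfl⟩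
    exact ⟨j, hj, h j hj⟩

/-- A point that slices two points separates the second from the first. -/
theorem separates_of_slices_two {p : ℕ → Pt} {z : Pt} (h : Slices (initial p 2) z) :
    Separates z (p 1) (initial p 1) := by
  obtain ⟨d, -, ⟨u, ⟨j, hj, rfl⟩, hu⟩, v, ⟨k, hk, rfl⟩, hv⟩ := h
  have hcross : ∃ e : Dir, d.cross = e.along := by
    cases d
    · exact ⟨.up, rfl⟩
    · exact ⟨.up, rfl⟩
    · exact ⟨.right, rfl⟩
    · exact ⟨.right, rfl⟩
  obtain ⟨e, he⟩ := hcross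
  rw [he] at hu hv
  have key : ∀ e : Dir, e.along (p 0) < e.along z → e.along z < e.along (p 1) →
      Separates z (p 1) (initial p 1) := by
    intro e h0 h1
    refine ⟨e, ?_, h1⟩
    rintro _ ⟨j, hj, rfl⟩
    change j < 1 at hj
    obtain rfl : j = 0 := by omega
    exact h0
  change j < 2 at hj
  change k < 2 at hk
  interval_cases j <;> interval_cases k
  · omega
  · exact key e hu hv
  · refine key e.opp ?_ ?_ <;> simp only [Dir.along_opp] <;> omega
  · omega

open Classical in
/-- The direction of the pin `p i`, with an arbitrary value if it has none. -/
noncomputable def dirOf (p : ℕ → Pt) (i : ℕ) : Dir :=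
  if h : ∃ d, SlicesFrom d (initial p i) (p i) then h.choose else .right

theorem HasDir.dirOf_eq {p : ℕ → Pt} {i : ℕ} {d : Dir} (h : HasDir p i d) : dirOf p i = d := by
  have h' : ∃ d, SlicesFrom d (initial p i) (p i) := ⟨d, h.2⟩
  rw [dirOf, dif_pos h']
  exact h'.choose_spec.dir_unique h.2

namespace IsProperPinSeq

variable {S : Set Pt} {L : ℕ} {p : ℕ → Pt}

theorem hasDir (h : IsProperPinSeq S L p) {i : ℕ} (hi : 2 ≤ i) (hL : i < L) :
    HasDir p i (dirOf p i) := by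
  obtain ⟨d, hd⟩ := h.slices i hL hi
  have h' : HasDir p i d := ⟨hi, hd⟩
  rwa [h'.dirOf_eq]

theorem beyond (h : IsProperPinSeq S L p) {i j : ℕ} (hi : 2 ≤ i) (hL : i < L) (hj : j < i) :
    (dirOf p i).along (p j) < (dirOf p i).along (p i) :=
  (h.hasDir hi hL).2.1 _ (mem_initial hj)

/-- A pin separates its predecessor from the earlier pins in the direction of the predecessor. -/
theorem separates_dirOf (h : IsProperPinSeq S L p) {i : ℕ} (hi : 2 ≤ i) (hL : i + 1 < L) :
    (∀ u ∈ initial p i, (dirOf p i).along u < (dirOf p i).along (p (i + 1))) ∧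
      (dirOf p i).along (p (i + 1)) < (dirOf p i).along (p i) := by
  obtain ⟨d, hd, hd'⟩ := h.separation i (by omega) hL
  have hs := (h.hasDir hi (by omega)).2
  suffices dirOf p i = d by rw [this]; exact ⟨hd, hd'⟩
  by_contra hne
  by_cases ho : d = (dirOf p i).opp
  · have h0 := hd (p 0) (mem_initial (by omega))
    have h1 := hs.1 (p 0) (mem_initial (by omega))
    subst ho
    simp only [Dir.along_opp] at h0 hd'
    omega
  · obtain ⟨-, -, v, hv, hv'⟩ := (slicesFrom_iff ⟨Ne.symm hne, ho⟩).1 hs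
    have := hd v hv
    omega

theorem between_left (h : IsProperPinSeq S L p) {i j : ℕ} (hi : 2 ≤ i) (hL : i + 1 < L)
    (hj : j < i) : (dirOf p i).along (p j) < (dirOf p i).along (p (i + 1)) :=
  (h.separates_dirOf hi hL).1 _ (mem_initial hj)

theorem between_right (h : IsProperPinSeq S L p) {i : ℕ} (hi : 2 ≤ i) (hL : i + 1 < L) :
    (dirOf p i).along (p (i + 1)) < (dirOf p i).along (p i) :=
  (h.separates_dirOf hi hL).2

theorem perp (h : IsProperPinSeq S L p) {i : ℕ} (hi : 2 ≤ i) (hL : i + 1 < L) :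
    Perp (dirOf p i) (dirOf p (i + 1)) := by
  have h1 := h.between_right hi hL
  have h2 := h.between_left hi hL (j := 0) (by omega)
  constructor <;> intro he
  · have := h.beyond (i := i + 1) (j := i) (by omega) hL (by omega)
    rw [he] at this
    omega
  · have := h.beyond (i := i + 1) (j := 0) (by omega) hL (by omega)
    rw [he, Dir.along_opp, Dir.along_opp] at this
    omega

theorem isTurn_iff (h : IsProperPinSeq S L p) {i : ℕ} (hL : i < L) :
    IsTurn p i ↔ 4 ≤ i ∧ dirOf p (i - 2) = dirOf p i := by
  constructor
  · rintro ⟨d, h1, h2⟩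
    refine ⟨?_, by rw [h1.dirOf_eq, h2.dirOf_eq]⟩
    have := h1.1
    omega
  · rintro ⟨hi, he⟩
    refine ⟨dirOf p i, ?_, h.hasDir (by omega) hL⟩
    rw [← he]
    exact h.hasDir (by omega) (by omega)

theorem dirOf_eq_opp (h : IsProperPinSeq S L p) {i : ℕ} (hi : 2 ≤ i) (hL : i + 2 < L)
    (ht : ¬ IsTurn p (i + 2)) : dirOf p (i + 2) = (dirOf p i).opp := by
  rcases (h.perp hi (by omega)).eq_or_eq_opp (h.perp (i := i + 1) (by omega) hL) with h1 | h1
  · refine absurd ((h.isTurn_iff hL).2 ⟨by omega, ?_⟩) ht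
    simpa using h1.symm
  · exact h1

theorem maximal (h : IsProperPinSeq S L p) {i : ℕ} (hi : 2 ≤ i) (hL : i < L) {z : Pt}
    (hz : z ∈ S) (hs : SlicesFrom (dirOf p i) (initial p i) z) :
    (dirOf p i).along z ≤ (dirOf p i).along (p i) :=
  h.maximality i hL _ (h.hasDir hi hL) z hz hs

theorem truncate (h : IsProperPinSeq S L p) {L' : ℕ} (h2 : 2 ≤ L') (hL : L' ≤ L) :
    IsProperPinSeq S L' p where
  two_le := h2
  mem i hi := h.mem i (by omega)
  ne := h.ne
  slices i hi := h.slices i (by omega)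
  maximality i hi := h.maximality i (by omega)
  separation i hi hi' := h.separation i hi (by omega)

/-- A sequence of points with prescribed directions is a proper pin sequence if each point lies
beyond all earlier ones in its direction, and in that direction its successor comes second. -/
theorem of_dir {δ : ℕ → Dir} (h2 : 2 ≤ L) (hmem : ∀ i < L, p i ∈ S) (hne : p 0 ≠ p 1)
    (hstart : 2 < L → SlicesFrom (δ 2) (initial p 2) (p 2))
    (hperp : ∀ i, 2 ≤ i → i + 1 < L → Perp (δ i) (δ (i + 1)))
    (hbeyond : ∀ i j, 2 ≤ i → i < L → j < i → (δ i).along (p j) < (δ i).along (p i))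
    (hleft : ∀ i j, 2 ≤ i → i + 1 < L → j < i → (δ i).along (p j) < (δ i).along (p (i + 1)))
    (hright : ∀ i, 2 ≤ i → i + 1 < L → (δ i).along (p (i + 1)) < (δ i).along (p i))
    (hmax : ∀ i, 2 ≤ i → i < L → ∀ z ∈ S, SlicesFrom (δ i) (initial p i) z →
      (δ i).along z ≤ (δ i).along (p i)) :
    IsProperPinSeq S L p ∧ ∀ i, 2 ≤ i → i < L → HasDir p i (δ i) := by
  have hdir : ∀ i, 2 ≤ i → i < L → HasDir p i (δ i) := by
    intro i hi hL
    refine ⟨hi, ?_⟩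
    rcases Nat.lt_or_ge i 3 with h3 | h3
    · obtain rfl : i = 2 := by omega
      exact hstart hL
    · obtain ⟨k, rfl⟩ : ∃ k, i = k + 1 := ⟨i - 1, by omega⟩
      refine (slicesFrom_iff (hperp k (by omega) hL).symm).2 ⟨?_, ?_, ?_⟩
      · rintro _ ⟨j, hj, rfl⟩
        exact hbeyond _ j hi hL hj
      · exact ⟨p 0, mem_initial (by omega), hleft k 0 (by omega) hL (by omega)⟩
      · exact ⟨p k, mem_initial (by omega), hright k (by omega) hL⟩
  refine ⟨⟨h2, hmem, hne, fun i hL hi => ⟨_, (hdir i hi hL).2⟩, ?_, ?_⟩, hdir⟩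
  · intro i hL d hd z hz hs
    have : d = δ i := hd.2.dir_unique (hdir i hd.1 hL).2
    subst this
    exact hmax i hd.1 hL z hz hs
  · intro i hi hL
    rcases Nat.lt_or_ge i 2 with h2 | h2
    · obtain rfl : i = 1 := by omega
      exact separates_of_slices_two ⟨_, (hdir 2 le_rfl hL).2⟩
    · refine ⟨δ i, ?_, hright i h2 hL⟩
      rintro _ ⟨j, hj, rfl⟩
      exact hleft i j h2 hL hj

end IsProperPinSeq

/-- Distinct points of the set have distinct abscissae and distinct ordinates. -/
def Generic (S : Set Pt) : Prop := ∀ z ∈ S, ∀ w ∈ S, ∀ d : Dir, d.along z = d.along w → z = w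

/-- Among the points of a finite set that slice `A` from `d` there is one furthest in direction
`d`. -/
theorem exists_maximal_slice {S A : Set Pt} (hfin : S.Finite) {d : Dir} {z : Pt} (hz : z ∈ S)
    (hs : SlicesFrom d A z) :
    ∃ w ∈ S, SlicesFrom d A w ∧ d.along z ≤ d.along w ∧
      ∀ v ∈ S, SlicesFrom d A v → d.along v ≤ d.along w := by
  obtain ⟨w, hw, hmax⟩ := Set.exists_max_image {v | v ∈ S ∧ SlicesFrom d A v} d.along
    (hfin.subset fun v hv => hv.1) ⟨z, hz, hs⟩
  exact ⟨w, hw.1, hw.2, hmax z ⟨hz, hs⟩, fun v hv hv' => hmax v ⟨hv, hv'⟩⟩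

/-! ### Proper pin sequences in simple point sets -/

/-- A pin sequence can be prolonged by a maximal slicing point that separates its last pin. -/
theorem IsProperPinSeq.append {S : Set Pt} {L : ℕ} {p : ℕ → Pt} (h : IsProperPinSeq S L p)
    {d : Dir} {z : Pt} (hz : z ∈ S) (hs : SlicesFrom d (initial p L) z)
    (hmax : ∀ v ∈ S, SlicesFrom d (initial p L) v → d.along v ≤ d.along z)
    (hsep : Separates z (p (L - 1)) (initial p (L - 1))) :
    IsProperPinSeq S (L + 1) (Function.update p L z) := by
  have hL := h.two_le
  have hp : ∀ i, i < L → Function.update p L z i = p i := fun i hi =>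
    Function.update_of_ne (by omega) _ _
  have hz' : Function.update p L z L = z := Function.update_self _ _ _
  have hin : ∀ i, i ≤ L → initial (Function.update p L z) i = initial p i := fun i hi =>
    initial_congr fun j hj => hp j (by omega)
  constructor
  · omega
  · intro i hi
    rcases Nat.lt_or_ge i L with h1 | h1
    · rw [hp i h1]
      exact h.mem i h1
    · obtain rfl : i = L := by omega
      rwa [hz']
  · rw [hp 0 (by omega), hp 1 (by omega)]
    exact h.ne
  · intro i hi h2
    rw [hin i (by omega)]
    rcases Nat.lt_or_ge i L with h1 | h1
    · rw [hp i h1]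
      exact h.slices i h1 h2
    · obtain rfl : i = L := by omega
      rw [hz']
      exact ⟨d, hs⟩
  · intro i hi e he w hw hws
    rw [hin i (by omega)] at hws
    have he' := he.2
    rw [hin i (by omega)] at he'
    rcases Nat.lt_or_ge i L with h1 | h1
    · rw [hp i h1] at he' ⊢
      exact h.maximality i h1 e ⟨he.1, he'⟩ w hw hws
    · obtain rfl : i = L := by omega
      rw [hz'] at he' ⊢
      obtain rfl := he'.dir_unique hs
      exact hmax w hw hws
  · intro i h1 hi
    rw [hin i (by omega), hp i (by omega)]
    rcases Nat.lt_or_ge (i + 1) L with h2 | h2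
    · rw [hp (i + 1) h2]
      exact h.separation i h1 h2
    · obtain rfl : L = i + 1 := by omega
      rw [hz']
      exact hsep

theorem isProperPinSeq_two {S : Set Pt} {x y : Pt} (hx : x ∈ S) (hy : y ∈ S) (hxy : x ≠ y) :
    IsProperPinSeq S 2 (fun i => if i = 0 then x else y) where
  two_le := le_rfl
  mem i _ := by by_cases h : i = 0 <;> simp [h, hx, hy]
  ne := by simpa using hxy
  slices i hi h2 := by omega
  maximality i hi d hd := by
    have := hd.1
    omega
  separation i h1 h2 := by omega

/-- The form in which simplicity is used: a subset with at least two points that misses an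
extreme point is sliced. -/
def SimpleSet (S : Set Pt) : Prop :=
  ∀ A ⊆ S, (∃ u ∈ A, ∃ v ∈ A, u ≠ v) →
    (∃ e ∈ S, e ∉ A ∧ ∃ d : Dir, ∀ u ∈ S, d.along u ≤ d.along e) →
    ∃ d, ∃ z ∈ S, SlicesFrom d A z

/-- In a simple set, a proper pin sequence leads from any two points to any extreme point. The
set of all points on such sequences has no slicing point: if there were one, then the furthest
point slicing the shortest possible initial part of a sequence could be appended to that part. -/
theorem exists_properPinSeq {S : Set Pt} (hfin : S.Finite) (hgen : Generic S)
    (hsimple : SimpleSet S) {x y e : Pt} (hx : x ∈ S) (hy : y ∈ S) (hxy : x ≠ y) (he : e ∈ S)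
    (hex : e ≠ x) {d₀ : Dir} (hd₀ : ∀ u ∈ S, d₀.along u ≤ d₀.along e) :
    ∃ L p, IsProperPinSeq S L p ∧ p 0 = x ∧ p 1 = y ∧ p (L - 1) = e := by
  classical
  by_contra hcon
  set Q : Set Pt := {z | ∃ L p, IsProperPinSeq S L p ∧ p 0 = x ∧ p 1 = y ∧ ∃ i < L, p i = z}
  have hQS : Q ⊆ S := by
    rintro z ⟨L, p, hp, -, -, i, hi, rfl⟩
    exact hp.mem i hi
  have heQ : e ∉ Q := by
    rintro ⟨L, p, hp, h0, h1, i, hi, rfl⟩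
    have hi0 : i ≠ 0 := by
      rintro rfl
      exact hex h0
    exact hcon ⟨i + 1, p, hp.truncate (by omega) (by omega), h0, h1, by simp⟩
  have hxQ : x ∈ Q :=
    ⟨2, _, isProperPinSeq_two hx hy hxy, by simp, by simp, 0, by norm_num, by simp⟩
  have hyQ : y ∈ Q :=
    ⟨2, _, isProperPinSeq_two hx hy hxy, by simp, by simp, 1, by norm_num, by simp⟩
  obtain ⟨d, z, hz, hs⟩ := hsimple Q hQS ⟨x, hxQ, y, hyQ, hxy⟩ ⟨e, he, heQ, d₀, hd₀⟩
  obtain ⟨c, hc⟩ : ∃ c : Dir, Perp d c := by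
    cases d
    · exact ⟨.up, by simp [Perp, Dir.opp]⟩
    · exact ⟨.up, by simp [Perp, Dir.opp]⟩
    · exact ⟨.right, by simp [Perp, Dir.opp]⟩
    · exact ⟨.right, by simp [Perp, Dir.opp]⟩
  have hex : ∃ i, ∃ L p, ∃ z ∈ S, IsProperPinSeq S L p ∧ p 0 = x ∧ p 1 = y ∧ 2 ≤ i ∧ i ≤ L ∧
      SlicesFrom d (initial p i) z ∧ ∀ q ∈ Q, d.along q < d.along z := by
    obtain ⟨hQz, ⟨u, hu, huz⟩, v, hv, hvz⟩ := (slicesFrom_iff hc).1 hs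
    have hxz : c.along x ≠ c.along z := by
      intro h
      have := hQz x hxQ
      rw [hgen x hx z hz c h] at this
      exact lt_irrefl _ this
    rcases lt_or_gt_of_ne hxz with hlt | hlt
    · obtain ⟨L, p, hp, h0, h1, i, hi, rfl⟩ := hv
      refine ⟨L, L, p, z, hz, hp, h0, h1, hp.two_le, le_rfl, (slicesFrom_iff hc).2 ⟨?_,
        ⟨p 0, mem_initial (by have := hp.two_le; omega), by rwa [h0]⟩,
        p i, mem_initial hi, hvz⟩, hQz⟩
      rintro _ ⟨j, hj, rfl⟩
      exact hQz _ ⟨L, p, hp, h0, h1, j, hj, rfl⟩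
    · obtain ⟨L, p, hp, h0, h1, i, hi, rfl⟩ := hu
      refine ⟨L, L, p, z, hz, hp, h0, h1, hp.two_le, le_rfl, (slicesFrom_iff hc).2 ⟨?_,
        ⟨p i, mem_initial hi, huz⟩,
        p 0, mem_initial (by have := hp.two_le; omega), by rwa [h0]⟩, hQz⟩
      rintro _ ⟨j, hj, rfl⟩
      exact hQz _ ⟨L, p, hp, h0, h1, j, hj, rfl⟩
  obtain ⟨L, p, z, hz, hp, h0, h1, h2, hL, hs, hQz⟩ := Nat.find_spec hex
  have hmin := fun i (hi : i < Nat.find hex) => Nat.find_min hex hi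
  generalize Nat.find hex = i at *
  obtain ⟨w, hw, hws, hzw, hmax⟩ := exists_maximal_slice hfin hz hs
  have hQw : ∀ q ∈ Q, d.along q < d.along w := fun q hq => lt_of_lt_of_le (hQz q hq) hzw
  have hpi := hp.truncate h2 hL
  have hsep : Separates w (p (i - 1)) (initial p (i - 1)) := by
    rcases Nat.lt_or_ge i 3 with h3 | h3
    · obtain rfl : i = 2 := by omega
      exact separates_of_slices_two ⟨d, hws⟩
    · obtain ⟨k, rfl⟩ : ∃ k, i = k + 1 := ⟨i - 1, by omega⟩
      simp only [Nat.add_sub_cancel]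
      have hnot : ¬ SlicesFrom d (initial p k) w := fun h =>
        hmin k (by omega) ⟨L, p, w, hw, hp, h0, h1, by omega, by omega, h, hQw⟩
      have hne : ∀ j < k, c.along (p j) ≠ c.along w := by
        intro j hj h
        have h' := hws.1 (p j) (mem_initial (by omega))
        rw [hgen _ (hp.mem j (by omega)) w hw c h] at h'
        exact lt_irrefl _ h'
      obtain ⟨hb, ⟨_, ⟨a, ha, rfl⟩, hua⟩, _, ⟨b, hb', rfl⟩, hvb⟩ := (slicesFrom_iff hc).1 hws
      change a < k + 1 at ha
      change b < k + 1 at hb'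
      rw [slicesFrom_iff hc] at hnot
      by_cases hlow : ∃ j < k, c.along (p j) < c.along w
      · have hhigh : ∀ j < k, ¬ c.along w < c.along (p j) := by
          intro j hj h
          obtain ⟨j', hj', h'⟩ := hlow
          exact hnot ⟨fun u hu => hb u (initial_mono p (by omega) hu),
            ⟨_, mem_initial hj', h'⟩, _, mem_initial hj, h⟩
        obtain rfl : b = k := by
          by_contra hbk
          exact hhigh b (by omega) hvb
        refine ⟨c, ?_, hvb⟩
        rintro _ ⟨j, hj, rfl⟩
        exact lt_of_le_of_ne (not_lt.1 (hhigh j hj)) (hne j hj)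
      · push Not at hlow
        obtain rfl : a = k := by
          by_contra hak
          have := hlow a (by omega)
          omega
        refine ⟨c.opp, ?_, by simpa using hua⟩
        rintro _ ⟨j, hj, rfl⟩
        have h4 := hlow j hj
        have h5 := hne j hj
        rw [Dir.along_opp, Dir.along_opp]
        omega
  have hnew := hpi.append hw hws hmax hsep
  have hwQ : w ∈ Q := by
    refine ⟨i + 1, _, hnew, ?_, ?_, i, by omega, Function.update_self _ _ _⟩
    · rw [Function.update_of_ne (by omega), h0]
    · rw [Function.update_of_ne (by omega), h1]
  exact lt_irrefl _ (hQw w hwQ)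

/-! ### The plot of a simple permutation -/

theorem plot_finite {n : ℕ} (π : Equiv.Perm (Fin n)) : (plot π).Finite := Set.finite_range _

theorem plot_generic {n : ℕ} (π : Equiv.Perm (Fin n)) : Generic (plot π) := by
  rintro _ ⟨i, rfl⟩ _ ⟨j, rfl⟩ d h
  have : i = j := by
    cases d <;> simp [Dir.along] at h
    · exact Fin.ext h
    · exact Fin.ext h
    · exact π.injective (Fin.ext h)
    · exact π.injective (Fin.ext h)
  rw [this]

/-- The points of the plot in the rectangular hull of a set that is not sliced form an
interval. -/
theorem plot_simpleSet {n : ℕ} {π : Equiv.Perm (Fin n)} (h : IsSimple π) :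
    SimpleSet (plot π) := by
  rintro A hA ⟨u, hu, v, hv, huv⟩ ⟨e, he, heA, d, hd⟩
  by_contra hcon
  push Not at hcon
  set pt : Fin n → Pt := fun i => (((i : ℕ) : ℤ), ((π i : ℕ) : ℤ)) with hpt
  have hmem : ∀ i, pt i ∈ plot π := fun i => ⟨i, rfl⟩
  set I : Set (Fin n) := {i | ∀ c : Dir, ∃ w ∈ A, c.along (pt i) ≤ c.along w} with hI
  have hAI : ∀ i, pt i ∈ A → i ∈ I := fun i hi c => ⟨_, hi, le_rfl⟩
  -- a point whose coordinate along `c` is strictly inside the hull lies in the hull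
  have key : ∀ (c c' : Dir), Perp c c' → ∀ i, (∃ w ∈ A, c.along w < c.along (pt i)) →
      (∃ w ∈ A, c.along (pt i) < c.along w) → i ∈ I := by
    intro c c' hc i h1 h2 f
    rcases hc.cases f with rfl | rfl | rfl | rfl
    · obtain ⟨w, hw, hw'⟩ := h2
      exact ⟨w, hw, hw'.le⟩
    · by_contra hno
      push Not at hno
      exact hcon f _ (hmem i) ((slicesFrom_iff hc.symm).2 ⟨hno, h1, h2⟩)
    · obtain ⟨w, hw, hw'⟩ := h1
      exact ⟨w, hw, by simpa using hw'.le⟩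
    · by_contra hno
      push Not at hno
      exact hcon _ _ (hmem i) ((slicesFrom_iff hc.symm.opp_left).2 ⟨hno, h1, h2⟩)
  obtain ⟨iu, rfl⟩ := hA hu
  obtain ⟨iv, rfl⟩ := hA hv
  obtain ⟨ie, rfl⟩ := he
  have hord : I.OrdConnected := by
    refine ⟨fun i hi j hj k hk => ?_⟩
    rcases eq_or_lt_of_le hk.1 with rfl | hik
    · exact hi
    rcases eq_or_lt_of_le hk.2 with rfl | hkj
    · exact hj
    obtain ⟨w, hw, hw'⟩ := hi .left
    obtain ⟨w', hw1, hw2⟩ := hj .right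
    have h1 : (i : ℕ) < k := hik
    have h2 : (k : ℕ) < j := hkj
    refine key .right .up (by simp [Perp, Dir.opp]) k ⟨w, hw, ?_⟩ ⟨w', hw1, ?_⟩ <;>
      simp only [Dir.along, hpt] at * <;> omega
  have hord' : (π '' I).OrdConnected := by
    refine ⟨?_⟩
    rintro _ ⟨i, hi, rfl⟩ _ ⟨j, hj, rfl⟩ l hl
    obtain ⟨k, rfl⟩ := π.surjective l
    refine ⟨k, ?_, rfl⟩
    rcases eq_or_lt_of_le hl.1 with hik | hik
    · rwa [← π.injective hik]
    rcases eq_or_lt_of_le hl.2 with hkj | hkj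
    · rwa [π.injective hkj]
    obtain ⟨w, hw, hw'⟩ := hi .down
    obtain ⟨w', hw1, hw2⟩ := hj .up
    have h1 : (π i : ℕ) < π k := hik
    have h2 : (π k : ℕ) < π j := hkj
    refine key .up .right (by simp [Perp, Dir.opp]) k ⟨w, hw, ?_⟩ ⟨w', hw1, ?_⟩ <;>
      simp only [Dir.along, hpt] at * <;> omega
  rcases h.2 I ⟨iu, hAI iu hu⟩ hord hord' with ⟨i, hi⟩ | huniv
  · have h1 : iu = i := by simpa [hi] using hAI iu hu
    have h2 : iv = i := by simpa [hi] using hAI iv hv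
    exact huv (by rw [h1, h2])
  · have heI : ie ∈ I := by
      rw [huniv]
      trivial
    obtain ⟨w, hw, hw'⟩ := heI d
    have := plot_generic π _ (hmem ie) w (hA hw) d (le_antisymm hw' (hd w (hA hw)))
    exact heA (by rw [← this] at hw; exact hw)

/-! ### Pin sequences with the greatest number of turns -/

open Classical in
/-- The indices of the turns among the first `L` pins. -/
noncomputable def turns (p : ℕ → Pt) (L : ℕ) : Finset ℕ := (Finset.range L).filter (IsTurn p)

theorem mem_turns {p : ℕ → Pt} {L i : ℕ} : i ∈ turns p L ↔ i < L ∧ IsTurn p i := by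
  simp [turns]

/-- A shortcut in a turn-free stretch. The pins `p (i - 1), …, p (i + 4)` spiral, and `z` lies
beyond `p (i + 4)` in the direction of `p (i - 1)` and separates `p i` from the earlier pins.
Then the pins `p (i + 1), p (i + 2), p (i + 3)` can be replaced by a single pin in the direction
of `p (i - 1)`; that pin is a turn, and no turn is lost. -/
theorem exists_more_turns {S : Set Pt} (hfin : S.Finite) (hgen : Generic S) {L : ℕ}
    {p : ℕ → Pt} (hp : IsProperPinSeq S L p) {i : ℕ} (hi : 3 ≤ i) (hL : i + 4 < L)
    (h1 : dirOf p (i + 1) = (dirOf p (i - 1)).opp) (h2 : dirOf p (i + 2) = (dirOf p i).opp)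
    (h3 : dirOf p (i + 3) = dirOf p (i - 1)) (h4 : dirOf p (i + 4) = dirOf p i) {z : Pt}
    (hz : z ∈ S) (hzl : ∀ j < i, (dirOf p i).along (p j) < (dirOf p i).along z)
    (hzr : (dirOf p i).along z < (dirOf p i).along (p i))
    (hzt : (dirOf p (i - 1)).along (p (i + 4)) < (dirOf p (i - 1)).along z) :
    ∃ L' p', IsProperPinSeq S L' p' ∧ p' 0 = p 0 ∧ p' 1 = p 1 ∧ p' (L' - 1) = p (L - 1) ∧
      (turns p L).card < (turns p' L').card := by
  classical
  obtain ⟨k, rfl⟩ : ∃ k, i = k + 1 := ⟨i - 1, by omega⟩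
  simp only [Nat.add_sub_cancel] at h1 h3 hzt
  set d := dirOf p k with hd
  set e := dirOf p (k + 1) with he
  change d.along (p (k + 5)) < d.along z at hzt
  have hde : Perp d e := hp.perp (by omega) (by omega)
  -- where the pins of the stretch lie
  have b3 : ∀ j < k + 4, d.along (p j) < d.along (p (k + 4)) := fun j hj => by
    have := hp.beyond (i := k + 1 + 3) (j := j) (by omega) (by omega) hj
    rwa [h3] at this
  have b4 : ∀ j < k + 5, e.along (p j) < e.along (p (k + 5)) := fun j hj => by
    have := hp.beyond (i := k + 1 + 4) (j := j) (by omega) (by omega) hj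
    rwa [h4] at this
  have b1 : ∀ j < k + 1, e.along (p j) < e.along (p (k + 1)) := fun j hj =>
    hp.beyond (by omega) (by omega) hj
  have s3 : ∀ j < k + 4, d.along (p j) < d.along (p (k + 5)) := fun j hj => by
    have := hp.between_left (i := k + 1 + 3) (j := j) (by omega) (by omega) hj
    rwa [h3] at this
  have s3' : d.along (p (k + 5)) < d.along (p (k + 4)) := by
    have := hp.between_right (i := k + 1 + 3) (by omega) (by omega)
    rwa [h3] at this
  have hzs : SlicesFrom d (initial p (k + 2)) z := by
    refine (slicesFrom_iff hde).2 ⟨?_, ⟨p 0, mem_initial (by omega), hzl 0 (by omega)⟩,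
      p (k + 1), mem_initial (by omega), hzr⟩
    rintro _ ⟨j, hj, rfl⟩
    change j < k + 2 at hj
    have := s3 j (by omega)
    omega
  -- the furthest possible replacement
  obtain ⟨w, hw, hws, hzw, hwmax⟩ := exists_maximal_slice hfin hz hzs
  obtain ⟨hwb, ⟨_, ⟨a, ha, rfl⟩, hau⟩, _, ⟨b, hb, rfl⟩, hbv⟩ := (slicesFrom_iff hde).1 hws
  change a < k + 2 at ha
  change b < k + 2 at hb
  have hwb' : ∀ j < k + 4, d.along (p j) < d.along w := fun j hj => by
    have := s3 j hj
    omega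
  have hwt : d.along (p (k + 5)) < d.along w := by
    omega
  have hwr : e.along w < e.along (p (k + 1)) := by
    rcases Nat.lt_or_ge b (k + 1) with h | h
    · have := b1 b h
      omega
    · obtain rfl : b = k + 1 := by omega
      exact hbv
  have hne : ∀ j < k + 4, e.along (p j) ≠ e.along w := by
    intro j hj h
    have h' := hwb' j hj
    rw [hgen _ (hp.mem j (by omega)) w hw e h] at h'
    exact lt_irrefl _ h'
  have hwl : ∀ j < k + 1, e.along (p j) < e.along w := by
    by_contra hcon
    push Not at hcon
    obtain ⟨j, hj, hj'⟩ := hcon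
    have hj2 : e.along w < e.along (p j) := lt_of_le_of_ne hj' (hne j (by omega)).symm
    have hk := (hp.hasDir (i := k) (by omega) (by omega)).2
    obtain ⟨-, ⟨_, ⟨a', ha', rfl⟩, hau'⟩, _, ⟨b', hb', rfl⟩, hbv'⟩ :=
      (slicesFrom_iff hde).1 hk
    have hsl : SlicesFrom d (initial p k) w := by
      refine (slicesFrom_iff hde).2 ⟨?_, ?_, ?_⟩
      · rintro _ ⟨l, hl, rfl⟩
        change l < k at hl
        exact hwb' l (by omega)
      · rcases Nat.lt_or_ge a k with h | h
        · exact ⟨_, mem_initial h, hau⟩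
        · have hak : a = k ∨ a = k + 1 := by omega
          rcases hak with rfl | rfl
          · exact ⟨_, mem_initial ha', hau'.trans hau⟩
          · omega
      · rcases Nat.lt_or_ge j k with h | h
        · exact ⟨_, mem_initial h, hj2⟩
        · obtain rfl : j = k := by omega
          exact ⟨_, mem_initial hb', hj2.trans hbv'⟩
    have h5 : d.along w ≤ d.along (p k) := hp.maximal (by omega) (by omega) hw hsl
    have h6 := hwb' k (by omega)
    omega
  have hwle : d.along w ≤ d.along (p (k + 4)) := by
    have := hp.maximal (i := k + 1 + 3) (z := w) (by omega) (by omega) hw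
    rw [h3] at this
    refine this ((slicesFrom_iff hde).2 ⟨?_, ⟨p 0, mem_initial (by omega), hwl 0 (by omega)⟩,
      p (k + 1), mem_initial (by omega), hwr⟩)
    rintro _ ⟨j, hj, rfl⟩
    exact hwb' j hj
  -- the new pin does not leave the hull of the pins that it replaces
  have hull : ∀ f : Dir, ∃ j < k + 5, f.along w ≤ f.along (p j) := by
    intro f
    rcases hde.cases f with rfl | rfl | rfl | rfl
    · exact ⟨k + 4, by omega, hwle⟩
    · exact ⟨k + 1, by omega, hwr.le⟩
    · refine ⟨0, by omega, ?_⟩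
      have := hwb' 0 (by omega)
      simp only [Dir.along_opp]
      omega
    · refine ⟨0, by omega, ?_⟩
      have := hwl 0 (by omega)
      simp only [Dir.along_opp]
      omega
  set q : ℕ → Pt := fun j => if j < k + 2 then p j else if j = k + 2 then w else p (j + 2)
    with hq
  set δ : ℕ → Dir := fun j =>
    if j < k + 2 then dirOf p j else if j = k + 2 then d else dirOf p (j + 2) with hδ
  have q1 : ∀ j < k + 2, q j = p j := fun j hj => by simp [hq, hj]
  have q2 : q (k + 2) = w := by simp [hq]
  have q3 : ∀ j, k + 3 ≤ j → q j = p (j + 2) := fun j hj => by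
    simp [hq, show ¬ j < k + 2 by omega, show j ≠ k + 2 by omega]
  have δ1 : ∀ j < k + 2, δ j = dirOf p j := fun j hj => by simp [hδ, hj]
  have δ2 : δ (k + 2) = d := by simp [hδ]
  have δ3 : ∀ j, k + 3 ≤ j → δ j = dirOf p (j + 2) := fun j hj => by
    simp [hδ, show ¬ j < k + 2 by omega, show j ≠ k + 2 by omega]
  have hq1 : ∀ j, j ≤ k + 2 → initial q j = initial p j := fun j hj =>
    initial_congr fun l hl => q1 l (by omega)
  have qhull : ∀ f : Dir, ∀ j l, k + 3 ≤ j → l < j →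
      ∃ m < j + 2, f.along (q l) ≤ f.along (p m) := by
    intro f j l _ hl
    rcases lt_trichotomy l (k + 2) with h | h | h
    · exact ⟨l, by omega, (congrArg _ (q1 l h)).le⟩
    · obtain ⟨m, hm, hm'⟩ := hull f
      exact ⟨m, by omega, by rwa [h, q2]⟩
    · exact ⟨l + 2, by omega, (congrArg _ (q3 l (by omega))).le⟩
  have hnew := IsProperPinSeq.of_dir (S := S) (L := L - 2) (p := q) (δ := δ) (by omega)
    (by
      intro j hj
      rcases lt_trichotomy j (k + 2) with h | h | h
      · rw [q1 j h]
        exact hp.mem j (by omega)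
      · rwa [h, q2]
      · rw [q3 j (by omega)]
        exact hp.mem _ (by omega))
    (by
      rw [q1 0 (by omega), q1 1 (by omega)]
      exact hp.ne)
    (by
      intro _
      rw [hq1 2 (by omega), δ1 2 (by omega), q1 2 (by omega)]
      exact (hp.hasDir le_rfl (by omega)).2)
    (by
      intro j hj hjL
      rcases lt_trichotomy j (k + 1) with h | h | h
      · rw [δ1 j (by omega), δ1 (j + 1) (by omega)]
        exact hp.perp hj (by omega)
      · subst h
        rw [δ1 (k + 1) (by omega), δ2]
        exact hde.symm
      · rcases Nat.lt_or_ge j (k + 3) with h' | h'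
        · obtain rfl : j = k + 2 := by omega
          rw [δ2, δ3 (k + 2 + 1) (by omega), h4]
          exact hde
        · rw [δ3 j h', δ3 (j + 1) (by omega)]
          exact hp.perp (i := j + 2) (by omega) (by omega))
    (by
      intro j l hj hjL hl
      rcases lt_trichotomy j (k + 2) with h | h | h
      · rw [δ1 j h, q1 j h, q1 l (by omega)]
        exact hp.beyond hj (by omega) hl
      · subst h
        rw [δ2, q2, q1 l hl]
        exact hwb' l (by omega)
      · rw [δ3 j (by omega), q3 j (by omega)]
        obtain ⟨m, hm, hm'⟩ := qhull (dirOf p (j + 2)) j l (by omega) hl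
        exact lt_of_le_of_lt hm' (hp.beyond (by omega) (by omega) hm))
    (by
      intro j l hj hjL hl
      rcases lt_trichotomy j (k + 1) with h | h | h
      · rw [δ1 j (by omega), q1 (j + 1) (by omega), q1 l (by omega)]
        exact hp.between_left hj (by omega) hl
      · subst h
        rw [δ1 (k + 1) (by omega), q2, q1 l (by omega)]
        exact hwl l hl
      · rcases lt_trichotomy j (k + 3) with h' | h' | h'
        · obtain rfl : j = k + 2 := by omega
          rw [δ2, q3 (k + 2 + 1) (by omega), q1 l hl]
          exact s3 l (by omega)
        · subst h'
          rw [δ3 _ (by omega), q3 (k + 3 + 1) (by omega)]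
          have h5 : ∀ m < k + 5, (dirOf p (k + 3 + 2)).along (p m) <
              (dirOf p (k + 3 + 2)).along (p (k + 3 + 1 + 2)) := fun m hm =>
            hp.between_left (i := k + 5) (by omega) (by omega) hm
          obtain ⟨m, hm, hm'⟩ := qhull (dirOf p (k + 3 + 2)) (k + 3) l (by omega) hl
          exact lt_of_le_of_lt hm' (h5 m hm)
        · rw [δ3 j (by omega), q3 (j + 1) (by omega)]
          obtain ⟨m, hm, hm'⟩ := qhull (dirOf p (j + 2)) j l (by omega) hl
          exact lt_of_le_of_lt hm' (hp.between_left (i := j + 2) (by omega) (by omega) hm))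
    (by
      intro j hj hjL
      rcases lt_trichotomy j (k + 1) with h | h | h
      · rw [δ1 j (by omega), q1 (j + 1) (by omega), q1 j (by omega)]
        exact hp.between_right hj (by omega)
      · subst h
        rw [δ1 (k + 1) (by omega), q2, q1 (k + 1) (by omega)]
        exact hwr
      · rcases Nat.lt_or_ge j (k + 3) with h' | h'
        · obtain rfl : j = k + 2 := by omega
          rw [δ2, q3 (k + 2 + 1) (by omega), q2]
          exact hwt
        · rw [δ3 j h', q3 j h', q3 (j + 1) (by omega)]
          exact hp.between_right (i := j + 2) (by omega) (by omega))
    (by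
      intro j hj hjL v hv hs
      rcases lt_trichotomy j (k + 2) with h | h | h
      · rw [δ1 j h, hq1 j (by omega)] at hs
        rw [δ1 j h, q1 j h]
        exact hp.maximal hj (by omega) hv hs
      · subst h
        rw [δ2, hq1 _ le_rfl] at hs
        rw [δ2, q2]
        exact hwmax v hv hs
      · by_contra hcon
        rw [δ3 j (by omega), q3 j (by omega)] at hcon
        rw [δ3 j (by omega)] at hs
        push Not at hcon
        have hperp := hp.perp (i := j + 1) (by omega) (by omega)
        obtain ⟨-, ⟨_, ⟨a₁, ha₁, rfl⟩, ha₂⟩, _, ⟨b₁, hb₁, rfl⟩, hb₂⟩ :=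
          (slicesFrom_iff hperp.symm).1 hs
        obtain ⟨m, hm, hm'⟩ := qhull (dirOf p (j + 1)) j b₁ (by omega) hb₁
        obtain ⟨m₂, hm₂, hm₂'⟩ := qhull (dirOf p (j + 1)).opp j a₁ (by omega) ha₁
        simp only [Dir.along_opp] at hm₂'
        have hsl : SlicesFrom (dirOf p (j + 2)) (initial p (j + 2)) v := by
          refine (slicesFrom_iff hperp.symm).2 ⟨?_, ⟨_, mem_initial hm₂, by omega⟩,
            ⟨_, mem_initial hm, by omega⟩⟩
          rintro _ ⟨l, hl, rfl⟩
          exact (hp.beyond (i := j + 2) (by omega) (by omega) hl).trans hcon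
        exact absurd (hp.maximal (by omega) (by omega) hv hsl) (not_le.2 hcon))
  obtain ⟨hprop, hdir⟩ := hnew
  have hdq : ∀ j, 2 ≤ j → j < L - 2 → dirOf q j = δ j := fun j hj hjL =>
    (hdir j hj hjL).dirOf_eq
  refine ⟨L - 2, q, hprop, q1 0 (by omega), q1 1 (by omega), ?_, ?_⟩
  · rw [q3 _ (by omega)]
    congr 1
    omega
  · -- old turns keep their places before the shortcut and move by two after it
    have hold : ∀ t ∈ turns p L, t < k + 2 ∨ k + 6 ≤ t := by
      intro t ht
      obtain ⟨htL, htt⟩ := mem_turns.1 ht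
      obtain ⟨-, ht'⟩ := (hp.isTurn_iff htL).1 htt
      by_contra hcon
      have hno : ∀ f : Dir, f ≠ f.opp := fun f h => f.opp_ne h.symm
      have hcase : t = k + 2 ∨ t = k + 3 ∨ t = k + 4 ∨ t = k + 5 := by omega
      rcases hcase with rfl | rfl | rfl | rfl
      · rw [show k + 1 + 1 = k + 2 by omega] at h1
        rw [h1] at ht'
        exact hno _ ht'
      · rw [show k + 1 + 2 = k + 3 by omega] at h2
        rw [h2] at ht'
        exact hno _ ht'
      · rw [show k + 1 + 3 = k + 4 by omega] at h3
        rw [h3, show k + 4 - 2 = k + 1 + 1 by omega, h1] at ht'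
        exact hno _ ht'.symm
      · rw [show k + 1 + 4 = k + 5 by omega] at h4
        rw [h4, show k + 5 - 2 = k + 1 + 2 by omega, h2] at ht'
        exact hno _ ht'.symm
    set σ : ℕ → ℕ := fun t => if t < k + 2 then t else t - 2 with hσ
    have hinj : Set.InjOn σ (turns p L) := by
      intro s hs t ht hst
      have h5 := hold s hs
      have h6 := hold t ht
      simp only [hσ] at hst
      split_ifs at hst <;> omega
    have hnotin : k + 2 ∉ (turns p L).image σ := by
      intro h
      obtain ⟨t, ht, ht'⟩ := Finset.mem_image.1 h
      have h5 := hold t ht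
      simp only [hσ] at ht'
      split_ifs at ht' <;> omega
    have hsub : insert (k + 2) ((turns p L).image σ) ⊆ turns q (L - 2) := by
      intro t ht
      rw [Finset.mem_insert] at ht
      rcases ht with rfl | ht
      · refine mem_turns.2 ⟨by omega, (hprop.isTurn_iff (by omega)).2 ⟨by omega, ?_⟩⟩
        rw [hdq _ (by omega) (by omega), hdq _ (by omega) (by omega), δ2,
          show k + 2 - 2 = k by omega, δ1 k (by omega)]
      · obtain ⟨t, hmem, rfl⟩ := Finset.mem_image.1 ht
        obtain ⟨htL, htt⟩ := mem_turns.1 hmem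
        obtain ⟨ht4, ht'⟩ := (hp.isTurn_iff htL).1 htt
        simp only [hσ]
        rcases hold t hmem with h5 | h5
        · rw [if_pos h5]
          refine mem_turns.2 ⟨by omega, (hprop.isTurn_iff (by omega)).2 ⟨ht4, ?_⟩⟩
          rw [hdq _ (by omega) (by omega), hdq _ (by omega) (by omega), δ1 t h5,
            δ1 (t - 2) (by omega)]
          exact ht'
        · rw [if_neg (by omega)]
          refine mem_turns.2 ⟨by omega, (hprop.isTurn_iff (by omega)).2 ⟨by omega, ?_⟩⟩
          rw [hdq _ (by omega) (by omega), hdq _ (by omega) (by omega), δ3 (t - 2) (by omega),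
            show t - 2 + 2 = t by omega, ← ht']
          rcases Nat.eq_or_lt_of_le h5 with h6 | h6
          · rw [← h6, show k + 6 - 2 - 2 = k + 2 by omega, δ2, show k + 6 - 2 = k + 1 + 3 by omega,
              h3]
          · rw [δ3 (t - 2 - 2) (by omega)]
            congr 1
            omega
    calc (turns p L).card = ((turns p L).image σ).card := (Finset.card_image_of_injOn hinj).symm
      _ < (insert (k + 2) ((turns p L).image σ)).card := by
        rw [Finset.card_insert_of_notMem hnotin]
        omega
      _ ≤ (turns q (L - 2)).card := Finset.card_le_card hsub

/-! ### Pins that run over many triples of a wedge -/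

/-- The coordinates of a point with respect to two perpendicular directions. -/
def frame (x y : Dir) (z : Pt) : Pt := (x.along z, y.along z)

theorem exists_frame {g : Pt → Pt} (hg : g ∈ sumSymmetries) :
    ∃ x y, Perp x y ∧ g = frame x y := by
  rcases hg with rfl | rfl | rfl | rfl
  · exact ⟨.right, .up, by simp [Perp, Dir.opp], rfl⟩
  · exact ⟨.up, .right, by simp [Perp, Dir.opp], rfl⟩
  · exact ⟨.left, .down, by simp [Perp, Dir.opp], rfl⟩
  · exact ⟨.down, .left, by simp [Perp, Dir.opp], rfl⟩

/-- A wedge sawtooth alternation whose horizontal axis points in direction `x` and whose vertical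
axis points in direction `y`. -/
def DirWedge (x y : Dir) {h : ℕ} (a b c : Fin h → Pt) : Prop :=
  IsWedge (fun j => frame x y (a j)) (fun j => frame x y (b j)) (fun j => frame x y (c j))

namespace DirWedge

variable {x y : Dir} {h : ℕ} {a b c : Fin h → Pt}

theorem ac (w : DirWedge x y a b c) (j : Fin h) : x.along (a j) < x.along (c j) := (w.2.1 j).1

theorem cb (w : DirWedge x y a b c) (j : Fin h) : x.along (c j) < x.along (b j) := (w.2.1 j).2

theorem ba (w : DirWedge x y a b c) (j : Fin h) : y.along (b j) < y.along (a j) := (w.1.1 j).2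

theorem ba_lt (w : DirWedge x y a b c) {i j : Fin h} (hij : i < j) :
    x.along (b i) < x.along (a j) := (w.1.2 i j hij).1

theorem ab_lt (w : DirWedge x y a b c) {i j : Fin h} (hij : i < j) :
    y.along (a i) < y.along (b j) := (w.1.2 i j hij).2

theorem cb_lt (w : DirWedge x y a b c) (i j : Fin h) : y.along (c i) < y.along (b j) :=
  w.2.2.1 i j

theorem cc_lt (w : DirWedge x y a b c) {i j : Fin h} (hij : i < j) :
    y.along (c j) < y.along (c i) := w.2.2.2 i j hij

theorem comp (w : DirWedge x y a b c) {k : ℕ} {σ : Fin k → Fin h} (hσ : StrictMono σ) :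
    DirWedge x y (fun j => a (σ j)) (fun j => b (σ j)) (fun j => c (σ j)) :=
  ⟨⟨fun j => w.1.1 (σ j), fun _ _ hij => w.1.2 _ _ (hσ hij)⟩, fun j => w.2.1 (σ j),
    fun i j => w.2.2.1 (σ i) (σ j), fun _ _ hij => w.2.2.2 _ _ (hσ hij)⟩

end DirWedge

/-- The `j`-th triple is touched by the first `i` pins: it is not entirely to the right of their
hull, with its `a` and `b` above the hull and its `c` below (for `x = right` and `y = up`). -/
def Touched (x y : Dir) {h : ℕ} (a b c : Fin h → Pt) (p : ℕ → Pt) (i : ℕ) (j : Fin h) : Prop :=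
  ∃ l < i, x.along (a j) ≤ x.along (p l) ∨ y.along (b j) ≤ y.along (p l) ∨
    y.along (p l) ≤ y.along (c j)

section

variable {S : Set Pt} {L : ℕ} {p : ℕ → Pt} {x y : Dir} {h : ℕ} {a b c : Fin h → Pt}

theorem not_touched {i : ℕ} {j : Fin h} (hj : ¬ Touched x y a b c p i j) {l : ℕ} (hl : l < i) :
    x.along (p l) < x.along (a j) ∧ y.along (p l) < y.along (b j) ∧
      y.along (c j) < y.along (p l) := by
  by_contra hcon
  exact hj ⟨l, hl, by omega⟩

/-- A pin touches new triples in its own direction only; pins to the left touch none. -/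
theorem newly_touched (hxy : Perp x y) (hp : IsProperPinSeq S L p) {i : ℕ} (hi : 2 ≤ i)
    (hL : i < L) {j : Fin h} (hj : ¬ Touched x y a b c p i j)
    (hj' : Touched x y a b c p (i + 1) j) :
    (dirOf p i = x ∧ x.along (a j) ≤ x.along (p i)) ∨
      (dirOf p i = y ∧ y.along (b j) ≤ y.along (p i)) ∨
      (dirOf p i = y.opp ∧ y.along (p i) ≤ y.along (c j)) := by
  obtain ⟨l, hl, hl'⟩ := hj'
  have hli : l = i := by
    by_contra hne
    exact hj ⟨l, by omega, hl'⟩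
  subst hli
  have hs := (hp.hasDir hi hL).2
  have h0 := hp.beyond hi hL (j := 0) (by omega)
  have hn0 := not_touched hj (l := 0) (by omega)
  have hx : Perp (dirOf p l) x → ¬ x.along (a j) ≤ x.along (p l) := by
    intro hpx hle
    obtain ⟨-, -, _, ⟨m, hm, rfl⟩, hm'⟩ := (slicesFrom_iff hpx).1 hs
    have := not_touched hj hm
    omega
  have hy : Perp (dirOf p l) y → ¬ y.along (b j) ≤ y.along (p l) ∧
      ¬ y.along (p l) ≤ y.along (c j) := by
    intro hpy
    obtain ⟨-, ⟨_, ⟨m, hm, rfl⟩, hm'⟩, _, ⟨m₂, hm₂, rfl⟩, hm₂'⟩ := (slicesFrom_iff hpy).1 hs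
    have h1 := not_touched hj hm
    have h2 := not_touched hj hm₂
    omega
  rcases hxy.cases (dirOf p l) with he | he | he | he
  · have := hy (he ▸ hxy)
    left
    exact ⟨he, by omega⟩
  · have := hx (he ▸ hxy.symm)
    rw [he] at h0
    right; left
    refine ⟨he, ?_⟩
    omega
  · have := hy (he ▸ hxy.opp_left)
    rw [he, Dir.along_opp, Dir.along_opp] at h0
    omega
  · have := hx (he ▸ hxy.symm.opp_left)
    rw [he, Dir.along_opp, Dir.along_opp] at h0
    right; right
    exact ⟨he, by omega⟩

/-- If the first two pins form a 21, then every later pin slices a 21 of earlier pins. -/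
theorem exists_sliced_21 (hxy : Perp x y) (hp : IsProperPinSeq S L p)
    (h0 : x.along (p 0) < x.along (p 1)) (h1 : y.along (p 1) < y.along (p 0)) {i : ℕ}
    (hi : 2 ≤ i) (hL : i < L) :
    ∃ k < i, ∃ l < i, x.along (p k) < x.along (p l) ∧ y.along (p l) < y.along (p k) ∧
      (dirOf p i = x → y.along (p l) < y.along (p i) ∧ y.along (p i) < y.along (p k)) ∧
      (dirOf p i = y ∨ dirOf p i = y.opp →
        x.along (p k) < x.along (p i) ∧ x.along (p i) < x.along (p l)) := by
  rcases Nat.lt_or_ge i 3 with h3 | h3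
  · obtain rfl : i = 2 := by omega
    have hs := (hp.hasDir hi hL).2
    refine ⟨0, by omega, 1, by omega, h0, h1, ?_, ?_⟩
    · intro he
      obtain ⟨-, ⟨_, ⟨m, hm, rfl⟩, hm'⟩, _, ⟨m₂, hm₂, rfl⟩, hm₂'⟩ :=
        (slicesFrom_iff (he ▸ hxy : Perp (dirOf p 2) y)).1 hs
      change m < 2 at hm
      change m₂ < 2 at hm₂
      interval_cases m <;> interval_cases m₂ <;> omega
    · intro he
      have hpx : Perp (dirOf p 2) x := by
        rcases he with he | he
        · exact he ▸ hxy.symm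
        · exact he ▸ hxy.symm.opp_left
      obtain ⟨-, ⟨_, ⟨m, hm, rfl⟩, hm'⟩, _, ⟨m₂, hm₂, rfl⟩, hm₂'⟩ := (slicesFrom_iff hpx).1 hs
      change m < 2 at hm
      change m₂ < 2 at hm₂
      interval_cases m <;> interval_cases m₂ <;> omega
  · obtain ⟨k, rfl⟩ : ∃ k, i = k + 1 := ⟨i - 1, by omega⟩
    have hs := (hp.hasDir (i := k) (by omega) (by omega)).2
    have hpe := hp.perp (i := k) (by omega) hL
    have hl := fun m hm => hp.between_left (i := k) (j := m) (by omega) hL hm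
    have hr := hp.between_right (i := k) (by omega) hL
    have hself : ∀ f : Dir, Perp f f → False := fun f hf => hf.1 rfl
    have hopp : ∀ f : Dir, Perp f f.opp → False := fun f hf => hf.2 rfl
    rcases hxy.cases (dirOf p k) with he | he | he | he <;> rw [he] at hs hpe hl hr
    · obtain ⟨hb, -, _, ⟨m, hm, rfl⟩, hm'⟩ := (slicesFrom_iff hxy).1 hs
      change m < k at hm
      refine ⟨m, by omega, k, by omega, hb _ (mem_initial hm), hm', ?_, fun _ => ⟨hl m hm, hr⟩⟩
      intro h
      rw [h] at hpe
      exact (hself _ hpe).elim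
    · obtain ⟨hb, -, _, ⟨m, hm, rfl⟩, hm'⟩ := (slicesFrom_iff hxy.symm).1 hs
      change m < k at hm
      refine ⟨k, by omega, m, by omega, hm', hb _ (mem_initial hm), fun _ => ⟨hl m hm, hr⟩, ?_⟩
      rintro (h | h) <;> rw [h] at hpe
      · exact (hself _ hpe).elim
      · exact (hopp _ hpe).elim
    · obtain ⟨hb, ⟨_, ⟨m, hm, rfl⟩, hm'⟩, -⟩ := (slicesFrom_iff hxy.opp_left).1 hs
      change m < k at hm
      have h4 := hb _ (mem_initial hm)
      have h5 := hl m hm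
      simp only [Dir.along_opp] at h4 h5 hr
      refine ⟨k, by omega, m, by omega, by omega, hm', ?_, fun _ => ⟨by omega, by omega⟩⟩
      intro h
      rw [h] at hpe
      exact (hpe.2 (by simp)).elim
    · obtain ⟨hb, ⟨_, ⟨m, hm, rfl⟩, hm'⟩, -⟩ := (slicesFrom_iff hxy.symm.opp_left).1 hs
      change m < k at hm
      have h4 := hb _ (mem_initial hm)
      have h5 := hl m hm
      simp only [Dir.along_opp] at h4 h5 hr
      refine ⟨m, by omega, k, by omega, hm', by omega, fun _ => ⟨by omega, by omega⟩, ?_⟩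
      rintro (h | h) <;> rw [h] at hpe
      · exact (hpe.2 (by simp)).elim
      · exact (hself _ hpe).elim

end

/-- A pin that newly touches `k + 1` triples slices a 21 of earlier pins from beyond `k` of these
triples. Together they form a sliced wedge sawtooth alternation, of type 2, 3 or 1 according to
whether the pin points right, up or down. -/
theorem containsSlicedWedge_of_newly_touched {n : ℕ} {π : Equiv.Perm (Fin n)} {L : ℕ}
    {p : ℕ → Pt} {x y : Dir} {h : ℕ} {a b c : Fin h → Pt} (hg : frame x y ∈ sumSymmetries)
    (hxy : Perp x y) (hw : DirWedge x y a b c)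
    (habc : ∀ j, a j ∈ plot π ∧ b j ∈ plot π ∧ c j ∈ plot π)
    (hp : IsProperPinSeq (plot π) L p) (h0 : x.along (p 0) < x.along (p 1))
    (h1 : y.along (p 1) < y.along (p 0)) {i : ℕ} (hi : 2 ≤ i) (hL : i < L) {k : ℕ}
    {J : Finset (Fin h)} (hJ : k + 1 ≤ J.card) (hJ₁ : ∀ j ∈ J, ¬ Touched x y a b c p i j)
    (hJ₂ : ∀ j ∈ J, Touched x y a b c p (i + 1) j) : ContainsSlicedWedge π (k + 1) := by
  classical
  have hne : J.Nonempty := Finset.card_pos.1 (by omega)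
  set t := J.max' hne
  have htJ : t ∈ J := Finset.max'_mem _ _
  have hcard : k ≤ (J.erase t).card := by
    rw [Finset.card_erase_of_mem htJ]
    omega
  obtain ⟨K, hK, hKc⟩ := Finset.exists_subset_card_eq hcard
  set σ := K.orderEmbOfFin hKc
  have hσJ : ∀ j, σ j ∈ J := fun j =>
    Finset.mem_of_mem_erase (hK (Finset.orderEmbOfFin_mem K hKc j))
  have hσt : ∀ j, σ j < t := by
    intro j
    have h2 : σ j ∈ J.erase t := hK (Finset.orderEmbOfFin_mem K hKc j)
    exact lt_of_le_of_ne (Finset.le_max' _ _ (hσJ j)) (Finset.ne_of_mem_erase h2)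
  have hout : ∀ j, ∀ l < i, x.along (p l) < x.along (a (σ j)) ∧
      y.along (p l) < y.along (b (σ j)) ∧ y.along (c (σ j)) < y.along (p l) := fun j l hl =>
    not_touched (hJ₁ _ (hσJ j)) hl
  obtain ⟨u, hu, v, hv, huv, hvu, hX, hY⟩ := exists_sliced_21 hxy hp h0 h1 hi hL
  have hbu := hp.beyond hi hL hu
  have hbv := hp.beyond hi hL hv
  have hwσ : IsWedge (fun j => frame x y (a (σ j))) (fun j => frame x y (b (σ j)))
      (fun j => frame x y (c (σ j))) := hw.comp σ.strictMono
  have hmp : ∀ l < L, p l ∈ plot π := hp.mem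
  have hσa : ∀ j, x.along (b (σ j)) < x.along (a t) ∧ y.along (a (σ j)) < y.along (b t) ∧
      y.along (c t) < y.along (c (σ j)) := fun j =>
    ⟨hw.ba_lt (hσt j), hw.ab_lt (hσt j), hw.cc_lt (hσt j)⟩
  refine ⟨k, rfl, frame x y, hg, ?_⟩
  rcases newly_touched hxy hp hi hL (hJ₁ t htJ) (hJ₂ t htJ) with ⟨he, hle⟩ | ⟨he, hle⟩ | ⟨he, hle⟩
  · obtain ⟨h2, h3⟩ := hX he
    rw [he] at hbu hbv
    refine ⟨p u, p v, p i, fun j => a (σ j), fun j => b (σ j), fun j => c (σ j),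
      ⟨hmp _ (by omega), hmp _ (by omega), hmp _ hL⟩, fun j => habc _, Or.inr (Or.inl
      ⟨hwσ, ⟨huv, hbv, fun j => ⟨(hout j v hv).1, ?_⟩⟩, h2, h3, fun j =>
        ⟨(hout j v hv).2.2, (hout j u hu).2.1⟩⟩)⟩
    exact lt_of_lt_of_le (hσa j).1 hle
  · obtain ⟨h2, h3⟩ := hY (Or.inl he)
    rw [he] at hbu hbv
    refine ⟨p u, p i, p v, fun j => a (σ j), fun j => b (σ j), fun j => c (σ j),
      ⟨hmp _ (by omega), hmp _ hL, hmp _ (by omega)⟩, fun j => habc _, Or.inr (Or.inr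
      ⟨hwσ, ⟨h2, h3, fun j => (hout j v hv).1⟩, hvu, hbu, fun j =>
        ⟨(hout j v hv).2.2, (hout j u hu).2.1, ?_⟩⟩)⟩
    exact lt_of_lt_of_le (hσa j).2.1 hle
  · obtain ⟨h2, h3⟩ := hY (Or.inr he)
    rw [he, Dir.along_opp, Dir.along_opp] at hbu hbv
    refine ⟨p u, p i, p v, fun j => a (σ j), fun j => b (σ j), fun j => c (σ j),
      ⟨hmp _ (by omega), hmp _ hL, hmp _ (by omega)⟩, fun j => habc _, Or.inl
      ⟨hwσ, ⟨h2, h3, fun j => (hout j v hv).1⟩, neg_lt_neg_iff.1 hbv, hvu, fun j =>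
        ⟨?_, (hout j v hv).2.2, (hout j u hu).2.1⟩⟩⟩
    exact lt_of_le_of_lt hle (hσa j).2.2

/-! ### Spirals -/

/-- The points `f 0, …, f (L - 1)` spiral with directions `δ`: from `f 2` on, each point lies
beyond all earlier ones in its direction, and its successor comes second in that direction. -/
structure IsSpiral (δ : ℕ → Dir) (L : ℕ) (f : ℕ → Pt) : Prop where
  perp : ∀ i, Perp (δ i) (δ (i + 1))
  opp : ∀ i, δ (i + 2) = (δ i).opp
  two_le : 2 ≤ L
  ne : f 0 ≠ f 1
  start : 2 < L → SlicesFrom (δ 2) (initial f 2) (f 2)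
  beyond : ∀ i j, 2 ≤ i → i < L → j < i → (δ i).along (f j) < (δ i).along (f i)
  left : ∀ i j, 2 ≤ i → i + 1 < L → j < i → (δ i).along (f j) < (δ i).along (f (i + 1))
  right : ∀ i, 2 ≤ i → i + 1 < L → (δ i).along (f (i + 1)) < (δ i).along (f i)

namespace IsSpiral

variable {δ : ℕ → Dir} {L : ℕ} {f : ℕ → Pt}

theorem dir_add_four (hf : IsSpiral δ L f) (i : ℕ) : δ (i + 4) = δ i := by
  rw [show i + 4 = i + 2 + 2 from rfl, hf.opp, hf.opp, Dir.opp_opp]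

theorem dir_cases (hf : IsSpiral δ L f) (i : ℕ) (d : Dir) :
    d = δ i ∨ d = δ (i + 1) ∨ d = δ (i + 2) ∨ d = δ (i + 3) := by
  rw [hf.opp i, show i + 3 = i + 1 + 2 from rfl, hf.opp (i + 1)]
  exact (hf.perp i).cases d

end IsSpiral

/-- A point between two stages of a spiral: it lies on one side of `f 0, …, f N` in both
coordinates, and none of the next four directions takes it as far as the pins `f (N + 2), …,
f (N + 5)`. -/
structure Lodged (δ : ℕ → Dir) (f : ℕ → Pt) (N : ℕ) (z : Pt) : Prop where
  out : ∃ d e : Dir, Perp d e ∧ ∀ j ≤ N, d.along (f j) < d.along z ∧ e.along (f j) < e.along z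
  inside : ∀ i, N + 2 ≤ i → i ≤ N + 5 → (δ i).along z < (δ i).along (f i)
  ne : z ≠ f (N + 1)

namespace Lodged

variable {δ : ℕ → Dir} {L N : ℕ} {f : ℕ → Pt} {z : Pt}

theorem exists_le (h : Lodged δ f N z) (hf : IsSpiral δ L f) (d : Dir) :
    ∃ j ≤ N + 5, d.along z ≤ d.along (f j) := by
  rcases hf.dir_cases (N + 2) d with rfl | rfl | rfl | rfl
  · exact ⟨N + 2, by omega, (h.inside _ (by omega) (by omega)).le⟩
  · exact ⟨N + 3, by omega, (h.inside _ (by omega) (by omega)).le⟩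
  · exact ⟨N + 4, by omega, (h.inside _ (by omega) (by omega)).le⟩
  · exact ⟨N + 5, by omega, (h.inside _ (by omega) (by omega)).le⟩

theorem ne_pin (h : Lodged δ f N z) (hf : IsSpiral δ L f) {j : ℕ} (hj : j < L) : z ≠ f j := by
  rintro rfl
  obtain ⟨d, e, -, ho⟩ := h.out
  rcases Nat.lt_or_ge N j with h1 | h1
  · rcases eq_or_lt_of_le (Nat.succ_le_of_lt h1) with h2 | h2
    · exact h.ne (by rw [← h2])
    · rcases Nat.lt_or_ge (N + 5) j with h3 | h3
      · obtain ⟨l, hl, hl'⟩ := h.exists_le hf (δ j)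
        have := hf.beyond j l (by omega) hj (by omega)
        omega
      · exact lt_irrefl _ (h.inside j (by omega) h3)
  · exact lt_irrefl _ (ho j h1).1

theorem not_slices_of_le (h : Lodged δ f N z) {A : Set Pt}
    (hA : ∀ u ∈ A, ∀ d : Dir, ∃ j ≤ N, d.along u ≤ d.along (f j)) : ¬ Slices A z := by
  obtain ⟨d, e, hde, ho⟩ := h.out
  refine not_slices_of_corner hde fun u hu => ⟨?_, ?_⟩
  · obtain ⟨j, hj, hj'⟩ := hA u hu d
    exact lt_of_le_of_lt hj' (ho j hj).1
  · obtain ⟨j, hj, hj'⟩ := hA u hu e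
    exact lt_of_le_of_lt hj' (ho j hj).2

theorem along_le_of_slicesFrom (h : Lodged δ f N z) (hf : IsSpiral δ L f) {i : ℕ} (hi : 2 ≤ i)
    (hL : i < L) (hs : SlicesFrom (δ i) (initial f i) z) :
    (δ i).along z ≤ (δ i).along (f i) := by
  rcases Nat.lt_or_ge i (N + 2) with h1 | h1
  · refine absurd ⟨_, hs⟩ (h.not_slices_of_le ?_)
    rintro _ ⟨j, hj, rfl⟩ d
    change j < i at hj
    exact ⟨j, by omega, le_rfl⟩
  · rcases Nat.lt_or_ge (N + 5) i with h2 | h2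
    · obtain ⟨j, hj, hj'⟩ := h.exists_le hf (δ i)
      have := hf.beyond i j hi hL (by omega)
      omega
    · exact (h.inside i h1 h2).le

end Lodged

/-- A point in the hull of `f 0, …, f N` does not slice a set that lies on one side of that hull
in both coordinates. -/
theorem not_slices_of_inner {f : ℕ → Pt} {N : ℕ} {d e : Dir} (hde : Perp d e) {A : Set Pt} {z : Pt}
    (hz : ∀ c : Dir, ∃ j ≤ N, c.along z ≤ c.along (f j))
    (hA : ∀ u ∈ A, ∀ j ≤ N, d.along (f j) < d.along u ∧ e.along (f j) < e.along u) :
    ¬ Slices A z := by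
  refine not_slices_of_corner hde.opp_left.opp_right fun u hu => ?_
  obtain ⟨j, hj, hj'⟩ := hz d
  obtain ⟨l, hl, hl'⟩ := hz e
  have h1 := (hA u hu j hj).1
  have h2 := (hA u hu l hl).2
  simp only [Dir.along_opp]
  omega

namespace IsSpiral

variable {δ : ℕ → Dir} {L : ℕ} {f : ℕ → Pt}

theorem not_slices_later (hf : IsSpiral δ L f) {m j : ℕ} (hm : 2 ≤ m) (hj : m + 1 ≤ j)
    (hL : j < L) {A : Set Pt} (hA : ∀ u ∈ A, ∀ d : Dir, ∃ l < m, d.along u ≤ d.along (f l)) :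
    ¬ Slices A (f j) := by
  obtain ⟨k, rfl⟩ : ∃ k, j = k + 1 := ⟨j - 1, by omega⟩
  refine not_slices_of_corner (hf.perp k) fun u hu => ⟨?_, ?_⟩
  · obtain ⟨l, hl, hl'⟩ := hA u hu (δ k)
    exact lt_of_le_of_lt hl' (hf.left k l (by omega) hL (by omega))
  · obtain ⟨l, hl, hl'⟩ := hA u hu (δ (k + 1))
    exact lt_of_le_of_lt hl' (hf.beyond (k + 1) l (by omega) hL (by omega))

/-- The points of a spiral form a turn-free proper pin sequence in any set whose other points are
lodged in the spiral. -/
theorem isProperPinSeq (hf : IsSpiral δ L f) {S : Set Pt} (hmem : ∀ i < L, f i ∈ S)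
    (hS : ∀ z ∈ S, (∃ j < L, z = f j) ∨ ∃ N, Lodged δ f N z) :
    IsProperPinSeq S L f ∧ ∀ i, 2 ≤ i → i < L → HasDir f i (δ i) := by
  refine IsProperPinSeq.of_dir hf.two_le hmem hf.ne hf.start (fun i _ _ => hf.perp i) hf.beyond
    hf.left hf.right ?_
  intro i hi hL z hz hs
  rcases hS z hz with ⟨j, hj, rfl⟩ | ⟨N, hN⟩
  · rcases lt_trichotomy j i with h | rfl | h
    · exact (hf.beyond i j hi hL h).le
    · exact le_rfl
    · rcases Nat.eq_or_lt_of_le (Nat.succ_le_of_lt h) with h1 | h1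
      · rw [← h1]
        exact (hf.right i hi (by omega)).le
      · refine absurd ⟨_, hs⟩ (hf.not_slices_later hi (by omega : i + 1 ≤ j) hj ?_)
        rintro _ ⟨l, hl, rfl⟩ d
        exact ⟨l, hl, le_rfl⟩
  · exact hN.along_le_of_slicesFrom hf hi hL hs

theorem not_isTurn (hf : IsSpiral δ L f) (hdir : ∀ i, 2 ≤ i → i < L → HasDir f i (δ i)) {i : ℕ}
    (hi : i < L) : ¬ IsTurn f i := by
  rintro ⟨d, h1, h2⟩
  have h3 := h1.1
  obtain ⟨k, rfl⟩ : ∃ k, i = k + 2 := ⟨i - 2, by omega⟩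
  simp only [Nat.add_sub_cancel] at h1 h3
  have h4 := h1.2.dir_unique (hdir k h3 (by omega)).2
  have h5 := h2.2.dir_unique (hdir (k + 2) (by omega) hi).2
  rw [hf.opp k] at h5
  exact (δ k).opp_ne (by rw [← h5, h4])

end IsSpiral

/-- The order of the pins `g (k + 2), …, g (k + 8)` of a spiral and their predecessors, in terms
of the directions `d` and `e` of `g (k + 3)` and `g (k + 4)`. The fields `b i`, `l i` and `r i`
say that the pin `g (k + i)` lies beyond its predecessors, and that its successor lies between
these and `g (k + i)`. -/
structure Window (δ : ℕ → Dir) (g : ℕ → Pt) (k : ℕ) (d e : Dir) : Prop where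
  perp : Perp d e
  h2 : δ (k + 2) = e.opp
  h3 : δ (k + 3) = d
  h4 : δ (k + 4) = e
  h5 : δ (k + 5) = d.opp
  h6 : δ (k + 6) = e.opp
  h7 : δ (k + 7) = d
  h8 : δ (k + 8) = e
  l1 : ∀ j < k + 1, d.along (g (k + 2)) < d.along (g j)
  b2 : ∀ j < k + 2, e.along (g (k + 2)) < e.along (g j)
  l2 : ∀ j < k + 2, e.along (g (k + 3)) < e.along (g j)
  r2 : e.along (g (k + 2)) < e.along (g (k + 3))
  b3 : ∀ j < k + 3, d.along (g j) < d.along (g (k + 3))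
  l3 : ∀ j < k + 3, d.along (g j) < d.along (g (k + 4))
  r3 : d.along (g (k + 4)) < d.along (g (k + 3))
  b4 : ∀ j < k + 4, e.along (g j) < e.along (g (k + 4))
  l4 : ∀ j < k + 4, e.along (g j) < e.along (g (k + 5))
  r4 : e.along (g (k + 5)) < e.along (g (k + 4))
  b5 : ∀ j < k + 5, d.along (g (k + 5)) < d.along (g j)
  l5 : ∀ j < k + 5, d.along (g (k + 6)) < d.along (g j)
  r5 : d.along (g (k + 5)) < d.along (g (k + 6))
  b6 : ∀ j < k + 6, e.along (g (k + 6)) < e.along (g j)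
  l6 : ∀ j < k + 6, e.along (g (k + 7)) < e.along (g j)
  r6 : e.along (g (k + 6)) < e.along (g (k + 7))
  b7 : ∀ j < k + 7, d.along (g j) < d.along (g (k + 7))
  l7 : ∀ j < k + 7, d.along (g j) < d.along (g (k + 8))
  r7 : d.along (g (k + 8)) < d.along (g (k + 7))
  b8 : ∀ j < k + 8, e.along (g j) < e.along (g (k + 8))

theorem IsSpiral.window {δ : ℕ → Dir} {L k : ℕ} {g : ℕ → Pt} (hg : IsSpiral δ L g)
    (hk : 1 ≤ k) (hL : k + 8 < L) : Window δ g k (δ (k + 3)) (δ (k + 4)) := by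
  have e2 : δ (k + 2) = (δ (k + 4)).opp := by
    have := hg.opp (k + 2)
    rw [show k + 4 = k + 2 + 2 from rfl, this, Dir.opp_opp]
  have e1 : δ (k + 1) = (δ (k + 3)).opp := by
    have := hg.opp (k + 1)
    rw [show k + 3 = k + 1 + 2 from rfl, this, Dir.opp_opp]
  have e5 : δ (k + 5) = (δ (k + 3)).opp := hg.opp (k + 3)
  have e6 : δ (k + 6) = (δ (k + 4)).opp := hg.opp (k + 4)
  have e7 : δ (k + 7) = δ (k + 3) := hg.dir_add_four (k + 3)
  have e8 : δ (k + 8) = δ (k + 4) := hg.dir_add_four (k + 4)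
  have b := fun i j => hg.beyond i j
  have l := fun i j => hg.left i j
  have r := fun i => hg.right i
  have hneg : ∀ (d : Dir) (z w : Pt), d.opp.along z < d.opp.along w → d.along w < d.along z := by
    intro d z w h
    rw [Dir.along_opp, Dir.along_opp] at h
    omega
  exact
    { perp := hg.perp (k + 3), h2 := e2, h3 := rfl, h4 := rfl, h5 := e5, h6 := e6, h7 := e7
      h8 := e8
      l1 := fun j hj => hneg _ _ _ (e1 ▸ l (k + 1) j (by omega) (by omega) hj)
      b2 := fun j hj => hneg _ _ _ (e2 ▸ b (k + 2) j (by omega) (by omega) hj)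
      l2 := fun j hj => hneg _ _ _ (e2 ▸ l (k + 2) j (by omega) (by omega) hj)
      r2 := hneg _ _ _ (e2 ▸ r (k + 2) (by omega) (by omega))
      b3 := fun j hj => b (k + 3) j (by omega) (by omega) hj
      l3 := fun j hj => l (k + 3) j (by omega) (by omega) hj
      r3 := r (k + 3) (by omega) (by omega)
      b4 := fun j hj => b (k + 4) j (by omega) (by omega) hj
      l4 := fun j hj => l (k + 4) j (by omega) (by omega) hj
      r4 := r (k + 4) (by omega) (by omega)
      b5 := fun j hj => hneg _ _ _ (e5 ▸ b (k + 5) j (by omega) (by omega) hj)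
      l5 := fun j hj => hneg _ _ _ (e5 ▸ l (k + 5) j (by omega) (by omega) hj)
      r5 := hneg _ _ _ (e5 ▸ r (k + 5) (by omega) (by omega))
      b6 := fun j hj => hneg _ _ _ (e6 ▸ b (k + 6) j (by omega) (by omega) hj)
      l6 := fun j hj => hneg _ _ _ (e6 ▸ l (k + 6) j (by omega) (by omega) hj)
      r6 := hneg _ _ _ (e6 ▸ r (k + 6) (by omega) (by omega))
      b7 := fun j hj => e7 ▸ b (k + 7) j (by omega) (by omega) hj
      l7 := fun j hj => e7 ▸ l (k + 7) j (by omega) (by omega) hj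
      r7 := e7 ▸ r (k + 7) (by omega) (by omega)
      b8 := fun j hj => e8 ▸ b (k + 8) j (by omega) (by omega) hj }

/-! ### Extensions in coordinates -/

/-- The coordinates of a type 1 extension `q` of the pin `g (k + 4)` of a spiral, where `d` and `e`
are the directions of `g (k + 3)` and `g (k + 4)`. The position relative to early pins is stated
for `f`, that relative to the pins nearby for `g`. -/
structure CornerExt (d e : Dir) (f g : ℕ → Pt) (k : ℕ) (q : Pt) : Prop where
  past : ∀ j < k + 3, d.along (f j) < d.along q ∧ e.along (f j) < e.along q
  side : d.along (g (k + 4)) < d.along q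
  side' : e.along q < e.along (g (k + 4))
  top : d.along q < d.along (g (k + 8))
  cut : d.along (g (k + 3)) < d.along q ∨ e.along q < e.along (g (k + 5))

/-- The coordinates of the points `q` and `r` of a type 2 extension of the pin `g (k + 4)`. -/
structure PairPos (d e : Dir) (f g : ℕ → Pt) (k : ℕ) (q r : Pt) : Prop where
  past_q : ∀ j < k + 3, d.along (f j) < d.along q ∧ e.along (f j) < e.along q
  past_r : ∀ j < k + 3, d.along (f j) < d.along r ∧ e.along (f j) < e.along r
  rq : d.along r < d.along q
  qr : e.along q < e.along r
  top : d.along q < d.along (g (k + 4))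
  side : e.along r < e.along (g (k + 5))

/-- The coordinates of a type 2 extension `q, r, t` of the pin `g (k + 4)` in which `t` lies next
to the following pin. -/
structure PairExt (d e : Dir) (f g : ℕ → Pt) (k : ℕ) (q r t : Pt) : Prop
    extends PairPos d e f g k q r where
  past_t : ∀ j < k + 3, d.along t < d.along (f j) ∧ e.along (f j) < e.along t
  qt : e.along q < e.along t
  tr : e.along t < e.along r
  low : d.along (g (k + 6)) < d.along t

/-- The coordinates of a type 2 extension `q, r, t` of the pin `g (k + 4)` in which `t` lies next
to the preceding pin. -/
structure PairExt' (d e : Dir) (f g : ℕ → Pt) (k : ℕ) (q r t : Pt) : Prop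
    extends PairPos d e f g k q r where
  past_t : ∀ j < k + 2, d.along (f j) < d.along t ∧ e.along t < e.along (f j)
  rt : d.along r < d.along t
  tq : d.along t < d.along q
  low : e.along (g (k + 3)) < e.along t

section

variable {δ : ℕ → Dir} {L k : ℕ} {g : ℕ → Pt} {d e : Dir} {q r t : Pt}

/-- The four indices at which a point lodged at stage `k + 2` has to be compared with a pin. -/
theorem Window.inside (hw : Window δ g k d e) {z : Pt} (h4 : e.along z < e.along (g (k + 4)))
    (h5 : d.along (g (k + 5)) < d.along z) (h6 : e.along (g (k + 6)) < e.along z)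
    (h7 : d.along z < d.along (g (k + 7))) {i : ℕ} (hi : k + 2 + 2 ≤ i) (hi' : i ≤ k + 2 + 5) :
    (δ i).along z < (δ i).along (g i) := by
  have hi : i = k + 4 ∨ i = k + 5 ∨ i = k + 6 ∨ i = k + 7 := by omega
  rcases hi with rfl | rfl | rfl | rfl
  · rwa [hw.h4]
  · rw [hw.h5, Dir.along_opp, Dir.along_opp]
    omega
  · rw [hw.h6, Dir.along_opp, Dir.along_opp]
    omega
  · rwa [hw.h7]

theorem CornerExt.lodged (h : CornerExt d e g g k q) (hw : Window δ g k d e) :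
    Lodged δ g (k + 2) q := by
  have h0 := h.past 0 (by omega)
  have h1 := hw.b5 (k + 4) (by omega)
  have h2 := hw.b6 0 (by omega)
  have h3 := hw.l2 0 (by omega)
  have hs := h.side
  have ht := h.top
  have hr := hw.r7
  refine ⟨⟨d, e, hw.perp, fun j hj => h.past j (by omega)⟩,
    fun i => hw.inside h.side' (by omega) (by omega) (by omega), ?_⟩
  rintro rfl
  change d.along (g 0) < d.along (g (k + 3)) ∧ e.along (g 0) < e.along (g (k + 3)) at h0
  omega

theorem PairPos.lodged (h : PairPos d e g g k q r) (hw : Window δ g k d e) :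
    Lodged δ g (k + 2) q ∧ Lodged δ g (k + 2) r := by
  have h0 := h.past_q 0 (by omega)
  have h0' := h.past_r 0 (by omega)
  have h1 := hw.b5 0 (by omega)
  have h2 := hw.b6 0 (by omega)
  have h3 := hw.l2 0 (by omega)
  have h4 := hw.r4
  have h5 := hw.b7 (k + 4) (by omega)
  have hq := h.qr
  have hr := h.rq
  have hs := h.side
  have ht := h.top
  refine ⟨⟨⟨d, e, hw.perp, fun j hj => h.past_q j (by omega)⟩,
    fun i => hw.inside (by omega) (by omega) (by omega) (by omega), ?_⟩,
    ⟨⟨d, e, hw.perp, fun j hj => h.past_r j (by omega)⟩,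
    fun i => hw.inside (by omega) (by omega) (by omega) (by omega), ?_⟩⟩
  · rintro rfl
    change d.along (g 0) < d.along (g (k + 3)) ∧ e.along (g 0) < e.along (g (k + 3)) at h0
    omega
  · rintro rfl
    change d.along (g 0) < d.along (g (k + 3)) ∧ e.along (g 0) < e.along (g (k + 3)) at h0'
    omega

theorem PairExt.lodged (h : PairExt d e g g k q r t) (hw : Window δ g k d e) :
    Lodged δ g (k + 2) t := by
  have h0 := h.past_t 0 (by omega)
  have h2 := hw.b6 0 (by omega)
  have h3 := hw.l2 0 (by omega)
  have h4 := hw.r4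
  have h5 := hw.b7 0 (by omega)
  have h6 := hw.r5
  have ht := h.tr
  have hs := h.side
  have hl := h.low
  refine ⟨⟨d.opp, e, hw.perp.opp_left, fun j hj => ?_⟩,
    fun i => hw.inside (by omega) (by omega) (by omega) (by omega), ?_⟩
  · have := h.past_t j (by omega)
    simp only [Dir.along_opp]
    omega
  · rintro rfl
    change d.along (g (k + 3)) < d.along (g 0) ∧ e.along (g 0) < e.along (g (k + 3)) at h0
    omega

theorem PairExt'.lodged (h : PairExt' d e g g k q r t) (hw : Window δ g k d e) :
    Lodged δ g (k + 1) t := by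
  have h0 := h.past_t 0 (by omega)
  have h1 := hw.b5 0 (by omega)
  have h2 := hw.b4 0 (by omega)
  have h3 := hw.r3
  have h4 := hw.b6 (k + 3) (by omega)
  have ht := h.tq
  have hs := h.top
  have hl := h.low
  refine ⟨⟨d, e.opp, hw.perp.opp_right, fun j hj => ?_⟩, fun i h1 h2 => ?_, ?_⟩
  · have := h.past_t j (by omega)
    simp only [Dir.along_opp]
    omega
  · have hi : i = k + 3 ∨ i = k + 4 ∨ i = k + 5 ∨ i = k + 6 := by omega
    rcases hi with rfl | rfl | rfl | rfl
    · rw [hw.h3]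
      omega
    · rw [hw.h4]
      omega
    · rw [hw.h5, Dir.along_opp, Dir.along_opp]
      omega
    · rw [hw.h6, Dir.along_opp, Dir.along_opp]
      omega
  · rintro rfl
    have h6 := hw.l1 0 (by omega)
    change d.along (g 0) < d.along (g (k + 2)) ∧ _ at h0
    omega

/-- The points of the set `S` are pins, points of `X`, or lodged well inside or well outside the
stage of the spiral at which the pin `g (k + 4)` is extended. -/
def FarFrom (δ : ℕ → Dir) (L : ℕ) (g : ℕ → Pt) (k : ℕ) (X S : Set Pt) : Prop :=
  ∀ z ∈ S, (∃ j < L, z = g j) ∨ z ∈ X ∨ ∃ N, Lodged δ g N z ∧ (N + 5 ≤ k + 2 ∨ k + 7 ≤ N)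

/-- A set lodged at stage `k + 2` is sliced only by nearby points. -/
theorem FarFrom.cases_of_slices (hg : IsSpiral δ L g) {X S A : Set Pt}
    (hS : FarFrom δ L g k X S) (hde : Perp d e)
    (hA : ∀ u ∈ A, ∀ j < k + 3, d.along (g j) < d.along u ∧ e.along (g j) < e.along u)
    (hA' : ∀ u ∈ A, ∀ c : Dir, ∃ j ≤ k + 7, c.along u ≤ c.along (g j)) {z : Pt} (hz : z ∈ S)
    (hs : Slices A z) : z ∈ X ∨ ∃ j < L, z = g j ∧ k + 3 ≤ j ∧ j ≤ k + 8 := by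
  rcases hS z hz with ⟨j, hj, rfl⟩ | hX | ⟨N, hN, hfar⟩
  · right
    refine ⟨j, hj, rfl, ?_, ?_⟩
    · by_contra hlt
      exact not_slices_of_inner (N := k + 2) hde (fun c => ⟨j, by omega, le_rfl⟩)
        (fun u hu l hl => hA u hu l (by omega)) hs
    · by_contra hlt
      refine hg.not_slices_later (m := k + 8) (by omega) (by omega) hj (fun u hu c => ?_) hs
      obtain ⟨l, hl, hl'⟩ := hA' u hu c
      exact ⟨l, by omega, hl'⟩
  · exact Or.inl hX
  · exfalso
    rcases hfar with hfar | hfar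
    · refine not_slices_of_inner (N := k + 2) hde (fun c => ?_)
        (fun u hu l hl => hA u hu l (by omega)) hs
      obtain ⟨l, hl, hl'⟩ := hN.exists_le hg c
      exact ⟨l, by omega, hl'⟩
    · refine hN.not_slices_of_le (fun u hu c => ?_) hs
      obtain ⟨l, hl, hl'⟩ := hA' u hu c
      exact ⟨l, by omega, hl'⟩

theorem CornerExt.isExt₁ (h : CornerExt d e g g k q) (hg : IsSpiral δ L g)
    (hdir : ∀ i, 2 ≤ i → i < L → HasDir g i (δ i)) (hw : Window δ g k d e) (hL : k + 8 < L)
    {S : Set Pt} (hS : FarFrom δ L g k {q} S) : IsExt₁ S L g (k + 4) q := by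
  have hlod := h.lodged hw
  have hd3 := hdir (k + 3) (by omega) (by omega)
  have hd4 := hdir (k + 4) (by omega) (by omega)
  rw [hw.h3] at hd3
  rw [hw.h4] at hd4
  have hs := h.side
  have hs' := h.side'
  have ht := h.top
  have h0 := h.past 0 (by omega)
  refine ⟨d, e, hd3, hd4, Or.inl ⟨hs, hs'⟩, ?_, ?_⟩
  · rw [show k + 4 - 1 = k + 3 from rfl]
    rcases h.cut with hc | hc
    · left
      refine ⟨e.opp, (slicesFrom_iff hw.perp.symm.opp_left).2 ⟨?_, ⟨g (k + 4), by simp, hw.r3⟩,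
        q, by simp, hc⟩⟩
      have h3 := hw.l2 0 (by omega)
      rintro u (rfl | rfl) <;> simp only [Dir.along_opp] <;> omega
    · right
      refine ⟨by omega, d.opp, (slicesFrom_iff hw.perp.opp_left).2 ⟨?_, ⟨q, by simp, hc⟩,
        g (k + 4), by simp, hw.r4⟩⟩
      have h3 := hw.b5 (k + 4) (by omega)
      change d.along (g (k + 4 + 1)) < _ at h3
      rintro u (rfl | rfl) <;> simp only [Dir.along_opp] <;> omega
  · intro z hz hsl
    have hA : ∀ u ∈ ({g (k + 4), q} : Set Pt), ∀ j < k + 3,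
        d.along (g j) < d.along u ∧ e.along (g j) < e.along u := by
      rintro u (rfl | rfl) j hj
      · exact ⟨hw.l3 j hj, hw.b4 j (by omega)⟩
      · exact h.past j hj
    have hA' : ∀ u ∈ ({g (k + 4), q} : Set Pt), ∀ c : Dir,
        ∃ j ≤ k + 7, c.along u ≤ c.along (g j) := by
      rintro u (rfl | rfl) c
      · exact ⟨k + 4, by omega, le_rfl⟩
      · exact hlod.exists_le hg c
    rcases hS.cases_of_slices hg hw.perp hA hA' hz hsl with rfl | ⟨j, hj, rfl, h1, h2⟩
    · exact absurd hsl (not_slices_of_mem (by simp))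
    have hno : ∀ {c c' : Dir}, Perp c c' → c.along (g (k + 4)) < c.along (g j) →
        c.along q < c.along (g j) → c'.along (g (k + 4)) < c'.along (g j) →
        c'.along q < c'.along (g j) → False := by
      intro c c' hcc h1 h2 h3 h4
      refine not_slices_of_corner hcc ?_ hsl
      rintro u (rfl | rfl)
      · exact ⟨h1, h3⟩
      · exact ⟨h2, h4⟩
    have hcase : j = k + 3 ∨ j = k + 4 ∨ j = k + 5 ∨ j = k + 6 ∨ j = k + 7 ∨ j = k + 8 := by omega
    rcases hcase with rfl | rfl | rfl | rfl | rfl | rfl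
    · exact Or.inl rfl
    · exact absurd hsl (not_slices_of_mem (by simp))
    · exact Or.inr ⟨hj, rfl⟩
    · exfalso
      have h3 := hw.b6 0 (by omega)
      have h4 := hw.b6 (k + 4) (by omega)
      have h5 := hw.l5 (k + 4) (by omega)
      refine hno hw.perp.opp_left.opp_right ?_ ?_ ?_ ?_ <;> (try simp only [Dir.along_opp]) <;> omega
    · exfalso
      have h3 := hw.l6 0 (by omega)
      have h4 := hw.l6 (k + 4) (by omega)
      have h5 := hw.b7 (k + 4) (by omega)
      have h6 := hw.r7
      refine hno hw.perp.opp_right ?_ ?_ ?_ ?_ <;> (try simp only [Dir.along_opp]) <;> omega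
    · exfalso
      have h4 := hw.b8 (k + 4) (by omega)
      have h5 := hw.l7 (k + 4) (by omega)
      refine hno hw.perp ?_ ?_ ?_ ?_ <;> omega

/-- The pair `q, r` is sliced by `t` alone, and `g (k + 5)` alone among the pins separates it from
`g (k + 4)`; this part is common to both forms of type 2 extensions. -/
theorem PairPos.isExt₂ (h : PairPos d e g g k q r) (hg : IsSpiral δ L g)
    (hdir : ∀ i, 2 ≤ i → i < L → HasDir g i (δ i)) (hw : Window δ g k d e) (hL : k + 8 < L)
    {S : Set Pt} (hS : FarFrom δ L g k {q, r, t} S) (htS : t ∈ S) (hsl : Slices {q, r} t)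
    (ht : (Forms21 d e (g (k + 3)) t ∧ ∀ j < L, Slices {g (k + 3), t} (g j) ↔ j = k + 4) ∨
      (Forms21 d e t (g (k + 5)) ∧ ∀ j < L, Slices {g (k + 5), t} (g j) ↔ j = k + 6)) :
    IsExt₂ S L g (k + 4) q r t := by
  obtain ⟨hlq, hlr⟩ := h.lodged hw
  have hd3 := hdir (k + 3) (by omega) (by omega)
  have hd4 := hdir (k + 4) (by omega) (by omega)
  rw [hw.h3] at hd3
  rw [hw.h4] at hd4
  have hrq := h.rq
  have hqr := h.qr
  have htop := h.top
  have hside := h.side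
  have r4 := hw.r4
  have hq0 := h.past_q 0 (by omega)
  have hr0 := h.past_r 0 (by omega)
  have hA : ∀ u ∈ ({g (k + 4), q, r} : Set Pt), ∀ j < k + 3,
      d.along (g j) < d.along u ∧ e.along (g j) < e.along u := by
    rintro u (rfl | rfl | rfl) j hj
    · exact ⟨hw.l3 j hj, hw.b4 j (by omega)⟩
    · exact h.past_q j hj
    · exact h.past_r j hj
  have hA' : ∀ u ∈ ({g (k + 4), q, r} : Set Pt), ∀ c : Dir,
      ∃ j < k + 5, c.along u ≤ c.along (g j) := by
    rintro u (rfl | rfl | rfl) c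
    · exact ⟨k + 4, by omega, le_rfl⟩
    all_goals
      rcases hw.perp.cases c with rfl | rfl | rfl | rfl
      · exact ⟨k + 4, by omega, by omega⟩
      · exact ⟨k + 4, by omega, by omega⟩
      · refine ⟨0, by omega, ?_⟩
        simp only [Dir.along_opp]
        omega
      · refine ⟨0, by omega, ?_⟩
        simp only [Dir.along_opp]
        omega
  -- the only pins that can slice a part of the triple
  have hpin : ∀ A ⊆ ({g (k + 4), q, r} : Set Pt), ∀ j < L, Slices A (g j) →
      j = k + 4 ∨ j = k + 5 := by
    intro A hAs j hj hs
    have h1 : k + 3 ≤ j := by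
      by_contra hlt
      exact not_slices_of_inner (N := k + 2) hw.perp (fun c => ⟨j, by omega, le_rfl⟩)
        (fun u hu l hl => hA u (hAs hu) l (by omega)) hs
    have h2 : j < k + 6 := by
      by_contra hlt
      exact hg.not_slices_later (m := k + 5) (by omega) (by omega) hj
        (fun u hu c => hA' u (hAs hu) c) hs
    by_contra hcon
    obtain rfl : j = k + 3 := by omega
    have h3 := hw.l2 0 (by omega)
    have h4 := hw.r3
    refine not_slices_of_corner hw.perp.opp_right (fun u hu => ?_) hs
    rcases hAs hu with rfl | rfl | rfl <;> simp only [Dir.along_opp] <;> omega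
  have hmem : ({q, r} : Set Pt) ⊆ {g (k + 4), q, r} := by
    intro u hu
    exact Or.inr hu
  refine ⟨d, e, hd3, hd4, ?_, ⟨Or.inr ⟨hrq, hqr⟩, ?_, ?_⟩, ⟨by omega, ⟨e, ?_, r4⟩, ?_⟩⟩
  · rcases ht with ht | ht
    · exact Or.inl ht
    · exact Or.inr ⟨by omega, ht⟩
  · rintro z (rfl | rfl)
    · refine ⟨⟨htop, by omega⟩, ?_⟩
      rintro _ ⟨j, hj, rfl⟩
      change j < k + 3 at hj
      exact h.past_q j hj
    · refine ⟨⟨by omega, by omega⟩, ?_⟩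
      rintro _ ⟨j, hj, rfl⟩
      change j < k + 3 at hj
      exact h.past_r j hj
  · intro z hz
    constructor
    · intro hs
      rcases hS.cases_of_slices (A := {q, r}) hg hw.perp (fun u hu => hA u (hmem hu)) (fun u hu c => by
        obtain ⟨l, hl, hl'⟩ := hA' u (hmem hu) c
        exact ⟨l, by omega, hl'⟩) hz hs with hX | ⟨j, hj, rfl, -, -⟩
      · rcases hX with rfl | rfl | hX
        · exact absurd hs (not_slices_of_mem (by simp))
        · exact absurd hs (not_slices_of_mem (by simp))
        · exact hX
      · exfalso
        rcases hpin {q, r} hmem j hj hs with rfl | rfl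
        · refine not_slices_of_corner hw.perp (fun u hu => ?_) hs
          rcases hu with rfl | rfl <;> omega
        · have h5 := hw.b5 0 (by omega)
          refine not_slices_of_corner hw.perp.opp_left (fun u hu => ?_) hs
          rcases hu with rfl | rfl <;> simp only [Dir.along_opp] <;> omega
    · rintro rfl
      exact hsl
  · rintro u (rfl | rfl)
    · change e.along u < e.along (g (k + 5))
      omega
    · exact hside
  · intro j hj
    constructor
    · intro hs
      rcases hpin _ subset_rfl j hj hs with rfl | rfl
      · exact absurd hs (not_slices_of_mem (by simp))
      · rfl
    · rintro rfl
      refine ⟨d.opp, (slicesFrom_iff hw.perp.opp_left).2 ⟨?_, ⟨r, by simp, hside⟩,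
        g (k + 4), by simp, r4⟩⟩
      have h5 := hw.b5 0 (by omega)
      have h6 := hw.b5 (k + 4) (by omega)
      change d.along (g (k + 4 + 1)) < _ at h5
      change d.along (g (k + 4 + 1)) < _ at h6
      rintro u (rfl | rfl | rfl) <;> simp only [Dir.along_opp] <;> omega

theorem PairExt.isExt₂ (h : PairExt d e g g k q r t) (hg : IsSpiral δ L g)
    (hdir : ∀ i, 2 ≤ i → i < L → HasDir g i (δ i)) (hw : Window δ g k d e) (hL : k + 8 < L)
    {S : Set Pt} (hS : FarFrom δ L g k {q, r, t} S) (htS : t ∈ S) :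
    IsExt₂ S L g (k + 4) q r t := by
  have ht0 := h.past_t 0 (by omega)
  have hq0 := h.past_q 0 (by omega)
  have hr0 := h.past_r 0 (by omega)
  have hqt := h.qt
  have htr := h.tr
  have hlow := h.low
  have hside := h.side
  have r5 := hw.r5
  have r4 := hw.r4
  refine h.toPairPos.isExt₂ hg hdir hw hL hS htS ⟨d.opp, (slicesFrom_iff hw.perp.opp_left).2
    ⟨?_, ⟨q, by simp, hqt⟩, r, by simp, htr⟩⟩ (Or.inr ⟨Or.inr ⟨by omega, by omega⟩, ?_⟩)
  · rintro u (rfl | rfl) <;> simp only [Dir.along_opp] <;> omega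
  intro j hj
  constructor
  · intro hs
    have hno : ∀ {c c' : Dir}, Perp c c' → c.along (g (k + 5)) < c.along (g j) →
        c.along t < c.along (g j) → c'.along (g (k + 5)) < c'.along (g j) →
        c'.along t < c'.along (g j) → False := by
      intro c c' hcc h1 h2 h3 h4
      refine not_slices_of_corner hcc ?_ hs
      rintro u (rfl | rfl)
      · exact ⟨h1, h3⟩
      · exact ⟨h2, h4⟩
    have h1 : k + 3 ≤ j := by
      by_contra hlt
      have h2 := h.past_t j (by omega)
      have h3 := hw.b5 j (by omega)
      have h4 := hw.l4 j (by omega)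
      refine hno hw.perp.opp_right ?_ ?_ ?_ ?_ <;> (try simp only [Dir.along_opp]) <;> omega
    have h2 : j < k + 7 := by
      by_contra hlt
      refine hg.not_slices_later (m := k + 6) (by omega) (by omega) hj (fun u hu c => ?_) hs
      rcases hu with rfl | rfl
      · exact ⟨k + 5, by omega, le_rfl⟩
      · rcases hw.perp.cases c with rfl | rfl | rfl | rfl
        · exact ⟨0, by omega, ht0.1.le⟩
        · exact ⟨k + 5, by omega, by omega⟩
        · refine ⟨k + 5, by omega, ?_⟩
          simp only [Dir.along_opp]
          omega
        · refine ⟨0, by omega, ?_⟩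
          simp only [Dir.along_opp]
          omega
    have hcase : j = k + 3 ∨ j = k + 4 ∨ j = k + 5 ∨ j = k + 6 := by omega
    rcases hcase with rfl | rfl | rfl | rfl
    · exfalso
      have h3 := hw.b3 0 (by omega)
      have h4 := hw.b5 (k + 3) (by omega)
      have h5 := hw.l2 0 (by omega)
      refine hno hw.perp.opp_right ?_ ?_ ?_ ?_ <;> (try simp only [Dir.along_opp]) <;> omega
    · exfalso
      have h3 := hw.l3 0 (by omega)
      refine hno hw.perp ?_ ?_ ?_ ?_ <;> omega
    · exact absurd hs (not_slices_of_mem (by simp))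
    · rfl
  · rintro rfl
    have h3 := hw.b6 0 (by omega)
    have h4 := hw.b6 (k + 5) (by omega)
    refine ⟨e.opp, (slicesFrom_iff hw.perp.symm.opp_left).2 ⟨?_, ⟨g (k + 5), by simp, r5⟩,
      t, by simp, hlow⟩⟩
    rintro u (rfl | rfl) <;> simp only [Dir.along_opp] <;> omega

theorem PairExt'.isExt₂ (h : PairExt' d e g g k q r t) (hg : IsSpiral δ L g)
    (hdir : ∀ i, 2 ≤ i → i < L → HasDir g i (δ i)) (hw : Window δ g k d e) (hL : k + 8 < L)
    {S : Set Pt} (hS : FarFrom δ L g k {q, r, t} S) (htS : t ∈ S) :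
    IsExt₂ S L g (k + 4) q r t := by
  have ht0 := h.past_t 0 (by omega)
  have hq0 := h.past_q 0 (by omega)
  have hr0 := h.past_r 0 (by omega)
  have hrt := h.rt
  have htq := h.tq
  have hlow := h.low
  have htop := h.top
  have r3 := hw.r3
  have r2 := hw.r2
  refine h.toPairPos.isExt₂ hg hdir hw hL hS htS ⟨e.opp, (slicesFrom_iff
    hw.perp.symm.opp_left).2 ⟨?_, ⟨r, by simp, hrt⟩, q, by simp, htq⟩⟩
    (Or.inl ⟨Or.inr ⟨by omega, by omega⟩, ?_⟩)
  · rintro u (rfl | rfl) <;> simp only [Dir.along_opp] <;> omega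
  intro j hj
  constructor
  · intro hs
    have hno : ∀ {c c' : Dir}, Perp c c' → c.along (g (k + 3)) < c.along (g j) →
        c.along t < c.along (g j) → c'.along (g (k + 3)) < c'.along (g j) →
        c'.along t < c'.along (g j) → False := by
      intro c c' hcc h1 h2 h3 h4
      refine not_slices_of_corner hcc ?_ hs
      rintro u (rfl | rfl)
      · exact ⟨h1, h3⟩
      · exact ⟨h2, h4⟩
    have h1 : k + 2 ≤ j := by
      by_contra hlt
      have h2 := h.past_t j (by omega)
      have h3 := hw.b3 j (by omega)
      have h4 := hw.l2 j (by omega)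
      refine hno hw.perp.opp_left ?_ ?_ ?_ ?_ <;> (try simp only [Dir.along_opp]) <;> omega
    have h2 : j < k + 5 := by
      by_contra hlt
      refine hg.not_slices_later (m := k + 4) (by omega) (by omega) hj (fun u hu c => ?_) hs
      rcases hu with rfl | rfl
      · exact ⟨k + 3, by omega, le_rfl⟩
      · rcases hw.perp.cases c with rfl | rfl | rfl | rfl
        · exact ⟨k + 3, by omega, by omega⟩
        · exact ⟨0, by omega, ht0.2.le⟩
        · refine ⟨0, by omega, ?_⟩
          simp only [Dir.along_opp]
          omega
        · refine ⟨k + 3, by omega, ?_⟩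
          simp only [Dir.along_opp]
          omega
    have hcase : j = k + 2 ∨ j = k + 3 ∨ j = k + 4 := by omega
    rcases hcase with rfl | rfl | rfl
    · exfalso
      have h3 := hw.b3 (k + 2) (by omega)
      have h4 := hw.l1 0 (by omega)
      refine hno hw.perp.opp_left.opp_right ?_ ?_ ?_ ?_ <;> (try simp only [Dir.along_opp]) <;> omega
    · exact absurd hs (not_slices_of_mem (by simp))
    · rfl
  · rintro rfl
    have h3 := hw.b4 0 (by omega)
    have h4 := hw.b4 (k + 3) (by omega)
    refine ⟨e, (slicesFrom_iff hw.perp.symm).2 ⟨?_, ⟨t, by simp, by omega⟩,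
      g (k + 3), by simp, r3⟩⟩
    rintro u (rfl | rfl) <;> omega

end

/-! ### Replacing pins of a spiral -/

/-- The points `u` and `v` may take the places of the pins `f (m + 4)` and `f (m + 5)` of a
spiral. Neither of them leaves the hull of the original pins. -/
structure Swap (δ : ℕ → Dir) (f : ℕ → Pt) (m : ℕ) (u v : Pt) : Prop where
  u_past : ∀ j < m + 4, (δ (m + 4)).along (f j) < (δ (m + 4)).along u
  u_le : (δ (m + 4)).along u ≤ (δ (m + 4)).along (f (m + 4))
  u_left : ∀ j < m + 3, (δ (m + 3)).along (f j) < (δ (m + 3)).along u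
  u_right : (δ (m + 3)).along u < (δ (m + 3)).along (f (m + 3))
  v_past : ∀ j < m + 4, (δ (m + 5)).along (f j) < (δ (m + 5)).along v
  v_le : (δ (m + 5)).along v ≤ (δ (m + 5)).along (f (m + 5))
  v_left : ∀ j < m + 4, (δ (m + 4)).along (f j) < (δ (m + 4)).along v
  v_right : (δ (m + 4)).along v < (δ (m + 4)).along u
  next : (δ (m + 5)).along (f (m + 6)) < (δ (m + 5)).along v

/-- The sequence `f` with `f (m + 4)` and `f (m + 5)` replaced by `u m` and `v m`, for all `m` in
`E`. -/
def swapped (E : Finset ℕ) (u v f : ℕ → Pt) (i : ℕ) : Pt :=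
  if 4 ≤ i ∧ i - 4 ∈ E then u (i - 4) else if 5 ≤ i ∧ i - 5 ∈ E then v (i - 5) else f i

section

variable {δ : ℕ → Dir} {L : ℕ} {E : Finset ℕ} {u v f : ℕ → Pt}

theorem swapped_first {m : ℕ} (hm : m ∈ E) : swapped E u v f (m + 4) = u m := by
  simp [swapped, hm]

theorem swapped_second (hsp : ∀ m ∈ E, ∀ m' ∈ E, m < m' → m + 6 ≤ m') {m : ℕ} (hm : m ∈ E) :
    swapped E u v f (m + 5) = v m := by
  have h1 : ¬ (4 ≤ m + 5 ∧ m + 5 - 4 ∈ E) := by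
    rintro ⟨-, h⟩
    have := hsp m hm _ h (by omega)
    omega
  rw [swapped, if_neg h1, if_pos ⟨by omega, by simpa using hm⟩]
  simp

theorem swapped_other {i : ℕ} (h4 : ∀ m ∈ E, i ≠ m + 4) (h5 : ∀ m ∈ E, i ≠ m + 5) :
    swapped E u v f i = f i := by
  rw [swapped, if_neg, if_neg]
  · rintro ⟨h, h'⟩
    exact h5 _ h' (by omega)
  · rintro ⟨h, h'⟩
    exact h4 _ h' (by omega)

theorem swapped_cases (i : ℕ) : (∃ m ∈ E, i = m + 4) ∨ (∃ m ∈ E, i = m + 5) ∨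
    ((∀ m ∈ E, i ≠ m + 4) ∧ ∀ m ∈ E, i ≠ m + 5) := by
  by_cases h4 : ∃ m ∈ E, i = m + 4
  · exact Or.inl h4
  · by_cases h5 : ∃ m ∈ E, i = m + 5
    · exact Or.inr (Or.inl h5)
    · push Not at h4 h5
      exact Or.inr (Or.inr ⟨h4, h5⟩)

/-- The hull of an initial part of the swapped sequence lies in the hull of the same initial part
of the original one. -/
theorem swapped_hull (hf : IsSpiral δ L f) (hsp : ∀ m ∈ E, ∀ m' ∈ E, m < m' → m + 6 ≤ m')
    (hsw : ∀ m ∈ E, Swap δ f m (u m) (v m)) (i : ℕ) (c : Dir) :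
    ∃ j ≤ i, c.along (swapped E u v f i) ≤ c.along (f j) := by
  rcases swapped_cases (E := E) i with ⟨m, hm, rfl⟩ | ⟨m, hm, rfl⟩ | ⟨h4, h5⟩
  · rw [swapped_first hm]
    have h := hsw m hm
    rcases (hf.perp (m + 3)).cases c with rfl | rfl | rfl | rfl
    · exact ⟨m + 3, by omega, h.u_right.le⟩
    · exact ⟨m + 4, by omega, h.u_le⟩
    · refine ⟨0, by omega, ?_⟩
      have := h.u_left 0 (by omega)
      simp only [Dir.along_opp]
      omega
    · refine ⟨0, by omega, ?_⟩
      have := h.u_past 0 (by omega)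
      simp only [Dir.along_opp]
      exact neg_le_neg this.le
  · rw [swapped_second hsp hm]
    have h := hsw m hm
    rcases (hf.perp (m + 4)).cases c with rfl | rfl | rfl | rfl
    · exact ⟨m + 4, by omega, h.v_right.le.trans h.u_le⟩
    · exact ⟨m + 5, by omega, h.v_le⟩
    · refine ⟨0, by omega, ?_⟩
      have := h.v_left 0 (by omega)
      simp only [Dir.along_opp]
      omega
    · refine ⟨0, by omega, ?_⟩
      have := h.v_past 0 (by omega)
      simp only [Dir.along_opp]
      exact neg_le_neg this.le
  · exact ⟨i, le_rfl, by rw [swapped_other h4 h5]⟩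

theorem IsSpiral.swapped (hf : IsSpiral δ L f)
    (hsp : ∀ m ∈ E, ∀ m' ∈ E, m < m' → m + 6 ≤ m') (hsw : ∀ m ∈ E, Swap δ f m (u m) (v m)) :
    IsSpiral δ L (swapped E u v f) := by
  have h0 : ∀ i < 4, SawtoothPin.swapped E u v f i = f i := fun i hi =>
    swapped_other (fun m _ => by omega) (fun m _ => by omega)
  refine ⟨hf.perp, hf.opp, hf.two_le, ?_, ?_, ?_, ?_, ?_⟩
  · rw [h0 0 (by omega), h0 1 (by omega)]
    exact hf.ne
  · rw [h0 2 (by omega), initial_congr fun j hj => h0 j (by omega)]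
    exact hf.start
  · intro i j hi hL hj
    obtain ⟨l, hl, hl'⟩ := swapped_hull hf hsp hsw j (δ i)
    refine lt_of_le_of_lt hl' ?_
    rcases swapped_cases (E := E) i with ⟨m, hm, rfl⟩ | ⟨m, hm, rfl⟩ | ⟨h4, h5⟩
    · rw [swapped_first hm]
      exact (hsw m hm).u_past l (by omega)
    · rw [swapped_second hsp hm]
      rcases Nat.lt_or_ge l (m + 4) with h | h
      · exact (hsw m hm).v_past l h
      · -- the original pin `f (m + 4)` lies higher than `f 0` in direction `δ (m + 3)`
        obtain rfl : l = m + 4 := by omega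
        refine lt_trans ?_ ((hsw m hm).v_past 0 (by omega))
        have := hf.left (m + 3) 0 (by omega) (by omega) (by omega)
        rw [show m + 5 = m + 3 + 2 from rfl, hf.opp, Dir.along_opp, Dir.along_opp]
        exact neg_lt_neg this
    · rw [swapped_other h4 h5]
      exact hf.beyond i l hi hL (by omega)
  · intro i j hi hL hj
    obtain ⟨l, hl, hl'⟩ := swapped_hull hf hsp hsw j (δ i)
    refine lt_of_le_of_lt hl' ?_
    rcases swapped_cases (E := E) (i + 1) with ⟨m, hm, he⟩ | ⟨m, hm, he⟩ | ⟨h4, h5⟩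
    · obtain rfl : i = m + 3 := by omega
      rw [show m + 3 + 1 = m + 4 from rfl, swapped_first hm]
      exact (hsw m hm).u_left l (by omega)
    · obtain rfl : i = m + 4 := by omega
      rw [show m + 4 + 1 = m + 5 from rfl, swapped_second hsp hm]
      exact (hsw m hm).v_left l (by omega)
    · rw [swapped_other h4 h5]
      exact hf.left i l hi hL (by omega)
  · intro i hi hL
    have hnext : ∀ m ∈ E, ∀ m' ∈ E, i + 1 = m + 4 ∨ i + 1 = m + 5 → i = m' + 4 ∨ i = m' + 5 →
        i + 1 = m + 5 ∧ i = m' + 4 := by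
      intro m hm m' hm' h1 h2
      rcases lt_trichotomy m m' with h | h | h
      · have := hsp m hm m' hm' h
        omega
      · omega
      · have := hsp m' hm' m hm h
        omega
    rcases swapped_cases (E := E) i with ⟨m, hm, rfl⟩ | ⟨m, hm, rfl⟩ | ⟨h4, h5⟩
    · rw [show m + 4 + 1 = m + 5 from rfl, swapped_first hm, swapped_second hsp hm]
      exact (hsw m hm).v_right
    · rw [swapped_second hsp hm, swapped_other (i := m + 5 + 1)]
      · exact (hsw m hm).next
      · intro m' hm' he
        have := hnext m' hm' m hm (Or.inl he) (Or.inr rfl)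
        omega
      · intro m' hm' he
        have := hnext m' hm' m hm (Or.inr he) (Or.inr rfl)
        omega
    · rcases swapped_cases (E := E) (i + 1) with ⟨m, hm, he⟩ | ⟨m, hm, he⟩ | ⟨h4', h5'⟩
      · obtain rfl : i = m + 3 := by omega
        rw [show m + 3 + 1 = m + 4 from rfl, swapped_first hm, swapped_other h4 h5]
        exact (hsw m hm).u_right
      · exact absurd (show i = m + 4 by omega) (h4 m hm)
      · rw [swapped_other h4 h5, swapped_other h4' h5']
        exact hf.right i hi hL

end

/-! ### Joining extensions at different stages of a spiral -/

/-- The points `X` extend the pin `g i`, which is `g (m + 4)` or `g (m + 5)`. -/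
def StageExt (δ : ℕ → Dir) (f g : ℕ → Pt) (m : ℕ) (X : Set Pt) (i : ℕ) : Prop :=
  (i = m + 4 ∧ ∃ q, X = {q} ∧ CornerExt (δ (m + 3)) (δ (m + 4)) f g m q) ∨
  (i = m + 5 ∧ ∃ q, X = {q} ∧ CornerExt (δ (m + 4)) (δ (m + 5)) f g (m + 1) q) ∨
  (i = m + 4 ∧ ∃ q r t, X = {q, r, t} ∧ PairExt (δ (m + 3)) (δ (m + 4)) f g m q r t) ∨
  (i = m + 5 ∧ ∃ q r t, X = {q, r, t} ∧ PairExt' (δ (m + 4)) (δ (m + 5)) f g (m + 1) q r t)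

section

variable {δ : ℕ → Dir} {L m i : ℕ} {f g g' : ℕ → Pt} {d e : Dir} {X : Set Pt}

theorem past_mono (hull : ∀ j, ∀ c : Dir, ∃ l ≤ j, c.along (g j) ≤ c.along (f l)) {c : Dir}
    {z : Pt} {n : ℕ} (h : ∀ j < n, c.along (f j) < c.along z) :
    ∀ j < n, c.along (g j) < c.along z := by
  intro j hj
  obtain ⟨l, hl, hl'⟩ := hull j c
  exact lt_of_le_of_lt hl' (h l (by omega))

theorem past_mono_opp (hull : ∀ j, ∀ c : Dir, ∃ l ≤ j, c.along (g j) ≤ c.along (f l)) {c : Dir}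
    {z : Pt} {n : ℕ} (h : ∀ j < n, c.along z < c.along (f j)) :
    ∀ j < n, c.along z < c.along (g j) := by
  intro j hj
  obtain ⟨l, hl, hl'⟩ := hull j c.opp
  have := h l (by omega)
  simp only [Dir.along_opp] at hl'
  omega

/-- Extensions are preserved if the pins nearby stay in place and the other pins stay within the
hull of the original sequence. -/
theorem CornerExt.congr {k : ℕ} {q : Pt} (h : CornerExt d e f g' k q)
    (hull : ∀ j, ∀ c : Dir, ∃ l ≤ j, c.along (g j) ≤ c.along (f l))
    (hg : ∀ j, k + 3 ≤ j → j ≤ k + 8 → g j = g' j) : CornerExt d e g g k q := by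
  refine ⟨fun j hj => ⟨past_mono hull (fun l hl => (h.past l hl).1) j hj,
    past_mono hull (fun l hl => (h.past l hl).2) j hj⟩, ?_, ?_, ?_, ?_⟩
  · rw [hg _ (by omega) (by omega)]
    exact h.side
  · rw [hg _ (by omega) (by omega)]
    exact h.side'
  · rw [hg _ (by omega) (by omega)]
    exact h.top
  · rw [hg _ (by omega) (by omega), hg _ (by omega) (by omega)]
    exact h.cut

theorem PairPos.congr {k : ℕ} {q r : Pt} (h : PairPos d e f g' k q r)
    (hull : ∀ j, ∀ c : Dir, ∃ l ≤ j, c.along (g j) ≤ c.along (f l))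
    (hg : ∀ j, k + 3 ≤ j → j ≤ k + 8 → g j = g' j) : PairPos d e g g k q r := by
  refine ⟨fun j hj => ⟨past_mono hull (fun l hl => (h.past_q l hl).1) j hj,
    past_mono hull (fun l hl => (h.past_q l hl).2) j hj⟩,
    fun j hj => ⟨past_mono hull (fun l hl => (h.past_r l hl).1) j hj,
    past_mono hull (fun l hl => (h.past_r l hl).2) j hj⟩, h.rq, h.qr, ?_, ?_⟩
  · rw [hg _ (by omega) (by omega)]
    exact h.top
  · rw [hg _ (by omega) (by omega)]
    exact h.side

theorem PairExt.congr {k : ℕ} {q r t : Pt} (h : PairExt d e f g' k q r t)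
    (hull : ∀ j, ∀ c : Dir, ∃ l ≤ j, c.along (g j) ≤ c.along (f l))
    (hg : ∀ j, k + 3 ≤ j → j ≤ k + 8 → g j = g' j) : PairExt d e g g k q r t := by
  refine ⟨h.toPairPos.congr hull hg, fun j hj =>
    ⟨past_mono_opp hull (fun l hl => (h.past_t l hl).1) j hj,
    past_mono hull (fun l hl => (h.past_t l hl).2) j hj⟩, h.qt, h.tr, ?_⟩
  rw [hg _ (by omega) (by omega)]
  exact h.low

theorem PairExt'.congr {k : ℕ} {q r t : Pt} (h : PairExt' d e f g' k q r t)
    (hull : ∀ j, ∀ c : Dir, ∃ l ≤ j, c.along (g j) ≤ c.along (f l))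
    (hg : ∀ j, k + 3 ≤ j → j ≤ k + 8 → g j = g' j) : PairExt' d e g g k q r t := by
  refine ⟨h.toPairPos.congr hull hg, fun j hj =>
    ⟨past_mono hull (fun l hl => (h.past_t l hl).1) j hj,
    past_mono_opp hull (fun l hl => (h.past_t l hl).2) j hj⟩, h.rt, h.tq, ?_⟩
  rw [hg _ (by omega) (by omega)]
  exact h.low

theorem StageExt.congr (h : StageExt δ f g' m X i)
    (hull : ∀ j, ∀ c : Dir, ∃ l ≤ j, c.along (g j) ≤ c.along (f l))
    (hg : ∀ j, m + 3 ≤ j → j ≤ m + 9 → g j = g' j) : StageExt δ g g m X i := by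
  have hg' : ∀ j, m + 1 + 3 ≤ j → j ≤ m + 1 + 8 → g j = g' j := fun j h1 h2 =>
    hg j (by omega) (by omega)
  have hg'' : ∀ j, m + 3 ≤ j → j ≤ m + 8 → g j = g' j := fun j h1 h2 =>
    hg j (by omega) (by omega)
  rcases h with ⟨hi, q, hX, h⟩ | ⟨hi, q, hX, h⟩ | ⟨hi, q, r, t, hX, h⟩ | ⟨hi, q, r, t, hX, h⟩
  · exact Or.inl ⟨hi, q, hX, h.congr hull hg''⟩
  · exact Or.inr (Or.inl ⟨hi, q, hX, h.congr hull hg'⟩)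
  · exact Or.inr (Or.inr (Or.inl ⟨hi, q, r, t, hX, h.congr hull hg''⟩))
  · exact Or.inr (Or.inr (Or.inr ⟨hi, q, r, t, hX, h.congr hull hg'⟩))

theorem StageExt.index (h : StageExt δ f g m X i) : i = m + 4 ∨ i = m + 5 := by
  rcases h with ⟨hi, -⟩ | ⟨hi, -⟩ | ⟨hi, -⟩ | ⟨hi, -⟩
  · exact Or.inl hi
  · exact Or.inr hi
  · exact Or.inl hi
  · exact Or.inr hi

theorem StageExt.lodged (h : StageExt δ g g m X i) (hg : IsSpiral δ L g) (hm : 1 ≤ m)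
    (hL : m + 9 < L) {z : Pt} (hz : z ∈ X) :
    ∃ N, (N = m + 2 ∨ N = m + 3) ∧ Lodged δ g N z := by
  have hw := hg.window hm (by omega)
  have hw' := hg.window (k := m + 1) (by omega) (by omega)
  rcases h with ⟨-, q, rfl, h⟩ | ⟨-, q, rfl, h⟩ | ⟨-, q, r, t, rfl, h⟩ | ⟨-, q, r, t, rfl, h⟩
  · obtain rfl := hz
    exact ⟨m + 2, by omega, h.lodged hw⟩
  · obtain rfl := hz
    exact ⟨m + 3, by omega, h.lodged hw'⟩
  · rcases hz with rfl | rfl | rfl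
    · exact ⟨m + 2, by omega, (h.toPairPos.lodged hw).1⟩
    · exact ⟨m + 2, by omega, (h.toPairPos.lodged hw).2⟩
    · exact ⟨m + 2, by omega, h.lodged hw⟩
  · rcases hz with rfl | rfl | rfl
    · exact ⟨m + 3, by omega, (h.toPairPos.lodged hw').1⟩
    · exact ⟨m + 3, by omega, (h.toPairPos.lodged hw').2⟩
    · exact ⟨m + 2, by omega, h.lodged hw'⟩

theorem StageExt.isExt (h : StageExt δ g g m X i) (hg : IsSpiral δ L g)
    (hdir : ∀ i, 2 ≤ i → i < L → HasDir g i (δ i)) (hm : 1 ≤ m) (hL : m + 9 < L) {S : Set Pt}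
    (hXS : X ⊆ S) (hS : ∀ z ∈ S, (∃ j < L, z = g j) ∨ z ∈ X ∨
      ∃ N, Lodged δ g N z ∧ (N + 5 ≤ m + 2 ∨ m + 8 ≤ N)) :
    (∃ q, X = {q} ∧ IsExt₁ S L g i q) ∨ ∃ q r t, X = {q, r, t} ∧ IsExt₂ S L g i q r t := by
  have hw := hg.window hm (by omega)
  have hw' := hg.window (k := m + 1) (by omega) (by omega)
  have hfar : FarFrom δ L g m X S := by
    intro z hz
    rcases hS z hz with h | h | ⟨N, hN, h⟩
    · exact Or.inl h
    · exact Or.inr (Or.inl h)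
    · exact Or.inr (Or.inr ⟨N, hN, by omega⟩)
  have hfar' : FarFrom δ L g (m + 1) X S := by
    intro z hz
    rcases hS z hz with h | h | ⟨N, hN, h⟩
    · exact Or.inl h
    · exact Or.inr (Or.inl h)
    · exact Or.inr (Or.inr ⟨N, hN, by omega⟩)
  rcases h with ⟨rfl, q, rfl, h⟩ | ⟨rfl, q, rfl, h⟩ | ⟨rfl, q, r, t, rfl, h⟩ |
    ⟨rfl, q, r, t, rfl, h⟩
  · exact Or.inl ⟨q, rfl, h.isExt₁ hg hdir hw (by omega) hfar⟩
  · exact Or.inl ⟨q, rfl, h.isExt₁ hg hdir hw' (by omega) hfar'⟩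
  · exact Or.inr ⟨q, r, t, rfl, h.isExt₂ hg hdir hw (by omega) hfar (hXS (by simp))⟩
  · exact Or.inr ⟨q, r, t, rfl, h.isExt₂ hg hdir hw' (by omega) hfar' (hXS (by simp))⟩

end

/-- Pin replacements and extensions at stages of a spiral that are at least six pins apart do not
interfere. -/
theorem isExtendedSpiral_of_stageExt {δ : ℕ → Dir} {L : ℕ} {f : ℕ → Pt} {P : Set Pt}
    (hf : IsSpiral δ L f) (hfP : ∀ i < L, f i ∈ P) (E : Finset ℕ) (u v : ℕ → Pt)
    (X : ℕ → Set Pt) (ι : ℕ → ℕ) (hE : ∀ m ∈ E, 1 ≤ m ∧ m + 9 < L)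
    (hsp : ∀ m ∈ E, ∀ m' ∈ E, m < m' → m + 6 ≤ m') (hu : ∀ m ∈ E, u m ∈ P)
    (hv : ∀ m ∈ E, v m ∈ P) (hX : ∀ m ∈ E, X m ⊆ P)
    (hsw : ∀ m ∈ E, Swap δ f m (u m) (v m))
    (hext : ∀ m ∈ E, StageExt δ f
      (Function.update (Function.update f (m + 4) (u m)) (m + 5) (v m)) m (X m) (ι m)) :
    ∃ S ⊆ P, IsExtendedSpiral S E.card := by
  classical
  set g := swapped E u v f with hgdef
  have hg : IsSpiral δ L g := hf.swapped hsp hsw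
  have hst : ∀ m ∈ E, StageExt δ g g m (X m) (ι m) := by
    intro m hm
    refine (hext m hm).congr (swapped_hull hf hsp hsw) fun j h1 h2 => ?_
    by_cases h5 : j = m + 5
    · rw [h5, Function.update_self, hgdef, swapped_second hsp hm]
    · rw [Function.update_of_ne h5]
      by_cases h4 : j = m + 4
      · rw [h4, Function.update_self, hgdef, swapped_first hm]
      · rw [Function.update_of_ne h4, hgdef]
        refine swapped_other (fun m' hm' he => ?_) (fun m' hm' he => ?_)
        all_goals
          rcases lt_trichotomy m m' with h | h | h
          · have := hsp m hm m' hm' h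
            omega
          · omega
          · have := hsp m' hm' m hm h
            omega
  have hinj : Set.InjOn ι E := by
    intro m hm m' hm' he
    have h1 := (hst m hm).index
    have h2 := (hst m' hm').index
    rcases lt_trichotomy m m' with h | h | h
    · have := hsp m hm m' hm' h
      omega
    · exact h
    · have := hsp m' hm' m hm h
      omega
  set Y : ℕ → Set Pt := fun i => {z | ∃ m ∈ E, ι m = i ∧ z ∈ X m}
  have hYX : ∀ m ∈ E, Y (ι m) = X m := by
    intro m hm
    ext z
    constructor
    · rintro ⟨m', hm', he, hz⟩
      rwa [← hinj hm' hm he]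
    · intro hz
      exact ⟨m, hm, rfl, hz⟩
  have hlodged : ∀ m ∈ E, ∀ z ∈ X m, ∃ N, (N = m + 2 ∨ N = m + 3) ∧ Lodged δ g N z :=
    fun m hm z hz => (hst m hm).lodged hg (hE m hm).1 (hE m hm).2 hz
  set S : Set Pt := initial g L ∪ ⋃ i ∈ E.image ι, Y i
  have hmemS : ∀ z ∈ S, (∃ j < L, z = g j) ∨ ∃ m ∈ E, z ∈ X m := by
    rintro z (⟨j, hj, rfl⟩ | hz)
    · exact Or.inl ⟨j, hj, rfl⟩
    · simp only [Set.mem_iUnion, Finset.mem_image, exists_prop] at hz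
      obtain ⟨i, ⟨m, hm, rfl⟩, hz⟩ := hz
      rw [hYX m hm] at hz
      exact Or.inr ⟨m, hm, hz⟩
  have hXS : ∀ m ∈ E, X m ⊆ S := by
    intro m hm z hz
    right
    simp only [Set.mem_iUnion, Finset.mem_image, exists_prop]
    exact ⟨ι m, ⟨m, hm, rfl⟩, by rwa [hYX m hm]⟩
  have hproper := hg.isProperPinSeq (S := S) (fun i hi => Or.inl (mem_initial hi)) (by
    intro z hz
    rcases hmemS z hz with h | ⟨m, hm, hz⟩
    · exact Or.inl h
    · obtain ⟨N, -, hN⟩ := hlodged m hm z hz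
      exact Or.inr ⟨N, hN⟩)
  obtain ⟨hprop, hdir⟩ := hproper
  refine ⟨S, ?_, L, g, E.image ι, Y, hprop, fun i hi => hg.not_isTurn hdir hi, ?_, ?_, rfl, ?_,
    ?_, ?_⟩
  · intro z hz
    rcases hmemS z hz with ⟨j, hj, rfl⟩ | ⟨m, hm, hz⟩
    · rcases swapped_cases (E := E) j with ⟨m, hm, rfl⟩ | ⟨m, hm, rfl⟩ | ⟨h4, h5⟩
      · rw [hgdef, swapped_first hm]
        exact hu m hm
      · rw [hgdef, swapped_second hsp hm]
        exact hv m hm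
      · rw [hgdef, swapped_other h4 h5]
        exact hfP j hj
    · exact hX m hm hz
  · rw [Finset.card_image_of_injOn hinj]
  · intro i hi
    obtain ⟨m, hm, rfl⟩ := Finset.mem_image.1 hi
    have h1 := (hst m hm).index
    have h2 := hE m hm
    omega
  · intro i hi
    obtain ⟨m, hm, rfl⟩ := Finset.mem_image.1 hi
    rw [hYX m hm, Set.disjoint_left]
    rintro z hz ⟨j, hj, rfl⟩
    obtain ⟨N, -, hN⟩ := hlodged m hm _ hz
    exact hN.ne_pin hg hj rfl
  · -- a point lodged at one stage lies within the hull of the pins before the next one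
    have key : ∀ m ∈ E, ∀ m' ∈ E, m < m' → ∀ z, z ∈ X m → z ∈ X m' → False := by
      intro m hm m' hm' hlt z hz hz'
      have := hsp m hm m' hm' hlt
      obtain ⟨N, hN, hNl⟩ := hlodged m hm z hz
      obtain ⟨N', hN', hNl'⟩ := hlodged m' hm' z hz'
      obtain ⟨d, e, -, ho⟩ := hNl'.out
      obtain ⟨j, hj, hj'⟩ := hNl.exists_le hg d
      have := (ho j (by omega)).1
      omega
    intro i hi j hj hij
    obtain ⟨m, hm, rfl⟩ := Finset.mem_image.1 hi
    obtain ⟨m', hm', rfl⟩ := Finset.mem_image.1 hj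
    rw [hYX m hm, hYX m' hm', Set.disjoint_left]
    intro z hz hz'
    rcases lt_trichotomy m m' with h | h | h
    · exact key m hm m' hm' h z hz hz'
    · exact hij (by rw [h])
    · exact key m' hm' m hm h z hz' hz
  · intro i hi
    obtain ⟨m, hm, rfl⟩ := Finset.mem_image.1 hi
    rw [hYX m hm]
    refine (hst m hm).isExt hg hdir (hE m hm).1 (hE m hm).2 (hXS m hm) ?_
    intro z hz
    rcases hmemS z hz with h | ⟨m', hm', hz⟩
    · exact Or.inl h
    · obtain ⟨N, hN, hNl⟩ := hlodged m' hm' z hz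
      rcases lt_trichotomy m m' with h | h | h
      · have := hsp m hm m' hm' h
        exact Or.inr (Or.inr ⟨N, hNl, by omega⟩)
      · rw [← h] at hz
        exact Or.inr (Or.inl hz)
      · have := hsp m' hm' m hm h
        exact Or.inr (Or.inr ⟨N, hNl, by omega⟩)

/-! ### A triple of the wedge in a turn of the spiral -/

/-- A spiral in the point set `P` whose pins are as far out as possible, and in which no pin can
be followed by one that lies beyond the next turn of the spiral in the direction before it. -/
structure TightSpiral (P : Set Pt) (δ : ℕ → Dir) (L : ℕ) (f : ℕ → Pt) : Prop
    extends IsSpiral δ L f where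
  generic : Generic P
  mem : ∀ i < L, f i ∈ P
  maximal : ∀ i, 2 ≤ i → i < L → ∀ z ∈ P, SlicesFrom (δ i) (initial f i) z →
    (δ i).along z ≤ (δ i).along (f i)
  no_shortcut : ∀ k, 2 ≤ k → k + 8 < L → ∀ z ∈ P,
    (∀ j < k + 4, (δ (k + 4)).along (f j) < (δ (k + 4)).along z) →
    (δ (k + 4)).along z < (δ (k + 4)).along (f (k + 4)) →
    (δ (k + 3)).along (f (k + 3)) < (δ (k + 3)).along z →
    (δ (k + 3)).along z ≤ (δ (k + 3)).along (f (k + 8))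

theorem Generic.along_ne {P : Set Pt} (h : Generic P) {z w : Pt} (hz : z ∈ P) (hw : w ∈ P)
    (c c' : Dir) (hne : c.along z ≠ c.along w) : c'.along z ≠ c'.along w := by
  intro he
  rw [h z hz w hw c' he] at hne
  exact hne rfl

namespace TightSpiral

variable {P : Set Pt} {δ : ℕ → Dir} {L k : ℕ} {f : ℕ → Pt} {d e : Dir} {z : Pt}

theorem along_le (hf : TightSpiral P δ L f) {i : ℕ} (hi : 1 ≤ i) (hL : i + 1 < L) (hz : z ∈ P)
    {j : ℕ} (hj : j < i + 1) (hl : (δ i).along (f j) < (δ i).along z)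
    (hr : (δ i).along z < (δ i).along (f i)) :
    (δ (i + 1)).along z ≤ (δ (i + 1)).along (f (i + 1)) := by
  by_contra hcon
  push Not at hcon
  refine absurd (hf.maximal (i + 1) (by omega) hL z hz ((slicesFrom_iff (hf.perp i).symm).2
    ⟨?_, ⟨_, mem_initial hj, hl⟩, _, mem_initial (Nat.lt_succ_self i), hr⟩)) (not_le.2 hcon)
  rintro _ ⟨l, hl, rfl⟩
  exact (hf.beyond (i + 1) l (by omega) hL hl).trans hcon

/-- A point beyond the pin `f (k + 3)` that separates `f (k + 4)` from its predecessors. -/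
theorem cornerExt_of_beyond (hf : TightSpiral P δ L f) (hw : Window δ f k d e) (hk : 2 ≤ k)
    (hL : k + 8 < L) (hz : z ∈ P) (hl : ∀ j < k + 4, e.along (f j) < e.along z)
    (hr : e.along z < e.along (f (k + 4))) (ht : d.along (f (k + 3)) < d.along z) :
    CornerExt d e f f k z := by
  have h1 := hf.no_shortcut k hk hL z hz
  rw [hw.h3, hw.h4] at h1
  have h2 := h1 hl hr ht
  have h3 : d.along z ≠ d.along (f (k + 8)) := by
    refine hf.generic.along_ne hz (hf.mem _ hL) e d ?_
    have := hw.b8 (k + 4) (by omega)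
    omega
  have h4 := hw.r3
  refine ⟨fun j hj => ⟨?_, hl j (by omega)⟩, by omega, hr, by omega, Or.inl ht⟩
  have := hw.b3 j hj
  omega

end TightSpiral

section

variable {P : Set Pt} {δ : ℕ → Dir} {L m : ℕ} {f g : ℕ → Pt} {d e : Dir}

/-- A point in the corner between the pins `f (k + 3)`, `f (k + 4)` and `f (k + 5)`. -/
theorem Window.cornerExt_of_between (hw : Window δ f k d e)
    (hl : ∀ j < k + 3, e.along (f j) < e.along z) (hr : e.along z < e.along (f (k + 5)))
    (hb : d.along (f (k + 4)) < d.along z) (ht : d.along z < d.along (f (k + 3))) :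
    CornerExt d e f f k z := by
  have h1 := hw.r4
  have h2 := hw.l7 (k + 3) (by omega)
  refine ⟨fun j hj => ⟨?_, hl j hj⟩, hb, by omega, by omega, Or.inr hr⟩
  have := hw.l3 j hj
  omega

theorem Window.swap (hw : Window δ f m d e) {u v : Pt}
    (hu : ∀ j < m + 4, e.along (f j) < e.along u) (hu' : e.along u ≤ e.along (f (m + 4)))
    (hu₁ : ∀ j < m + 3, d.along (f j) < d.along u) (hu₂ : d.along u < d.along (f (m + 3)))
    (hv : ∀ j < m + 4, d.along v < d.along (f j)) (hv' : d.along (f (m + 5)) ≤ d.along v)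
    (hv₁ : ∀ j < m + 4, e.along (f j) < e.along v) (hv₂ : e.along v < e.along u)
    (hn : d.along v < d.along (f (m + 6))) : Swap δ f m u v := by
  constructor
  · rwa [hw.h4]
  · rwa [hw.h4]
  · rwa [hw.h3]
  · rwa [hw.h3]
  · intro j hj
    have := hv j hj
    rw [hw.h5, Dir.along_opp, Dir.along_opp]
    omega
  · rw [hw.h5, Dir.along_opp, Dir.along_opp]
    omega
  · rwa [hw.h4]
  · rwa [hw.h4]
  · rw [hw.h5, Dir.along_opp, Dir.along_opp]
    omega

/-- Some points `u` and `v` of `P` can replace the pins `f (m + 4)` and `f (m + 5)`, and one of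
these pins then has an extension in `P`. -/
def Extendable (P : Set Pt) (δ : ℕ → Dir) (f : ℕ → Pt) (m : ℕ) : Prop :=
  ∃ u ∈ P, ∃ v ∈ P, ∃ X ⊆ P, ∃ i, Swap δ f m u v ∧
    StageExt δ f (Function.update (Function.update f (m + 4) u) (m + 5) v) m X i

theorem TightSpiral.extendable_of_stageExt (hf : TightSpiral P δ L f) (hm : 1 ≤ m)
    (hL : m + 9 < L) {X : Set Pt} {i : ℕ} (hX : X ⊆ P) (h : StageExt δ f f m X i) :
    Extendable P δ f m := by
  have hw := hf.toIsSpiral.window hm (by omega)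
  refine ⟨f (m + 4), hf.mem _ (by omega), f (m + 5), hf.mem _ (by omega), X, hX, i,
    hw.swap hw.b4 le_rfl hw.l3 hw.r3 (fun j hj => hw.b5 j (by omega)) le_rfl hw.l4 hw.r4 hw.r5, ?_⟩
  rwa [Function.update_eq_self, Function.update_eq_self]

theorem StageExt.first {q : Pt} (h3 : δ (m + 3) = d) (h4 : δ (m + 4) = e)
    (h : CornerExt d e f g m q) : StageExt δ f g m {q} (m + 4) := by
  subst h3 h4
  exact Or.inl ⟨rfl, q, rfl, h⟩

theorem StageExt.second {q : Pt} (h4 : δ (m + 4) = d) (h5 : δ (m + 5) = e)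
    (h : CornerExt d e f g (m + 1) q) : StageExt δ f g m {q} (m + 5) := by
  subst h4 h5
  exact Or.inr (Or.inl ⟨rfl, q, rfl, h⟩)

variable {x y : Dir} {a b c : Pt}

/-- A triple in a turn of a spiral that turns from `y` to `x`: the pins `f (m + 3)`, `f (m + 4)`,
`f (m + 5)` point in the directions `y`, `x` and `y.opp`. -/
theorem TightSpiral.extendable_of_clockwise (hf : TightSpiral P δ L f) (hm : 2 ≤ m)
    (hL : m + 9 < L) (hy : δ (m + 3) = y) (hx : δ (m + 4) = x) (ha : a ∈ P) (hb : b ∈ P)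
    (hc : c ∈ P) (hac : x.along a < x.along c) (hcb : x.along c < x.along b)
    (hba : y.along b < y.along a) (hcb' : y.along c < y.along b)
    (hpast : ∀ j < m + 3, x.along (f j) < x.along a ∧ y.along (f j) < y.along b ∧
      y.along c < y.along (f j))
    (htouch : y.along b ≤ y.along (f (m + 3)) ∨ x.along a ≤ x.along (f (m + 4)) ∨
      y.along (f (m + 5)) ≤ y.along c ∧ ∀ j < m + 5, y.along c < y.along (f j)) :
    Extendable P δ f m := by
  have hw : Window δ f m y x := by
    subst hy hx
    exact hf.toIsSpiral.window (by omega) (by omega)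
  have hw' : Window δ f (m + 1) x y.opp := by
    have := hf.toIsSpiral.window (k := m + 1) (by omega) (by omega)
    rwa [show m + 1 + 3 = m + 4 from rfl, show m + 1 + 4 = m + 5 from rfl, hx, hw.h5] at this
  have h5 : δ (m + 5) = y.opp := hw.h5
  have hX1 : ∀ {z}, z ∈ P → ({z} : Set Pt) ⊆ P := fun hz => Set.singleton_subset_iff.2 hz
  have hp0 := hpast 0 (by omega)
  have x3 := hw.l2 0 (by omega)
  have y3 := hw.b3 0 (by omega)
  have y4 := hw.l3 0 (by omega)
  have y43 := hw.r3
  have x4 := hw.b4 0 (by omega)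
  have x54 := hw.r4
  have y5 := hw.b5 0 (by omega)
  have y6 := hw.l5 0 (by omega)
  have x6 := hw.b6 0 (by omega)
  have mem3 := hf.mem (m + 3) (by omega)
  have mem4 := hf.mem (m + 4) (by omega)
  have mem5 := hf.mem (m + 5) (by omega)
  have mem6 := hf.mem (m + 6) (by omega)
  -- a point below `f (m + 3)` is to the left of `f (m + 4)`
  have hright : ∀ z ∈ P, y.along b ≤ y.along z → y.along z < y.along (f (m + 3)) →
      x.along z ≤ x.along (f (m + 4)) := by
    intro z hz h1 h2
    have := hf.along_le (i := m + 3) (j := 0) (z := z) (by omega) (by omega) hz (by omega)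
    rw [hy, show m + 3 + 1 = m + 4 from rfl, hx] at this
    exact this (by omega) h2
  -- unless there is an extension, `a` is to the left of `f (m + 4)`
  by_cases hcx : (∀ j < m + 5, y.along c < y.along (f j)) ∧ y.along (f (m + 5)) ≤ y.along c ∧
      x.along (f (m + 4)) < x.along c
  · obtain ⟨h1, h2, h3⟩ := hcx
    have h4 := hf.generic.along_ne hc mem5 x y (by omega)
    refine hf.extendable_of_stageExt (by omega) hL (hX1 hc) (StageExt.second hx h5
      (hf.cornerExt_of_beyond hw' (by omega) (by omega) hc (fun j hj => ?_) ?_ h3))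
    · have := h1 j (by omega)
      simp only [Dir.along_opp]
      omega
    · rw [show m + 1 + 4 = m + 5 from rfl]
      simp only [Dir.along_opp]
      omega
  have hax : x.along a < x.along (f (m + 4)) := by
    rcases htouch with h | h | ⟨h, h'⟩
    · have h1 := hf.generic.along_ne hb mem3 x y (by omega)
      have := hright b hb le_rfl (by omega)
      omega
    · by_contra hcon
      have h1 : x.along a = x.along (f (m + 4)) := by omega
      have h2 := hf.generic _ ha _ mem4 x h1
      have := hright b hb le_rfl (by rw [← h2] at y43; omega)
      omega
    · have : ¬ x.along (f (m + 4)) < x.along c := fun h1 => hcx ⟨h', h, h1⟩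
      omega
  have ha3 := hf.generic.along_ne ha mem3 x y (by omega)
  by_cases hay : y.along (f (m + 3)) < y.along a
  · refine hf.extendable_of_stageExt (by omega) hL (hX1 ha) (StageExt.first hy hx
      (hf.cornerExt_of_beyond hw hm (by omega) ha (fun j hj => ?_) hax hay))
    rcases Nat.lt_or_ge j (m + 3) with h | h
    · exact (hpast j h).1
    · obtain rfl : j = m + 3 := by omega
      omega
  -- now the whole triple lies in the same turn of the spiral
  have hbx := hright b hb le_rfl (by omega)
  have hcy : y.along (f (m + 5)) ≤ y.along c := by
    have := hf.along_le (i := m + 4) (j := 0) (z := c) (by omega) (by omega) hc (by omega)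
    rw [hx, show m + 4 + 1 = m + 5 from rfl, h5, Dir.along_opp, Dir.along_opp] at this
    have := this (by omega) (by omega)
    omega
  have hxpast : ∀ {z}, x.along a ≤ x.along z → ∀ j < m + 4, x.along (f j) < x.along z := by
    intro z hz j hj
    rcases Nat.lt_or_ge j (m + 3) with h | h
    · have := (hpast j h).1
      omega
    · obtain rfl : j = m + 3 := by omega
      omega
  have hcpast : ∀ j < m + 4, y.along c < y.along (f j) := by
    intro j hj
    rcases Nat.lt_or_ge j (m + 3) with h | h
    · exact (hpast j h).2.2
    · obtain rfl : j = m + 3 := by omega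
      omega
  have y8 := hw.l7 (m + 3) (by omega)
  have hapast : ∀ j < m + 3, y.along (f j) < y.along a ∧ x.along (f j) < x.along a :=
    fun j hj => ⟨by have := (hpast j hj).2.1; omega, (hpast j hj).1⟩
  have hc6 := hf.generic.along_ne hc mem6 x y (by omega)
  by_cases hlow : y.along c < y.along (f (m + 6))
  · -- `b` and `c` take the places of `f (m + 4)` and `f (m + 5)`
    refine ⟨b, hb, c, hc, {a}, hX1 ha, m + 4, hw.swap (hxpast (by omega)) hbx
      (fun j hj => (hpast j hj).2.1) (by omega) hcpast hcy (hxpast hac.le) hcb hlow,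
      StageExt.first hy hx ⟨hapast, ?_, ?_, ?_, Or.inr ?_⟩⟩
    · simpa using hba
    · simpa using hac.trans hcb
    · simp
      omega
    · simpa using hac
  by_cases hac5 : x.along (f (m + 5)) < x.along a
  · refine hf.extendable_of_stageExt (by omega) hL (hX1 hc) (StageExt.second hx h5
      (hw'.cornerExt_of_between (fun j hj => ?_) ?_ ?_ ?_))
    · have := hcpast j (by omega)
      simp only [Dir.along_opp]
      omega
    · rw [show m + 1 + 5 = m + 6 from rfl]
      simp only [Dir.along_opp]
      omega
    · exact hac5.trans hac
    · rw [show m + 1 + 3 = m + 4 from rfl]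
      omega
  have ha5 := hf.generic.along_ne ha mem5 y x (by omega)
  have hb5 := hf.generic.along_ne hb mem5 y x (by omega)
  by_cases hb5x : x.along (f (m + 5)) < x.along b
  · -- `b` takes the place of `f (m + 4)`
    refine ⟨b, hb, f (m + 5), mem5, {a}, hX1 ha, m + 4, hw.swap (hxpast (by omega)) hbx
      (fun j hj => (hpast j hj).2.1) (by omega) (fun j hj => hw.b5 j (by omega)) le_rfl hw.l4 hb5x
      hw.r5, StageExt.first hy hx ⟨hapast, ?_, ?_, ?_, Or.inr ?_⟩⟩
    · simpa using hba
    · simpa using hac.trans hcb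
    · simp
      omega
    · simp
      omega
  have ha4 := hf.generic.along_ne ha mem4 x y (by omega)
  by_cases hay4 : y.along (f (m + 4)) < y.along a
  · exact hf.extendable_of_stageExt (by omega) hL (hX1 ha) (StageExt.first hy hx
      (hw.cornerExt_of_between (fun j hj => (hpast j hj).1) (by omega) hay4 (by omega)))
  subst hy hx
  refine hf.extendable_of_stageExt (by omega) hL (X := {a, b, c}) ?_ (Or.inr (Or.inr (Or.inl
    ⟨rfl, a, b, c, rfl, ⟨⟨hapast, fun j hj => ⟨(hpast j hj).2.1, ?_⟩, hba, by omega, by omega,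
    by omega⟩, fun j hj => ⟨(hpast j hj).2.2, ?_⟩, hac, hcb, by omega⟩⟩)))
  · rintro z (rfl | rfl | rfl) <;> assumption
  · exact hxpast (by omega) j (by omega)
  · exact hxpast (by omega) j (by omega)

/-- A triple in a turn of a spiral that turns from `x` to `y`: the pins `f (m + 3)`, `f (m + 4)`,
`f (m + 5)` point in the directions `y.opp`, `x` and `y`. -/
theorem TightSpiral.extendable_of_anticlockwise (hf : TightSpiral P δ L f) (hm : 2 ≤ m)
    (hL : m + 9 < L) (hy : δ (m + 3) = y.opp) (hx : δ (m + 4) = x) (ha : a ∈ P) (hb : b ∈ P)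
    (hc : c ∈ P) (hac : x.along a < x.along c) (hcb : x.along c < x.along b)
    (hba : y.along b < y.along a) (hcb' : y.along c < y.along b)
    (hpast : ∀ j < m + 3, x.along (f j) < x.along a ∧ y.along (f j) < y.along b ∧
      y.along c < y.along (f j))
    (htouch : y.along (f (m + 3)) ≤ y.along c ∨ x.along a ≤ x.along (f (m + 4)) ∨
      y.along b ≤ y.along (f (m + 5))) :
    Extendable P δ f m := by
  have h5 : δ (m + 5) = y := by
    rw [show m + 5 = m + 3 + 2 from rfl, hf.opp, hy, Dir.opp_opp]
  have hw : Window δ f (m + 1) x y := by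
    subst h5 hx
    exact hf.toIsSpiral.window (by omega) (by omega)
  have hw' : Window δ f m y.opp x := by
    have := hf.toIsSpiral.window (k := m) (by omega) (by omega)
    rwa [hx, hy] at this
  have hX1 : ∀ {z}, z ∈ P → ({z} : Set Pt) ⊆ P := fun hz => Set.singleton_subset_iff.2 hz
  have hp0 := hpast 0 (by omega)
  have x3 : x.along (f (m + 3)) < x.along (f 0) := hw.l1 0 (by omega)
  have y3 : y.along (f (m + 3)) < y.along (f 0) := hw.b2 0 (by omega)
  have y4 : y.along (f (m + 4)) < y.along (f 0) := hw.l2 0 (by omega)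
  have y34 : y.along (f (m + 3)) < y.along (f (m + 4)) := hw.r2
  have x4 : x.along (f 0) < x.along (f (m + 4)) := hw.b3 0 (by omega)
  have x54 : x.along (f (m + 5)) < x.along (f (m + 4)) := hw.r3
  have x5 : x.along (f 0) < x.along (f (m + 5)) := hw.l3 0 (by omega)
  have y5 : y.along (f 0) < y.along (f (m + 5)) := hw.b4 0 (by omega)
  have y65 : y.along (f (m + 6)) < y.along (f (m + 5)) := hw.r4
  have x6 : x.along (f (m + 6)) < x.along (f 0) := hw.b5 0 (by omega)
  have x9 : x.along (f (m + 4)) < x.along (f (m + 9)) := hw.l7 (m + 4) (by omega)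
  have mem3 := hf.mem (m + 3) (by omega)
  have mem4 := hf.mem (m + 4) (by omega)
  have mem5 := hf.mem (m + 5) (by omega)
  have mem6 := hf.mem (m + 6) (by omega)
  -- a point to the left of `f (m + 4)` is below `f (m + 5)`
  have hup : x.along a < x.along (f (m + 4)) → y.along a ≤ y.along (f (m + 5)) := by
    intro h1
    have := hf.along_le (i := m + 4) (j := 0) (z := a) (by omega) (by omega) ha (by omega)
    rw [hx, show m + 4 + 1 = m + 5 from rfl, h5] at this
    exact this (by omega) h1
  have hby : y.along b < y.along (f (m + 5)) := by
    rcases htouch with h | h | h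
    · have h1 := hf.generic.along_ne hc mem3 x y (by omega)
      have h2 := hf.along_le (i := m + 3) (j := 0) (z := c) (by omega) (by omega) hc (by omega)
      rw [hy, show m + 3 + 1 = m + 4 from rfl, hx] at h2
      simp only [Dir.along_opp] at h2
      have h3 := h2 (by omega) (by omega)
      have := hup (by omega)
      omega
    · have h1 := hf.generic.along_ne ha mem4 y x (by omega)
      have := hup (by omega)
      omega
    · by_contra hcon
      have h1 : y.along b = y.along (f (m + 5)) := by omega
      have h2 := hf.generic _ hb _ mem5 y h1
      have := hup (by rw [← h2] at x54; omega)
      omega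
  have hb4 := hf.generic.along_ne hb mem4 y x (by omega)
  by_cases hbx : x.along (f (m + 4)) < x.along b
  · refine hf.extendable_of_stageExt (by omega) hL (hX1 hb) (StageExt.second hx h5
      (hf.cornerExt_of_beyond hw (by omega) (by omega) hb (fun j hj => ?_) hby hbx))
    rcases Nat.lt_or_ge j (m + 3) with h | h
    · exact (hpast j h).2.1
    · have hj' : j = m + 3 ∨ j = m + 4 := by omega
      rcases hj' with rfl | rfl <;> omega
  have hay := hup (by omega)
  have hxpast : ∀ {z}, x.along a ≤ x.along z → ∀ j < m + 4, x.along (f j) < x.along z := by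
    intro z hz j hj
    rcases Nat.lt_or_ge j (m + 3) with h | h
    · have := (hpast j h).1
      omega
    · obtain rfl : j = m + 3 := by omega
      omega
  have hypast : ∀ {z}, y.along b ≤ y.along z → ∀ j < m + 4, y.along (f j) < y.along z := by
    intro z hz j hj
    rcases Nat.lt_or_ge j (m + 3) with h | h
    · have := (hpast j h).2.1
      omega
    · obtain rfl : j = m + 3 := by omega
      omega
  have hc3 := hf.generic.along_ne hc mem3 x y (by omega)
  by_cases hcy : y.along c < y.along (f (m + 3))
  · refine hf.extendable_of_stageExt (by omega) hL (hX1 hc) (StageExt.first hy hx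
      (hf.cornerExt_of_beyond hw' hm (by omega) hc (hxpast hac.le) (by omega) ?_))
    simp only [Dir.along_opp]
    omega
  -- now the whole triple lies in the same turn of the spiral
  have hbpast : ∀ j < m + 1 + 3, x.along (f j) < x.along b ∧ y.along (f j) < y.along b :=
    fun j hj => ⟨hxpast (by omega) j hj, hypast le_rfl j hj⟩
  have ha6 := hf.generic.along_ne ha mem6 x y (by omega)
  by_cases hhigh : y.along (f (m + 6)) < y.along a
  · -- `c` and `a` take the places of `f (m + 4)` and `f (m + 5)`
    refine ⟨c, hc, a, ha, {b}, hX1 hb, m + 5, hw'.swap (hxpast hac.le) (by omega)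
      (fun j hj => ?_) ?_ (fun j hj => ?_) ?_ (hxpast le_rfl) hac ?_,
      StageExt.second hx h5 ⟨hbpast, ?_, ?_, ?_, Or.inl ?_⟩⟩
    · have := (hpast j hj).2.2
      simp only [Dir.along_opp]
      omega
    · simp only [Dir.along_opp]
      omega
    · have := hypast hba.le j hj
      simp only [Dir.along_opp]
      omega
    · simp only [Dir.along_opp]
      omega
    · simp only [Dir.along_opp]
      omega
    · simpa using hac.trans hcb
    · simpa using hba
    · rw [show m + 1 + 8 = m + 9 from rfl]
      simp
      omega
    · simpa using hcb
  by_cases hbx5 : x.along (f (m + 5)) < x.along b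
  · refine hf.extendable_of_stageExt (by omega) hL (hX1 hb) (StageExt.second hx h5
      (hw.cornerExt_of_between (fun j hj => (hbpast j hj).2) ?_ hbx5 ?_))
    · rw [show m + 1 + 5 = m + 6 from rfl]
      omega
    · rw [show m + 1 + 3 = m + 4 from rfl]
      omega
  have hb5 := hf.generic.along_ne hb mem5 y x (by omega)
  have hc4 := hf.generic.along_ne hc mem4 x y (by omega)
  by_cases hcy4 : y.along c < y.along (f (m + 4))
  · refine hf.extendable_of_stageExt (by omega) hL (hX1 hc) (StageExt.first hy hx
      (hw'.cornerExt_of_between (fun j hj => hxpast hac.le j (by omega)) (by omega) ?_ ?_))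
    · simp only [Dir.along_opp]
      omega
    · simp only [Dir.along_opp]
      omega
  subst h5 hx
  refine hf.extendable_of_stageExt (by omega) hL (X := {b, a, c}) ?_ (Or.inr (Or.inr (Or.inr
    ⟨rfl, b, a, c, rfl, ⟨⟨hbpast, fun j hj => ⟨hxpast le_rfl j hj, hypast hba.le j hj⟩, ?_, hba,
    ?_, ?_⟩, fun j hj => ⟨hxpast hac.le j (by omega), (hpast j hj).2.2⟩, hac, hcb, ?_⟩⟩)))
  · rintro z (rfl | rfl | rfl) <;> assumption
  · omega
  · rw [show m + 1 + 4 = m + 5 from rfl]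
    omega
  · rw [show m + 1 + 5 = m + 6 from rfl]
    omega
  · rw [show m + 1 + 3 = m + 4 from rfl]
    omega

end

/-! ### Spirals in turn-free stretches of pin sequences -/

/-- The directions of a spiral that starts with the directions `d`, `e`. -/
def spiralDir (d e : Dir) : ℕ → Dir
  | 0 => d
  | 1 => e
  | i + 2 => (spiralDir d e i).opp

theorem spiralDir_perp {d e : Dir} (h : Perp d e) :
    ∀ i, Perp (spiralDir d e i) (spiralDir d e (i + 1))
  | 0 => h
  | 1 => h.opp_left.symm
  | i + 2 => (spiralDir_perp h i).opp_left.opp_right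

/-- A stretch of a pin sequence without turns is a spiral, and it has no shortcuts if the number
of turns is the greatest possible. -/
theorem IsProperPinSeq.exists_tightSpiral {S : Set Pt} (hfin : S.Finite) (hgen : Generic S)
    {L : ℕ} {p : ℕ → Pt} (hp : IsProperPinSeq S L p)
    (hmax : ∀ L' p', IsProperPinSeq S L' p' → p' 0 = p 0 → p' 1 = p 1 → p' (L' - 1) = p (L - 1) →
      (turns p' L').card ≤ (turns p L).card)
    {n N : ℕ} (hN : 4 ≤ N) (hL : n + N ≤ L)
    (hturn : ∀ j, 4 ≤ j → j < N → ¬ IsTurn p (n + j)) :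
    ∃ δ, TightSpiral S δ N (fun j => p (n + j)) ∧ ∀ j, 2 ≤ j → j < N → δ j = dirOf p (n + j) := by
  set δ := spiralDir (dirOf p (n + 2)).opp (dirOf p (n + 3)).opp with hδdef
  have hperp : ∀ i, Perp (δ i) (δ (i + 1)) :=
    spiralDir_perp (hp.perp (i := n + 2) (by omega) (by omega)).opp_left.opp_right
  have hopp : ∀ i, δ (i + 2) = (δ i).opp := fun i => rfl
  have hδ : ∀ j, j + 2 < N → δ (j + 2) = dirOf p (n + (j + 2)) := by
    intro j
    induction j using Nat.strong_induction_on with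
    | _ j ih =>
      intro hj
      match j, ih, hj with
      | 0, _, _ => exact Dir.opp_opp _
      | 1, _, _ => exact Dir.opp_opp _
      | j + 2, ih, hj =>
        rw [hopp, ih j (by omega) (by omega)]
        exact (hp.dirOf_eq_opp (i := n + (j + 2)) (by omega) (by omega)
          (hturn (j + 4) (by omega) (by omega))).symm
  have hδ' : ∀ j, 2 ≤ j → j < N → δ j = dirOf p (n + j) := by
    intro j h2 hj
    obtain ⟨j, rfl⟩ := Nat.exists_eq_add_of_le' h2
    exact hδ j hj
  have hδ4 : ∀ k, δ (k + 4) = δ k := fun k => by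
    rw [show k + 4 = k + 2 + 2 from rfl, hopp, hopp, Dir.opp_opp]
  refine ⟨δ, ⟨⟨hperp, hopp, by omega, ?_, fun _ => ?_, ?_, ?_, ?_⟩, hgen,
    fun i hi => hp.mem _ (by omega), ?_, ?_⟩, hδ'⟩
  · rcases Nat.eq_zero_or_pos n with rfl | hn
    · simpa using hp.ne
    · intro he
      have := hp.beyond (i := n + 1) (j := n) (by omega) (by omega) (by omega)
      rw [← he] at this
      exact lt_irrefl _ this
  · rw [hδ' 2 le_rfl (by omega)]
    rcases Nat.eq_zero_or_pos n with rfl | hn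
    · have h := (hp.hasDir (i := 2) le_rfl (by omega)).2
      simpa using h
    · have hq := hp.perp (i := n + 1) (by omega) (by omega)
      refine (slicesFrom_iff hq.symm).2 ⟨?_, ⟨p (n + 0), mem_initial (p := fun j => p (n + j))
        (by omega), ?_⟩, p (n + 1), mem_initial (p := fun j => p (n + j)) (by omega), ?_⟩
      · rintro _ ⟨j, hj, rfl⟩
        change j < 2 at hj
        exact hp.beyond (by omega) (by omega) (by omega)
      · exact hp.between_left (i := n + 1) (by omega) (by omega) (by omega)
      · exact hp.between_right (i := n + 1) (by omega) (by omega)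
  · intro i j hi hL' hj
    rw [hδ' i hi hL']
    exact hp.beyond (by omega) (by omega) (by omega)
  · intro i j hi hL' hj
    rw [hδ' i hi (by omega)]
    exact hp.between_left (i := n + i) (by omega) (by omega) (by omega)
  · intro i hi hL'
    rw [hδ' i hi (by omega)]
    exact hp.between_right (i := n + i) (by omega) (by omega)
  · intro i hi hL' z hz hs
    rw [hδ' i hi hL'] at hs ⊢
    have hsub : initial (fun j => p (n + j)) i ⊆ initial p (n + i) := by
      rintro _ ⟨j, hj, rfl⟩
      change j < i at hj
      exact mem_initial (by omega)
    by_contra hcon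
    push Not at hcon
    obtain ⟨-, ⟨u, hu, hu'⟩, v, hv, hv'⟩ := hs
    refine absurd (hp.maximal (by omega) (by omega) hz
      ⟨?_, ⟨u, hsub hu, hu'⟩, v, hsub hv, hv'⟩) (not_le.2 hcon)
    rintro _ ⟨j, hj, rfl⟩
    exact (hp.beyond (by omega) (by omega) hj).trans hcon
  · intro k hk hL' z hz hl hr ht
    have e4 := hδ' (k + 4) (by omega) (by omega)
    have e3 := hδ' (k + 3) (by omega) (by omega)
    by_contra hcon
    push Not at hcon
    -- the pin `k` of the spiral bounds the pins before the stretch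
    have hl' : ∀ j < n + (k + 4), (δ (k + 4)).along (p j) < (δ (k + 4)).along z := by
      intro j hj
      rcases Nat.lt_or_ge j n with hjn | hjn
      · have h1 := hl k (by omega)
        have h2 := hp.beyond (i := n + k) (j := j) (by omega) (by omega) (by omega)
        rw [← hδ' k hk (by omega), ← hδ4] at h2
        exact h2.trans h1
      · obtain ⟨j, rfl⟩ := Nat.exists_eq_add_of_le hjn
        exact hl j (by omega)
    rw [e4] at hl' hr
    rw [e3] at hcon
    obtain ⟨L', p', h1, h2, h3, h4, h5⟩ := exists_more_turns hfin hgen hp (i := n + (k + 4))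
      (by omega) (by omega)
      ((hδ' (k + 5) (by omega) (by omega)).symm.trans (by
        rw [show n + (k + 4) - 1 = n + (k + 3) by omega, ← e3]; exact hopp (k + 3)))
      ((hδ' (k + 6) (by omega) (by omega)).symm.trans (by rw [← e4]; exact hopp (k + 4)))
      ((hδ' (k + 7) (by omega) (by omega)).symm.trans (by
        rw [show n + (k + 4) - 1 = n + (k + 3) by omega, ← e3]; exact hδ4 (k + 3)))
      ((hδ' (k + 8) (by omega) (by omega)).symm.trans (by rw [← e4]; exact hδ4 (k + 4)))
      hz hl' hr hcon
    exact absurd (hmax L' p' h1 h2 h3 h4) (not_le.2 h5)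

section

variable {P : Set Pt} {δ : ℕ → Dir} {L J : ℕ} {f : ℕ → Pt} {x y : Dir} {a b c : Pt}

/-- A pin of a spiral that newly touches a triple of the wedge gives rise to an extension of one
of the next or last few pins. -/
theorem TightSpiral.exists_extendable (hf : TightSpiral P δ L f) (hxy : Perp x y) (hJ : 7 ≤ J)
    (hL : J + 6 < L) (ha : a ∈ P) (hb : b ∈ P) (hc : c ∈ P) (hac : x.along a < x.along c)
    (hcb : x.along c < x.along b) (hba : y.along b < y.along a) (hcb' : y.along c < y.along b)
    (hpast : ∀ j < J, x.along (f j) < x.along a ∧ y.along (f j) < y.along b ∧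
      y.along c < y.along (f j))
    (htouch : (δ J = x ∧ x.along a ≤ x.along (f J)) ∨ (δ J = y ∧ y.along b ≤ y.along (f J)) ∨
      (δ J = y.opp ∧ y.along (f J) ≤ y.along c)) :
    ∃ m, m + 3 ≤ J ∧ J ≤ m + 5 ∧ Extendable P δ f m := by
  obtain ⟨k, rfl⟩ : ∃ k, J = k + 5 := ⟨J - 5, by omega⟩
  have o : ∀ i, δ (i + 2) = (δ i).opp := hf.opp
  have hopp : ∀ {i d}, δ (i + 2) = d → δ i = d.opp := by
    rintro i d rfl
    rw [o, Dir.opp_opp]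
  rcases htouch with ⟨h, ht⟩ | ⟨h, ht⟩ | ⟨h, ht⟩
  · refine ⟨k + 1, by omega, by omega, ?_⟩
    have h4 : Perp x (δ (k + 4)) := by
      rw [← h]
      exact (hf.perp (k + 4)).symm
    rcases hxy.symm.eq_or_eq_opp h4 with h4 | h4
    · exact hf.extendable_of_clockwise (by omega) (by omega) h4 h ha hb hc hac hcb hba hcb'
        (fun j hj => hpast j (by omega)) (Or.inr (Or.inl ht))
    · exact hf.extendable_of_anticlockwise (by omega) (by omega) h4 h ha hb hc hac hcb hba hcb'
        (fun j hj => hpast j (by omega)) (Or.inr (Or.inl ht))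
  · have h6 : Perp y (δ (k + 6)) := by
      rw [← h]
      exact hf.perp (k + 5)
    rcases hxy.eq_or_eq_opp h6 with h6 | h6
    · exact ⟨k + 2, by omega, by omega, hf.extendable_of_clockwise (by omega) (by omega) h h6 ha hb
        hc hac hcb hba hcb' (fun j hj => hpast j (by omega)) (Or.inl ht)⟩
    · refine ⟨k, by omega, by omega, hf.extendable_of_anticlockwise (by omega) (by omega) (hopp h)
        ?_ ha hb hc hac hcb hba hcb' (fun j hj => hpast j (by omega)) (Or.inr (Or.inr ht))⟩
      rw [hopp h6, Dir.opp_opp]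
  · have h6 : Perp y (δ (k + 6)) := by
      have := hf.perp (k + 5)
      rw [h] at this
      simpa using this.opp_left
    rcases hxy.eq_or_eq_opp h6 with h6 | h6
    · exact ⟨k + 2, by omega, by omega, hf.extendable_of_anticlockwise (by omega) (by omega) h h6
        ha hb hc hac hcb hba hcb' (fun j hj => hpast j (by omega)) (Or.inl ht)⟩
    · refine ⟨k, by omega, by omega, hf.extendable_of_clockwise (by omega) (by omega) ?_
        ?_ ha hb hc hac hcb hba hcb' (fun j hj => hpast j (by omega))
        (Or.inr (Or.inr ⟨ht, fun j hj => (hpast j hj).2.2⟩))⟩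
      · rw [hopp h, Dir.opp_opp]
      · rw [hopp h6, Dir.opp_opp]

theorem TightSpiral.isExtendedSpiral (hf : TightSpiral P δ L f) (E : Finset ℕ)
    (hE : ∀ m ∈ E, 1 ≤ m ∧ m + 9 < L) (hsp : ∀ m ∈ E, ∀ m' ∈ E, m < m' → m + 6 ≤ m')
    (hext : ∀ m ∈ E, Extendable P δ f m) : ∃ S ⊆ P, IsExtendedSpiral S E.card := by
  choose! u hu v hv X hX ι hsw hst using hext
  exact isExtendedSpiral_of_stageExt hf.toIsSpiral hf.mem E u v X ι hE hsp hu hv hX hsw hst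

end

/-! ### Counting newly touched triples -/

open Classical in
/-- The pins among `p 2, …, p (L - 1)` that newly touch a triple. -/
noncomputable def touchingPins (x y : Dir) {h : ℕ} (a b c : Fin h → Pt) (p : ℕ → Pt) (L : ℕ) :
    Finset ℕ :=
  (Finset.Ico 2 L).filter fun i => ∃ j, ¬ Touched x y a b c p i j ∧ Touched x y a b c p (i + 1) j

theorem mem_touchingPins {x y : Dir} {h : ℕ} {a b c : Fin h → Pt} {p : ℕ → Pt} {L i : ℕ} :
    i ∈ touchingPins x y a b c p L ↔ (2 ≤ i ∧ i < L) ∧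
      ∃ j, ¬ Touched x y a b c p i j ∧ Touched x y a b c p (i + 1) j := by
  simp [touchingPins]

/-- If the first two pins form the first copy of 21 and all triples get touched, then few new
triples at a time means many touching pins. -/
theorem DirWedge.le_card_touchingPins {x y : Dir} {h : ℕ} {a b c : Fin h → Pt}
    (hw : DirWedge x y a b c) {p : ℕ → Pt} {L : ℕ} {j₀ : Fin h} (hj₀ : ∀ j, j₀ ≤ j)
    (h0 : p 0 = a j₀) (h1 : p 1 = b j₀) (hL : ∀ j, Touched x y a b c p L j) {k : ℕ}
    (hk : ∀ i, 2 ≤ i → i < L → ∀ J : Finset (Fin h), (∀ j ∈ J, ¬ Touched x y a b c p i j) →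
      (∀ j ∈ J, Touched x y a b c p (i + 1) j) → J.card ≤ k) :
    h ≤ 1 + (touchingPins x y a b c p L).card * k := by
  classical
  set N : ℕ → Finset (Fin h) := fun i => Finset.univ.filter fun j =>
    ¬ Touched x y a b c p i j ∧ Touched x y a b c p (i + 1) j
  have hcover : (Finset.univ : Finset (Fin h)) ⊆
      {j₀} ∪ (touchingPins x y a b c p L).biUnion N := by
    intro j _
    rw [Finset.mem_union, Finset.mem_singleton, or_iff_not_imp_left]
    intro hne
    have hlt : j₀ < j := lt_of_le_of_ne (hj₀ j) (Ne.symm hne)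
    have h2 : ¬ Touched x y a b c p 2 j := by
      rintro ⟨l, hl, hl'⟩
      have e1 := hw.ba_lt hlt
      have e2 := hw.ab_lt hlt
      have e3 := hw.cb_lt j j₀
      have e4 := hw.ba j₀
      have e5 := hw.ac j₀
      have e6 := hw.cb j₀
      interval_cases l
      · rw [h0] at hl'
        omega
      · rw [h1] at hl'
        omega
    have hex : ∃ i, Touched x y a b c p i j := ⟨L, hL j⟩
    have hmono : ∀ {i i'}, i ≤ i' → Touched x y a b c p i j → Touched x y a b c p i' j := by
      rintro i i' hi ⟨l, hl, hl'⟩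
      exact ⟨l, by omega, hl'⟩
    have hspec := Nat.find_spec hex
    have hfL : Nat.find hex ≤ L := Nat.find_min' hex (hL j)
    have hf2 : 2 < Nat.find hex := by
      by_contra hcon
      exact h2 (hmono (by omega) hspec)
    have hpred := Nat.find_min hex (m := Nat.find hex - 1) (by omega)
    rw [show Nat.find hex = Nat.find hex - 1 + 1 by omega] at hspec
    exact Finset.mem_biUnion.2 ⟨Nat.find hex - 1, mem_touchingPins.2
      ⟨⟨by omega, by omega⟩, j, hpred, hspec⟩,
      Finset.mem_filter.2 ⟨Finset.mem_univ _, hpred, hspec⟩⟩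
  calc h = (Finset.univ : Finset (Fin h)).card := by simp
    _ ≤ _ := Finset.card_le_card hcover
    _ ≤ _ := Finset.card_union_le _ _
    _ ≤ 1 + (touchingPins x y a b c p L).card * k := by
      rw [Finset.card_singleton]
      refine Nat.add_le_add_left (Finset.card_biUnion_le_card_mul _ _ _ fun i hi => ?_) 1
      have hi := (mem_touchingPins.1 hi).1
      exact hk i hi.1 hi.2 _ (fun j hj => (Finset.mem_filter.1 hj).2.1)
        fun j hj => (Finset.mem_filter.1 hj).2.2

/-- In a stretch of pins without turns, every sixth touching pin gives rise to an extension. No pin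
opposite to `x` touches new triples, so any four consecutive touching pins span at least five
indices; this keeps the stages of the extensions apart. -/
theorem DirWedge.exists_isExtendedSpiral {S : Set Pt} (hfin : S.Finite) (hgen : Generic S)
    {x y : Dir} (hxy : Perp x y) {h : ℕ} {a b c : Fin h → Pt} (hw : DirWedge x y a b c)
    (habc : ∀ j, a j ∈ S ∧ b j ∈ S ∧ c j ∈ S) {L : ℕ} {p : ℕ → Pt} (hp : IsProperPinSeq S L p)
    (hmax : ∀ L' p', IsProperPinSeq S L' p' → p' 0 = p 0 → p' 1 = p 1 → p' (L' - 1) = p (L - 1) →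
      (turns p' L').card ≤ (turns p L).card)
    {s : ℕ} {C : Finset ℕ} (hC : C ⊆ touchingPins x y a b c p L) (hcard : 6 * s + 4 ≤ C.card)
    (hturn : ∀ i ∈ C, ∀ i' ∈ C, ∀ l, i < l → l ≤ i' → ¬ IsTurn p l) :
    ∃ X ⊆ S, IsExtendedSpiral X s := by
  classical
  obtain ⟨C', hC', hcard'⟩ := Finset.exists_subset_card_eq hcard
  set σ := C'.orderEmbOfFin hcard'
  have hmem : ∀ n, σ n ∈ C := fun n => hC' (Finset.orderEmbOfFin_mem C' hcard' n)
  set idx : ℕ → ℕ := fun n => if hn : n < 6 * s + 4 then σ ⟨n, hn⟩ else 0 with hidx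
  have hidxC : ∀ n < 6 * s + 4, idx n ∈ C := by
    intro n hn
    simp only [hidx, dif_pos hn, hmem]
  have hmono : ∀ n, n + 1 < 6 * s + 4 → idx n < idx (n + 1) := by
    intro n hn
    simp only [hidx, dif_pos hn, dif_pos (show n < 6 * s + 4 by omega)]
    exact σ.strictMono (by simp)
  have htp : ∀ n < 6 * s + 4, _ := fun n hn => mem_touchingPins.1 (hC (hidxC n hn))
  have h0 := (htp 0 (by omega)).1
  have hlast := (htp (6 * s + 3) (by omega)).1
  have hle : ∀ n < 6 * s + 4, idx 0 + n ≤ idx n := by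
    intro n
    induction n with
    | zero => intro _; simp
    | succ n ih =>
      intro hn
      have := ih (by omega)
      have := hmono n hn
      omega
  have hle' : ∀ k, k < 6 * s + 4 → idx (6 * s + 3 - k) + k ≤ idx (6 * s + 3) := by
    intro k
    induction k with
    | zero => intro _; simp
    | succ k ih =>
      intro hk
      have h1 := ih (by omega)
      have h2 := hmono (6 * s + 3 - (k + 1)) (by omega)
      rw [show 6 * s + 3 - (k + 1) + 1 = 6 * s + 3 - k by omega] at h2
      omega
  have hnl := hle (6 * s + 3) (by omega)
  obtain ⟨n, hn⟩ : ∃ n, idx 0 = n + 2 := ⟨idx 0 - 2, by omega⟩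
  obtain ⟨N, hN⟩ : ∃ N, idx (6 * s + 3) + 1 = n + N := ⟨idx (6 * s + 3) + 1 - n, by omega⟩
  obtain ⟨δ, hf, hδ⟩ := hp.exists_tightSpiral hfin hgen hmax (n := n) (N := N) (by omega)
    (by omega) fun j h4 hj => hturn _ (hidxC 0 (by omega)) _ (hidxC (6 * s + 3) (by omega)) _
      (by omega) (by omega)
  have hin : ∀ k < 6 * s + 4, n + 2 ≤ idx k ∧ idx k < n + N := by
    intro k hk
    have h1 := hle k hk
    have h2 := hle' (6 * s + 3 - k) (by omega)
    rw [show 6 * s + 3 - (6 * s + 3 - k) = k by omega] at h2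
    omega
  have hnt : ∀ k < 6 * s + 4, ∃ j, ¬ Touched x y a b c p (idx k) j ∧
      ((dirOf p (idx k) = x ∧ x.along (a j) ≤ x.along (p (idx k))) ∨
      (dirOf p (idx k) = y ∧ y.along (b j) ≤ y.along (p (idx k))) ∨
      (dirOf p (idx k) = y.opp ∧ y.along (p (idx k)) ≤ y.along (c j))) := by
    intro k hk
    obtain ⟨⟨h2, hL⟩, j, hj, hj'⟩ := htp k hk
    exact ⟨j, hj, newly_touched hxy hp h2 hL hj hj'⟩
  have hne : ∀ k < 6 * s + 4, ∀ l, idx k = n + l → δ l ≠ x.opp := by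
    intro k hk l hl he
    obtain ⟨h2, hN'⟩ := hin k hk
    obtain ⟨j, -, hj⟩ := hnt k hk
    rw [hl, ← hδ l (by omega) (by omega), he] at hj
    rcases hj with ⟨hj, -⟩ | ⟨hj, -⟩ | ⟨hj, -⟩
    · exact x.opp_ne hj
    · exact hxy.2 hj.symm
    · exact hxy.1 (by rw [← Dir.opp_opp y, ← hj, Dir.opp_opp])
  have hgap : ∀ k, k + 3 < 6 * s + 4 → idx k + 4 ≤ idx (k + 3) := by
    intro k hk
    by_contra hcon
    have e0 := hmono k (by omega)
    have e1 : _ < idx (k + 2) := hmono (k + 1) (by omega)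
    have e2 : _ < idx (k + 3) := hmono (k + 2) (by omega)
    have h2 := (hin k (by omega)).1
    obtain ⟨l, hl⟩ := Nat.exists_eq_add_of_le h2
    rcases hf.dir_cases (l + 2) x.opp with he | he | he | he
    · exact hne k (by omega) (l + 2) (by omega) he.symm
    · exact hne (k + 1) (by omega) (l + 2 + 1) (by omega) he.symm
    · exact hne (k + 2) (by omega) (l + 2 + 2) (by omega) he.symm
    · exact hne (k + 3) (by omega) (l + 2 + 3) (by omega) he.symm
  -- the first four and the last four touching pins leave room for the stages that are used
  have hstage : ∀ t < s, ∃ m, n + m + 3 ≤ idx (4 + 6 * t) ∧ idx (4 + 6 * t) ≤ n + m + 5 ∧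
      (2 ≤ m ∧ m + 9 < N) ∧ Extendable S δ (fun j => p (n + j)) m := by
    intro t ht
    have e1 : idx 1 + 4 ≤ idx 4 := hgap 1 (by omega)
    have e2 : idx 0 < idx 1 := hmono 0 (by omega)
    have e3 : idx 4 ≤ idx (4 + 6 * t) := by
      simp only [hidx, dif_pos (show 4 < 6 * s + 4 by omega),
        dif_pos (show 4 + 6 * t < 6 * s + 4 by omega)]
      exact σ.monotone (by simp)
    have e4 : _ ≤ idx (4 + 6 * t + 5) := hgap (4 + 6 * t + 2) (by omega)
    have e5 := hmono (4 + 6 * t) (by omega)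
    have e6 : _ < idx (4 + 6 * t + 2) := hmono (4 + 6 * t + 1) (by omega)
    have e7 := (hin (4 + 6 * t + 5) (by omega)).2
    obtain ⟨J, hJ⟩ := Nat.exists_eq_add_of_le (show n ≤ idx (4 + 6 * t) by omega)
    obtain ⟨j, hj, hj'⟩ := hnt (4 + 6 * t) (by omega)
    rw [hJ, ← hδ J (by omega) (by omega)] at hj'
    obtain ⟨m, hm1, hm2, hm⟩ := hf.exists_extendable hxy (J := J) (by omega) (by omega)
      (habc j).1 (habc j).2.1 (habc j).2.2 (hw.ac j) (hw.cb j) (hw.ba j) (hw.cb_lt j j)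
      (fun l hl => not_touched hj (by omega)) hj'
    exact ⟨m, by omega, by omega, ⟨by omega, by omega⟩, hm⟩
  choose! M hM1 hM2 hM3 hM4 using hstage
  have hMlt : ∀ t t', t < t' → t' < s → M t + 6 ≤ M t' := by
    intro t t' htt ht'
    have e1 := hgap (4 + 6 * t) (by omega)
    have e2 : _ ≤ idx (4 + 6 * t + 6) := hgap (4 + 6 * t + 3) (by omega)
    have e3 : idx (4 + 6 * t + 6) ≤ idx (4 + 6 * t') := by
      simp only [hidx, dif_pos (show 4 + 6 * t + 6 < 6 * s + 4 by omega),
        dif_pos (show 4 + 6 * t' < 6 * s + 4 by omega)]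
      refine σ.monotone ?_
      rw [Fin.mk_le_mk]
      omega
    have := hM1 t (by omega)
    have := hM2 t' ht'
    omega
  have hMinj : ∀ t < s, ∀ t' < s, M t < M t' → t < t' := by
    intro t ht t' _ hlt
    by_contra hcon
    rcases Nat.lt_or_ge t' t with h1 | h1
    · have := hMlt t' t h1 ht
      omega
    · rw [show t = t' by omega] at hlt
      exact lt_irrefl _ hlt
  have hEcard : ((Finset.range s).image M).card = s := by
    rw [Finset.card_image_of_injOn, Finset.card_range]
    intro t ht t' ht' he
    simp only [Finset.coe_range, Set.mem_Iio] at ht ht'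
    rcases lt_trichotomy t t' with h1 | h1 | h1
    · have := hMlt t t' h1 ht'
      omega
    · exact h1
    · have := hMlt t' t h1 ht
      omega
  have hres := hf.isExtendedSpiral ((Finset.range s).image M) ?_ ?_ ?_
  · rwa [hEcard] at hres
  · intro m hm
    obtain ⟨t, ht, rfl⟩ := Finset.mem_image.1 hm
    have := hM3 t (Finset.mem_range.1 ht)
    omega
  · intro m hm m' hm' hlt
    obtain ⟨t, ht, rfl⟩ := Finset.mem_image.1 hm
    obtain ⟨t', ht', rfl⟩ := Finset.mem_image.1 hm'
    rw [Finset.mem_range] at ht ht'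
    exact hMlt t t' (hMinj t ht t' ht' hlt) ht'
  · intro m hm
    obtain ⟨t, ht, rfl⟩ := Finset.mem_image.1 hm
    exact hM4 t (Finset.mem_range.1 ht)

end SawtoothPin

open SawtoothPin

theorem mainTheorem3 (m p s : ℕ) (hm : 0 < m) {n : ℕ} (π : Equiv.Perm (Fin n))
    (hπ : SawtoothPin.IsSimple π)
    (hw : SawtoothPin.ContainsWedge π (3 * m * p * (2 * s + 1))) :
    SawtoothPin.ContainsSlicedWedge π m ∨
      SawtoothPin.ContainsPinSeqWithTurns π p ∨
      SawtoothPin.ContainsExtendedSpiral π s := by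
  classical
  obtain ⟨k, rfl⟩ : ∃ k, m = k + 1 := ⟨m - 1, by omega⟩
  by_cases hsliced : ContainsSlicedWedge π (k + 1)
  · exact Or.inl hsliced
  by_cases hpin : ContainsPinSeqWithTurns π p
  · exact Or.inr (Or.inl hpin)
  refine Or.inr (Or.inr ?_)
  have hfew : ∀ L q, IsProperPinSeq (plot π) L q → (turns q L).card < p := fun L q hq => by
    by_contra hcon
    exact hpin ⟨L, q, hq, turns q L, by omega, fun i hi => mem_turns.1 hi⟩
  have hfin := plot_finite π
  have hgen := plot_generic π
  -- two points of the plot form a pin sequence with no turns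
  have hp0 : 0 < p := by
    have hn := hπ.1
    refine (Nat.zero_le _).trans_lt (hfew 2 _ (isProperPinSeq_two
      (Set.mem_range_self ⟨0, by omega⟩) (Set.mem_range_self ⟨1, by omega⟩) ?_))
    intro he
    have := congrArg Prod.fst he
    simp at this
  set h := 3 * (k + 1) * p * (2 * s + 1) with hh
  have hpos : 0 < h := by positivity
  obtain ⟨g, hg, a, b, c, habc, hw⟩ := hw
  obtain ⟨x, y, hxy, rfl⟩ := exists_frame hg
  have hw : DirWedge x y a b c := hw
  set j₀ : Fin h := ⟨0, hpos⟩
  obtain ⟨e, heP, hemax⟩ := Set.exists_max_image (plot π) x.along hfin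
    ⟨_, (habc j₀).1⟩
  have hab := (hw.ac j₀).trans (hw.cb j₀)
  have hb₀ := hemax _ (habc j₀).2.1
  obtain ⟨L₀, q₀, hq₀⟩ := exists_properPinSeq hfin hgen
    (plot_simpleSet hπ) (habc j₀).1 (habc j₀).2.1
    (fun he => by rw [he] at hab; exact lt_irrefl _ hab) heP
    (fun he => by rw [he] at hb₀; omega) hemax
  -- choose a pin sequence with the greatest number of turns
  obtain ⟨L, q, ⟨hq, hqa, hqb, hqe⟩, hmax⟩ : ∃ L q,
      (IsProperPinSeq (plot π) L q ∧ q 0 = a j₀ ∧ q 1 = b j₀ ∧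
        q (L - 1) = e) ∧
      ∀ L' q', IsProperPinSeq (plot π) L' q' → q' 0 = a j₀ →
        q' 1 = b j₀ → q' (L' - 1) = e →
        (turns q' L').card ≤ (turns q L).card := by
    set Q : ℕ → Prop := fun r => ∃ L q, (IsProperPinSeq (plot π) L q ∧
      q 0 = a j₀ ∧ q 1 = b j₀ ∧ q (L - 1) = e) ∧ (turns q L).card = r
    have hbound : ∀ r, Q r → r ≤ p := by
      rintro r ⟨L, q, hq, rfl⟩
      exact (hfew L q hq.1).le
    have hQ₀ : Q (turns q₀ L₀).card := ⟨L₀, q₀, hq₀, rfl⟩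
    obtain ⟨L, q, hq, hr⟩ := Nat.findGreatest_spec (hbound _ hQ₀) hQ₀
    refine ⟨L, q, hq, fun L' q' h1 h2 h3 h4 => ?_⟩
    have hQ' : Q (turns q' L').card := ⟨L', q', ⟨h1, h2, h3, h4⟩, rfl⟩
    rw [hr]
    exact Nat.le_findGreatest (hbound _ hQ') hQ'
  have hall : ∀ j, Touched x y a b c q L j := fun j =>
    ⟨L - 1, by have := hq.two_le; omega, Or.inl (by rw [hqe]; exact hemax _ (habc j).1)⟩
  have hcount := hw.le_card_touchingPins (fun j => Fin.mk_le_mk.2 (Nat.zero_le _)) hqa hqb hall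
    (k := k) fun i hi hL J hJ₁ hJ₂ => by
      by_contra hcon
      refine hsliced (containsSlicedWedge_of_newly_touched hg hxy hw habc hq
        (by rw [hqa, hqb]; exact hab) (by rw [hqa, hqb]; exact hw.ba j₀) hi hL (by omega) hJ₁ hJ₂)
  -- some stretch between turns has at least `6 * s + 4` touching pins
  obtain ⟨r, -, hr⟩ := Finset.exists_lt_card_fiber_of_mul_lt_card_of_maps_to
    (s := touchingPins x y a b c q L) (t := Finset.range p) (n := 6 * s + 3)
    (f := fun i => ((turns q L).filter (· ≤ i)).card)
    (fun i _ => Finset.mem_range.2 ((Finset.card_filter_le _ _).trans_lt (hfew L q hq))) (by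
      rw [Finset.card_range]
      by_contra hcon
      push Not at hcon
      have h1 := Nat.mul_le_mul_right k hcon
      have h2 : h = p * (6 * s + 3) * k + p * (6 * s + 3) := by rw [hh]; ring
      have h3 : 1 * 3 ≤ p * (6 * s + 3) := Nat.mul_le_mul hp0 (by omega)
      omega)
  refine hw.exists_isExtendedSpiral hfin hgen hxy habc hq ?_ (Finset.filter_subset _ _) hr ?_
  · rw [hqa, hqb, hqe]
    exact hmax
  · intro i hi i' hi' l hil hli' hl
    have hi := (Finset.mem_filter.1 hi).2
    have hi' := Finset.mem_filter.1 hi'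
    have hlL := (mem_touchingPins.1 hi'.1).1.2
    refine absurd (hi.trans hi'.2.symm) (Finset.card_lt_card ?_).ne
    refine Finset.ssubset_iff_subset_ne.2 ⟨Finset.monotone_filter_right _ fun u _ hu => ?_,
      fun he => ?_⟩
    · exact le_trans hu (by omega)
    · have : l ∈ (turns q L).filter (· ≤ i') :=
        Finset.mem_filter.2 ⟨mem_turns.2 ⟨by omega, hl⟩, hli'⟩
      rw [← he] at this
      have := (Finset.mem_filter.1 this).2
      omega
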